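/- Let $A\subset\mathbb R^2$ be a polygon, that is, a compact connected set which is the closure of its interior and whose topological boundary $\partial A$ is a union of finitely many pairwise disjoint simple closed polygonal curves (so $A$ need not be convex and may have holes). Let $V$ be the set of vertices of $A$ and, for $v\in V$, let $\omega_v\in(0,2\pi)\setminus\{\pi\}$ be the angle subtended by $A$ at $v$: if $\theta\in(0,\pi)$ is the angle between the two edges meeting at $v$, then $\omega_v=\theta$ if $A\cap U$ is convex for some neighbourhood $U$ of $v$, and $\omega_v=2\pi-\theta$ otherwise. Let $X_1,X_2,\dots$ be independent random points of $A$ with common probability density $f:A\to[0,\infty)$ with respect to Lebesgue measure, and suppose that $f$ (as a function on $A$) is continuous at every $x\in\partial A$. Let $f_0:=\operatorname{ess\,inf}_{x\in A}f(x)$ and $f_1:=\inf_{x\in\partial A}f(x)$. For $n,k\in\mathbb N$ let the $k$-coverage threshold be $$R_{n,k}:=\inf\{r>0:\ \text{for all } x\in A,\ \text{the closed disc } B(x,r)\text{ contains at least } k \text{ points of } \{X_1,\dots,X_n\}\},$$ with $\inf\emptyset:=+\infty$. Let $H(t):=1-t+t\log t$ for $t>0$, $H(0):=1$. For $a,x\ge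 0$ let $\hat H_a(x)$ be the unique $y\ge a$ with $y\,H(a/y)=x$, where $\hat H_0(0):=0$. Let $\beta\in[0,\infty)$ and let $k:\mathbb N\to\mathbb N=\{1,2,\dots\}$ satisfy $k(n)/\log n\to\beta$ and $k(n)/n\to0$ as $n\to\infty$. Then, almost surely, $$\lim_{n\to\infty}\frac{n\,R_{n,k(n)}^2}{\log n}=\max\left(\frac{\hat H_\beta(1)}{\pi f_0},\ \frac{2\hat H_\beta(1/2)}{\pi f_1},\ \max_{v\in V}\frac{2\beta}{\omega_v f(v)}\right).$$ In particular, for every constant $k\in\mathbb N$, almost surely, $$\lim_{n\to\infty}\frac{n\pi R_{n,k}^2}{\log n}=\max\left(\frac1{f_0},\frac1{f_1}\right).$$ Here $b/0:=+\infty$ for $b>0$, and $0/0:=0$ (the latter can occur only in the vertex terms, when $\beta=0$ and $f(v)=0$; then $f_1=0$ and the limit is $+\infty$ in any case); both limits are taken in $[0,\infty]$. -/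

import Mathlib

open MeasureTheory ProbabilityTheory Filter Topology
open scoped NNReal ENNReal

/-- The Euclidean plane. -/
abbrev Plane : Type := EuclideanSpace ℝ (Fin 2)

/-- `A` is a polygon with vertex set `V`: a compact connected set that is the closure of its
interior, and whose topological boundary is made of finitely many pairwise disjoint simple closed
polygonal curves (more than one if `A` has holes). The permutation `σ` sends every vertex to the
next one along its boundary curve, so the edges of `A` are the segments `[v, σ v]` and the boundary
curves are the cycles of `σ`. -/
structure IsPolygon (A : Set Plane) (V : Finset Plane) (σ : Equiv.Perm V) : Prop where
  isCompact : IsCompact A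
  isConnected : IsConnected A
  closure_interior : closure (interior A) = A
  frontier_eq : frontier A = ⋃ v : V, segment ℝ (v : Plane) (σ v : Plane)
  edge_nondegenerate : ∀ v : V, σ v ≠ v
  /-- Two different edges meet at most in common endpoints. -/
  edge_inter : ∀ v w : V, v ≠ w →
    segment ℝ (v : Plane) (σ v : Plane) ∩ segment ℝ (w : Plane) (σ w : Plane) ⊆
      {(v : Plane), (σ v : Plane)} ∩ {(w : Plane), (σ w : Plane)}
  /-- The two edges at a vertex do not continue each other along a line. -/
  angle_ne_pi : ∀ v : V,
    EuclideanGeometry.angle (σ.symm v : Plane) (v : Plane) (σ v : Plane) ≠ Real.pi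

open scoped Classical in
/-- The angle subtended by the polygon `A` at the vertex `v`: with `θ` the (unoriented) angle
between the two edges at `v`, it is `θ` if `A` is convex in some neighbourhood of `v`,
and `2 π - θ` otherwise. -/
noncomputable def vertexAngle (A : Set Plane) {V : Finset Plane} (σ : Equiv.Perm V) (v : V) : ℝ :=
  if ∃ U ∈ 𝓝 (v : Plane), Convex ℝ (A ∩ U) then
    EuclideanGeometry.angle (σ.symm v : Plane) (v : Plane) (σ v : Plane)
  else
    2 * Real.pi - EuclideanGeometry.angle (σ.symm v : Plane) (v : Plane) (σ v : Plane)

/-- The `k`-coverage threshold of the set `A` by the first `n` points `x 0, …, x (n - 1)` of a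
sequence: the infimum of all `r > 0` such that each closed ball of radius `r` centred in `A`
contains at least `k` points of `{x 0, …, x (n - 1)}`; it is `∞` if there is no such `r`. -/
noncomputable def coverageThreshold (A : Set Plane) (x : ℕ → Plane) (n k : ℕ) : ℝ≥0∞ :=
  ⨅ (r : ℝ) (_ : 0 < r ∧
    ∀ a ∈ A, (k : ℕ∞) ≤ ((x '' Set.Iio n) ∩ Metric.closedBall a r).encard), ENNReal.ofReal r

/-- The function `H(t) = 1 - t + t log t` for `t > 0`, with `H(0) = 1`. -/
noncomputable def rateH (t : ℝ) : ℝ :=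
  if t = 0 then 1 else 1 - t + t * Real.log t

/-- `Ĥ_a(x)`: the unique `y ≥ a` with `y H(a / y) = x`, for `a, x ≥ 0`
(see `eq_hatH_iff`; for `a = x = 0` this gives `0`). -/
noncomputable def hatH (a x : ℝ) : ℝ :=
  sInf {y : ℝ | a ≤ y ∧ y * rateH (a / y) = x}

theorem mul_rateH_div {a y : ℝ} (ha : 0 < a) (hy : 0 < y) :
    y * rateH (a / y) = y - a + a * (Real.log a - Real.log y) := by
  have h : a / y ≠ 0 := (div_pos ha hy).ne'
  rw [rateH, if_neg h, Real.log_div ha.ne' hy.ne']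
  field_simp

theorem existsUnique_hatH {a x : ℝ} (ha : 0 ≤ a) (hx : 0 ≤ x) :
    ∃! y : ℝ, a ≤ y ∧ y * rateH (a / y) = x := by
  rcases ha.eq_or_lt with rfl | ha
  · refine ⟨x, ⟨hx, by simp [rateH]⟩, ?_⟩
    rintro y ⟨-, h⟩
    simpa [rateH] using h
  · let g : ℝ → ℝ := fun y => y - a + a * (Real.log a - Real.log y)
    have hpos : ∀ y ∈ Set.Ici a, 0 < y := fun y hy => lt_of_lt_of_le ha hy
    have hcont : ContinuousOn g (Set.Ici a) := by
      intro y hy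
      have : ContinuousAt Real.log y := Real.continuousAt_log (hpos y hy).ne'
      exact (by fun_prop : ContinuousAt g y).continuousWithinAt
    have hmono : StrictMonoOn g (Set.Ici a) := by
      intro y hy z hz hyz
      have hy0 := hpos y hy
      have hz0 := hpos z hz
      have h1 : Real.log (z / y) < z / y - 1 :=
        Real.log_lt_sub_one_of_pos (div_pos hz0 hy0) (by
          rw [Ne, div_eq_one_iff_eq hy0.ne']; exact hyz.ne')
      rw [Real.log_div hz0.ne' hy0.ne'] at h1
      have h2 : a * (z / y - 1) ≤ z - y := by
        have h3 : z / y - 1 = (z - y) / y := by field_simp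
        rw [h3, mul_div_assoc', div_le_iff₀ hy0]
        have : a ≤ y := hy
        nlinarith
      have h4 : a * (Real.log z - Real.log y) < a * (z / y - 1) := mul_lt_mul_of_pos_left h1 ha
      show y - a + a * (Real.log a - Real.log y) < z - a + a * (Real.log a - Real.log z)
      linarith
    have hga : g a = 0 := by simp [g]
    have hM : ∃ M, a ≤ M ∧ x ≤ g M := by
      refine ⟨4 * a + 2 * x, by linarith, ?_⟩
      have hM0 : 0 < 4 * a + 2 * x := by linarith
      have h1 : Real.log ((4 * a + 2 * x) / (2 * a)) ≤ (4 * a + 2 * x) / (2 * a) - 1 :=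
        Real.log_le_sub_one_of_pos (by positivity)
      rw [Real.log_div hM0.ne' (by positivity), Real.log_mul (by norm_num) ha.ne'] at h1
      have h2 : Real.log 2 ≤ 1 := by linarith [Real.log_two_lt_d9]
      have h3 : a * (Real.log (4 * a + 2 * x) - (Real.log 2 + Real.log a)) ≤
          a * ((4 * a + 2 * x) / (2 * a) - 1) := mul_le_mul_of_nonneg_left h1 ha.le
      have h4 : a * ((4 * a + 2 * x) / (2 * a) - 1) = a + x := by field_simp; ring
      have h5 : a * Real.log 2 ≤ a * 1 := mul_le_mul_of_nonneg_left h2 ha.le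
      show x ≤ 4 * a + 2 * x - a + a * (Real.log a - Real.log (4 * a + 2 * x))
      nlinarith
    obtain ⟨M, haM, hxM⟩ := hM
    obtain ⟨y, hy, hgy⟩ := intermediate_value_Icc haM (hcont.mono Set.Icc_subset_Ici_self)
      (⟨hga ▸ hx, hxM⟩ : x ∈ Set.Icc (g a) (g M))
    refine ⟨y, ⟨hy.1, ?_⟩, ?_⟩
    · rw [mul_rateH_div ha (hpos y hy.1)]
      exact hgy
    · rintro z ⟨hz, h⟩
      rw [mul_rateH_div ha (hpos z hz)] at h
      exact hmono.injOn hz hy.1 (h.trans hgy.symm)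

theorem eq_hatH_iff {a x y : ℝ} (ha : 0 ≤ a) (hx : 0 ≤ x) :
    y = hatH a x ↔ y * rateH (a / y) = x ∧ a ≤ y := by
  obtain ⟨z, hz, huniq⟩ := existsUnique_hatH ha hx
  have hset : {y : ℝ | a ≤ y ∧ y * rateH (a / y) = x} = {z} :=
    Set.eq_singleton_iff_unique_mem.2 ⟨hz, huniq⟩
  have hval : hatH a x = z := by rw [hatH, hset, csInf_singleton]
  rw [hval]
  exact ⟨fun h => h ▸ ⟨hz.2, hz.1⟩, fun h => huniq y ⟨h.2, h.1⟩⟩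

/-! Consider radii `r` with `n r² = t log n`. A disc of radius `r` centred in `A` then contains on
average about `c log n` points, where `c = π f t` in the interior, `c = π f t / 2` on an edge and `c
= ω_v f(v) t / 2` at a vertex `v`. For `c > β`, a binomial variable with mean `c log n` stays below
`β log n` with probability `n ^ (-I)` up to lower order, where `I = poissonRate β c = c H(β / c)`
(`one_sub_binTail_le_rpow`, `rpow_le_one_sub_binTail`).

Up to logarithmic factors there are `n` essentially different positions for a disc in the interior,
`n ^ (1 / 2)` along the boundary and boundedly many near a vertex. Some disc therefore has too few
points when `I` is below `1`, `1 / 2` or `0` respectively, and none has when `I` is above. Since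
`hatH β` inverts `c ↦ poissonRate β c`, the critical values of `c` are `hatH β 1`, `hatH β (1 / 2)`
and `β`. Solving for `t` gives the three terms of the maximum.

Upper bound (`IsPolygon.rareShortage`, `RareShortage.ae_eventually`): the mass of small discs is
bounded below uniformly by the local shape of the polygon
(`IsPolygon.exists_lower_bound_near_frontier`), and a union bound over a net applies. The failure
probability is only polynomially small, so Borel-Cantelli is used along `j ^ K`, and monotonicity in
`n` and `r` fills the gaps.

Lower bound (`ae_eventually_exists_hits_lt`): about `n ^ e` disjoint discs of small mass are found.
The events that disjoint discs receive many points are negatively dependent, so all of them happen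
with at most the product of the probabilities (`measureReal_forall_le_hits_le`); this replaces
Poissonization. In the interior `f` is merely measurable, and the discs come from Lebesgue
differentiation (`exists_pos_volume_small_mass`). At a convex vertex the disc centred there suffices
(`ae_eventually_hits_lt_of_lt`); a reflex vertex, with angle at least `π`, never exceeds the edge
term. -/

/-! ### Binomial tails by recursion on the number of trials -/

/-- The probability that a binomial random variable with parameters `n`, `p` is at least `k`. -/
noncomputable def binTail (p : ℝ) : ℕ → ℕ → ℝ
  | 0, k => if k = 0 then 1 else 0
  | n + 1, k => (1 - p) * binTail p n k + p * binTail p n (k - 1)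

theorem binTail_succ (p : ℝ) (n k : ℕ) :
    binTail p (n + 1) k = (1 - p) * binTail p n k + p * binTail p n (k - 1) := rfl

theorem binTail_zero_left (p : ℝ) (k : ℕ) : binTail p 0 k = if k = 0 then 1 else 0 := rfl

@[simp] theorem binTail_zero_right (p : ℝ) (n : ℕ) : binTail p n 0 = 1 := by
  induction n with
  | zero => simp [binTail_zero_left]
  | succ n ih => rw [binTail_succ, Nat.zero_sub, ih]; ring

theorem binTail_nonneg {p : ℝ} (h0 : 0 ≤ p) (h1 : p ≤ 1) (n k : ℕ) : 0 ≤ binTail p n k := by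
  induction n generalizing k with
  | zero => rw [binTail_zero_left]; split_ifs <;> norm_num
  | succ n ih =>
    rw [binTail_succ]
    have := mul_nonneg (sub_nonneg.2 h1) (ih k)
    have := mul_nonneg h0 (ih (k - 1))
    linarith

theorem binTail_antitone {p : ℝ} (h0 : 0 ≤ p) (h1 : p ≤ 1) (n : ℕ) : Antitone (binTail p n) := by
  induction n with
  | zero =>
    intro i j hij
    simp only [binTail_zero_left]
    split_ifs with h h'
    · norm_num
    · omega
    · norm_num
    · norm_num
  | succ n ih =>
    intro i j hij
    rw [binTail_succ, binTail_succ]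
    have := mul_le_mul_of_nonneg_left (ih hij) (sub_nonneg.2 h1)
    have := mul_le_mul_of_nonneg_left (ih (Nat.sub_le_sub_right hij 1)) h0
    linarith

theorem binTail_mono_prob {p q : ℝ} (h0 : 0 ≤ p) (hpq : p ≤ q) (h1 : q ≤ 1) (n k : ℕ) :
    binTail p n k ≤ binTail q n k := by
  induction n generalizing k with
  | zero => simp [binTail_zero_left]
  | succ n ih =>
    rw [binTail_succ, binTail_succ]
    have h2 := mul_le_mul_of_nonneg_left (ih k) (sub_nonneg.2 (hpq.trans h1))
    have h3 := mul_le_mul_of_nonneg_left (ih (k - 1)) h0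
    have h4 := binTail_antitone (h0.trans hpq) h1 n (Nat.sub_le k 1)
    nlinarith [mul_nonneg (sub_nonneg.2 hpq) (sub_nonneg.2 h4)]

/-- Chernoff's bound: each trial multiplies the exponential moment by `1 - p (1 - e^(-s))`, so
induction on `n` needs no random variables. -/
theorem one_sub_binTail_le {p s : ℝ} (h0 : 0 ≤ p) (h1 : p ≤ 1) (hs : 0 ≤ s) (n k : ℕ) :
    1 - binTail p n k ≤ Real.exp (s * k) * (1 - p * (1 - Real.exp (-s))) ^ n := by
  have hM : 0 ≤ 1 - p * (1 - Real.exp (-s)) := by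
    nlinarith [mul_nonneg h0 (Real.exp_pos (-s)).le]
  induction n generalizing k with
  | zero =>
    rw [binTail_zero_left]
    split_ifs
    · simp [Real.exp_nonneg]
    · simpa using Real.one_le_exp (by positivity)
  | succ n ih =>
    rcases k with _ | k
    · simp only [binTail_zero_right, sub_self]; positivity
    · rw [binTail_succ, Nat.add_sub_cancel]
      have h2 := mul_le_mul_of_nonneg_left (ih (k + 1)) (sub_nonneg.2 h1)
      have h3 := mul_le_mul_of_nonneg_left (ih k) h0
      have h4 : Real.exp (s * k) = Real.exp (s * ((k + 1 : ℕ) : ℝ)) * Real.exp (-s) := by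
        rw [← Real.exp_add]; push_cast; ring_nf
      rw [h4] at h3
      rw [pow_succ]
      linarith

theorem binTail_le {p s : ℝ} (h0 : 0 ≤ p) (h1 : p ≤ 1) (hs : 0 ≤ s) (n k : ℕ) :
    binTail p n k ≤ Real.exp (-(s * k)) * (1 + p * (Real.exp s - 1)) ^ n := by
  have hM : 1 ≤ 1 + p * (Real.exp s - 1) := by
    have := mul_nonneg h0 (sub_nonneg.2 (Real.one_le_exp hs)); linarith
  induction n generalizing k with
  | zero =>
    rw [binTail_zero_left]
    split_ifs with h
    · simp [h]
    · positivity
  | succ n ih =>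
    rcases k with _ | k
    · simpa using one_le_pow₀ hM
    · rw [binTail_succ, Nat.add_sub_cancel]
      have h2 := mul_le_mul_of_nonneg_left (ih (k + 1)) (sub_nonneg.2 h1)
      have h3 := mul_le_mul_of_nonneg_left (ih k) h0
      have h4 : Real.exp (-(s * k)) = Real.exp (-(s * ((k + 1 : ℕ) : ℝ))) * Real.exp s := by
        rw [← Real.exp_add]; push_cast; ring_nf
      rw [h4] at h3
      rw [pow_succ]
      linarith

/-- A single binomial probability already has the right exponential order. Pascal's rule matches the
recursion of `binTail`. -/
theorem choose_mul_le_one_sub_binTail {p : ℝ} (h0 : 0 ≤ p) (h1 : p ≤ 1) (n : ℕ) {j k : ℕ}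
    (hjk : j < k) : n.choose j * p ^ j * (1 - p) ^ (n - j) ≤ 1 - binTail p n k := by
  have hq : 0 ≤ 1 - p := sub_nonneg.2 h1
  induction n generalizing j k with
  | zero =>
    rw [binTail_zero_left, if_neg (by omega)]
    rcases j with _ | j <;> simp
  | succ n ih =>
    obtain ⟨k, rfl⟩ := Nat.exists_eq_add_of_lt (Nat.zero_lt_of_lt hjk)
    simp only [Nat.zero_add, binTail_succ, Nat.add_sub_cancel]
    rcases j with _ | j
    · have h2 := mul_le_mul_of_nonneg_left (ih hjk) hq
      have h3 : binTail p n k ≤ 1 := by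
        simpa using binTail_antitone h0 h1 n (Nat.zero_le k)
      have h4 := mul_le_mul_of_nonneg_left h3 h0
      simp only [Nat.choose_zero_right, Nat.cast_one, pow_zero, Nat.sub_zero, zero_add] at h2 ⊢
      rw [pow_succ]
      linarith
    · have h2 := mul_le_mul_of_nonneg_left (ih hjk) hq
      have h3 := mul_le_mul_of_nonneg_left (ih (j := j) (k := k) (by omega)) h0
      rw [Nat.choose_succ_succ, Nat.add_sub_add_right]
      push_cast
      -- The truncated exponent `n - (j + 1)` is wrong only when `j + 1 > n`, where the coefficient
      -- vanishes.
      have h5 : (1 - p) * ((n.choose (j + 1) : ℝ) * p ^ (j + 1) * (1 - p) ^ (n - (j + 1))) =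
          n.choose (j + 1) * p ^ (j + 1) * (1 - p) ^ (n - j) := by
        rcases Nat.lt_or_ge n (j + 1) with h | h
        · simp [Nat.choose_eq_zero_of_lt h]
        · rw [show n - j = (n - (j + 1)) + 1 by omega, pow_succ (1 - p)]; ring
      rw [h5, zero_add] at h2
      have h6 : p * ((n.choose j : ℝ) * p ^ j * (1 - p) ^ (n - j)) =
          n.choose j * p ^ (j + 1) * (1 - p) ^ (n - j) := by rw [pow_succ]; ring
      rw [h6] at h3
      nlinarith

/-! ### Counting the points in disjoint sets -/

/-- Expanding the product on the right and dropping all terms of degree at least two in `d` leaves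
the left side. -/
theorem prod_add_sum_le_prod_add {ι : Type*} [DecidableEq ι] (s : Finset ι) (a d : ι → ℝ)
    (ha : ∀ i, 0 ≤ a i) (hd : ∀ i, 0 ≤ d i) :
    ∏ i ∈ s, a i + ∑ j ∈ s, d j * ∏ i ∈ s.erase j, a i ≤ ∏ i ∈ s, (a i + d i) := by
  induction s using Finset.induction_on with
  | empty => simp
  | insert b s hb ih =>
    rw [Finset.prod_insert hb, Finset.prod_insert hb, Finset.sum_insert hb,
      Finset.erase_insert hb]
    have h1 : ∑ j ∈ s, d j * ∏ i ∈ (insert b s).erase j, a i =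
        a b * ∑ j ∈ s, d j * ∏ i ∈ s.erase j, a i := by
      rw [Finset.mul_sum]
      refine Finset.sum_congr rfl fun j hj => ?_
      have hbj : b ≠ j := fun h => hb (h ▸ hj)
      rw [Finset.erase_insert_of_ne hbj, Finset.prod_insert (by simp [hb])]
      ring
    have h2 : ∏ i ∈ s, a i ≤ ∏ i ∈ s, (a i + d i) :=
      Finset.prod_le_prod (fun i _ => ha i) fun i _ => by linarith [hd i]
    rw [h1]
    nlinarith [mul_le_mul_of_nonneg_left ih (ha b), mul_le_mul_of_nonneg_left h2 (hd b)]

open scoped Classical in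
/-- The number of the points `x 0, …, x (n - 1)` that lie in `B`. -/
noncomputable def hits {α : Type*} (x : ℕ → α) (B : Set α) (n : ℕ) : ℕ :=
  Nat.count (fun i => x i ∈ B) n

section
variable {α : Type*}

@[simp] theorem hits_zero (x : ℕ → α) (B : Set α) : hits x B 0 = 0 := by
  classical exact Nat.count_zero _

open scoped Classical in
theorem hits_succ (x : ℕ → α) (B : Set α) (n : ℕ) :
    hits x B (n + 1) = hits x B n + if x n ∈ B then 1 else 0 := Nat.count_succ _ _

theorem hits_mono_set (x : ℕ → α) {B C : Set α} (h : B ⊆ C) (n : ℕ) : hits x B n ≤ hits x C n := by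
  classical exact Nat.count_mono_left fun _ _ hk => h hk

theorem hits_mono (x : ℕ → α) (B : Set α) : Monotone (hits x B) := by
  classical exact Nat.count_monotone _

open scoped Classical in
theorem hits_eq_sum (x : ℕ → α) (B : Set α) (n : ℕ) :
    hits x B n = ∑ i ∈ Finset.range n, if x i ∈ B then 1 else 0 := by
  induction n with
  | zero => simp
  | succ n ih => rw [hits_succ, Finset.sum_range_succ, ih]

variable [MeasurableSpace α] {Ω : Type*} [MeasurableSpace Ω] {P : Measure Ω}
  {X : ℕ → Ω → α} {μ : Measure α}

theorem measurable_hits (hX : ∀ i, Measurable (X i)) {B : Set α} (hB : MeasurableSet B) (n : ℕ) :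
    Measurable fun ω => hits (fun i => X i ω) B n := by
  classical
  simp only [hits_eq_sum]
  exact Finset.measurable_sum _ fun i _ => Measurable.ite (hX i hB) measurable_const measurable_const

/-- The next point is independent of the numbers of hits of the previous ones. -/
theorem measureReal_inter_hits {ι : Type*} [Finite ι] (hX : ∀ i, Measurable (X i))
    (hindep : iIndepFun X P) (hlaw : ∀ i, P.map (X i) = μ) {B : ι → Set α}
    (hB : ∀ i, MeasurableSet (B i)) {C : Set α} (hC : MeasurableSet C) (D : Set (ι → ℕ)) (n : ℕ) :
    P.real {ω | X n ω ∈ C ∧ (fun i => hits (fun l => X l ω) (B i) n) ∈ D} =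
      μ.real C * P.real {ω | (fun i => hits (fun l => X l ω) (B i) n) ∈ D} := by
  classical
  let g : (({n} : Finset ℕ) → α) → α := fun y => y ⟨n, by simp⟩
  let h : ((Finset.range n) → α) → (ι → ℕ) :=
    fun y i => ∑ l : Finset.range n, if y l ∈ B i then 1 else 0
  have hg : Measurable g := measurable_pi_apply _
  have hh : Measurable h := measurable_pi_lambda _ fun i =>
    Finset.measurable_sum _ fun l _ =>
      Measurable.ite (measurable_pi_apply l (hB i)) measurable_const measurable_const
  have hind := (hindep.indepFun_finset {n} (Finset.range n) (by simp) hX).comp hg hh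
  have heq : (h ∘ fun ω (i : Finset.range n) => X i ω) =
      fun ω i => hits (fun l => X l ω) (B i) n := by
    ext ω i
    simp only [h, Function.comp, hits_eq_sum]
    exact Finset.sum_coe_sort (Finset.range n) (fun l => if X l ω ∈ B i then 1 else 0)
  rw [heq] at hind
  have hgX : (g ∘ fun ω (i : ({n} : Finset ℕ)) => X i ω) = X n := rfl
  rw [hgX] at hind
  -- `ι → ℕ` is countable because `ι` is finite, so every `D` is measurable.
  have hDm : MeasurableSet D := D.to_countable.measurableSet
  have := hind.measure_inter_preimage_eq_mul C D hC hDm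
  have h3 : μ C = P (X n ⁻¹' C) := by rw [← hlaw n, Measure.map_apply (hX n) hC]
  simp only [Measure.real]
  rw [h3, ← ENNReal.toReal_mul]
  exact congrArg ENNReal.toReal this

/-- Negative dependence of multinomial counts. A point can help at most one of the disjoint cells,
whereas independent binomial counts could profit in several cells at once; these extra terms are
what `prod_add_sum_le_prod_add` discards. -/
theorem measureReal_forall_le_hits_le [IsProbabilityMeasure P] {ι : Type*} [Fintype ι] (hX : ∀ i, Measurable (X i))
    (hindep : iIndepFun X P) (hlaw : ∀ i, P.map (X i) = μ) {B : ι → Set α}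
    (hB : ∀ i, MeasurableSet (B i)) (hdisj : Pairwise (Function.onFun Disjoint B))
    (n : ℕ) (k : ι → ℕ) :
    P.real {ω | ∀ i, k i ≤ hits (fun l => X l ω) (B i) n} ≤
      ∏ i, binTail (μ.real (B i)) n (k i) := by
  classical
  have hμ : IsProbabilityMeasure μ :=
    hlaw 0 ▸ Measure.isProbabilityMeasure_map (hX 0).aemeasurable
  induction n generalizing k with
  | zero =>
    by_cases hk : ∀ i, k i = 0
    · simp [hk]
    · have : {ω : Ω | ∀ i, k i ≤ hits (fun l => X l ω) (B i) 0} = ∅ := by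
        ext ω; simpa using hk
      rw [this, measureReal_empty]
      exact Finset.prod_nonneg fun i _ =>
        binTail_nonneg measureReal_nonneg measureReal_le_one _ _
  | succ n ih =>
    set p : ι → ℝ := fun i => μ.real (B i) with hp
    have hp0 : ∀ i, 0 ≤ p i := fun i => measureReal_nonneg
    have hp1 : ∀ i, p i ≤ 1 := fun i => measureReal_le_one
    have hUm : MeasurableSet (⋃ i, B i)ᶜ := (MeasurableSet.iUnion hB).compl
    have hU : μ.real (⋃ i, B i)ᶜ = 1 - ∑ i, p i := by
      rw [measureReal_compl (MeasurableSet.iUnion hB), probReal_univ,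
        measureReal_iUnion_fintype hdisj hB]
    let D : (ι → ℕ) → Set (ι → ℕ) := fun k => {N | ∀ i, k i ≤ N i}
    -- The last point falls outside all cells or into exactly one cell `j`, where it lowers the
    -- requirement to `k j - 1`.
    have hsub : {ω | ∀ i, k i ≤ hits (fun l => X l ω) (B i) (n + 1)} ⊆
        {ω | X n ω ∈ (⋃ i, B i)ᶜ ∧ (fun i => hits (fun l => X l ω) (B i) n) ∈ D k} ∪
        ⋃ j, {ω | X n ω ∈ B j ∧ (fun i => hits (fun l => X l ω) (B i) n) ∈
          D (Function.update k j (k j - 1))} := by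
      intro ω hω
      simp only [Set.mem_ofPred_eq, hits_succ] at hω
      by_cases hmem : X n ω ∈ ⋃ i, B i
      · right
        obtain ⟨j, hj⟩ := Set.mem_iUnion.1 hmem
        refine Set.mem_iUnion.2 ⟨j, hj, fun i => ?_⟩
        have hi := hω i
        by_cases hij : i = j
        · subst hij; simp only [Function.update_self]; simp only [hj, if_true] at hi; omega
        · rw [Function.update_of_ne hij]
          have : X n ω ∉ B i := fun h => Set.disjoint_left.1 (hdisj hij) h hj
          simpa [this] using hi
      · left
        refine ⟨hmem, fun i => ?_⟩
        have hi := hω i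
        have : X n ω ∉ B i := fun h => hmem (Set.mem_iUnion.2 ⟨i, h⟩)
        simpa [this] using hi
    let a : ι → ℝ := fun i => binTail (p i) n (k i)
    let a' : ι → ℝ := fun i => binTail (p i) n (k i - 1)
    have ha : ∀ i, 0 ≤ a i := fun i => binTail_nonneg (hp0 i) (hp1 i) _ _
    have haa' : ∀ i, a i ≤ a' i := fun i => binTail_antitone (hp0 i) (hp1 i) _ (Nat.sub_le _ _)
    have hprod : ∀ j, ∏ i, binTail (p i) n (Function.update k j (k j - 1) i) =
        a' j * ∏ i ∈ Finset.univ.erase j, a i := by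
      intro j
      rw [← Finset.mul_prod_erase _ _ (Finset.mem_univ j), Function.update_self]
      congr 1
      refine Finset.prod_congr rfl fun i hi => ?_
      rw [Function.update_of_ne (Finset.ne_of_mem_erase hi)]
    calc P.real {ω | ∀ i, k i ≤ hits (fun l => X l ω) (B i) (n + 1)}
        ≤ (1 - ∑ i, p i) * ∏ i, a i +
            ∑ j, p j * (a' j * ∏ i ∈ Finset.univ.erase j, a i) := by
          refine (measureReal_mono hsub).trans ((measureReal_union_le _ _).trans ?_)
          refine add_le_add ?_ ((measureReal_iUnion_fintype_le _).trans ?_)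
          · rw [measureReal_inter_hits hX hindep hlaw hB hUm, hU]
            exact mul_le_mul_of_nonneg_left (ih k) (hU ▸ measureReal_nonneg)
          · refine Finset.sum_le_sum fun j _ => ?_
            rw [measureReal_inter_hits hX hindep hlaw hB (hB j), ← hprod]
            exact mul_le_mul_of_nonneg_left (ih _) (hp0 j)
      _ = ∏ i, a i + ∑ j, (p j * (a' j - a j)) * ∏ i ∈ Finset.univ.erase j, a i := by
          have : ∀ j, p j * ∏ i, a i = p j * a j * ∏ i ∈ Finset.univ.erase j, a i := by
            intro j; rw [← Finset.mul_prod_erase _ _ (Finset.mem_univ j)]; ring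
          rw [sub_mul, one_mul, Finset.sum_mul, Finset.sum_congr rfl fun j _ => this j,
            sub_add_eq_add_sub, add_sub_assoc, ← Finset.sum_sub_distrib]
          congr 1
          exact Finset.sum_congr rfl fun j _ => by ring
      _ ≤ ∏ i, (a i + p i * (a' i - a i)) :=
          prod_add_sum_le_prod_add _ _ _ ha fun i => mul_nonneg (hp0 i) (sub_nonneg.2 (haa' i))
      _ = ∏ i, binTail (p i) (n + 1) (k i) :=
          Finset.prod_congr rfl fun i _ => by rw [binTail_succ]; ring

theorem measureReal_hits_lt [IsProbabilityMeasure P] (hX : ∀ i, Measurable (X i))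
    (hindep : iIndepFun X P) (hlaw : ∀ i, P.map (X i) = μ) {B : Set α}
    (hB : MeasurableSet B) (n k : ℕ) :
    P.real {ω | hits (fun l => X l ω) B n < k} = 1 - binTail (μ.real B) n k := by
  classical
  have hμ : IsProbabilityMeasure μ :=
    hlaw 0 ▸ Measure.isProbabilityMeasure_map (hX 0).aemeasurable
  induction n generalizing k with
  | zero =>
    rcases k with _ | k <;> simp [binTail_zero_left]
  | succ n ih =>
    have hmeas : ∀ (C : Set α) (k : ℕ), MeasurableSet C →
        MeasurableSet {ω | X n ω ∈ C ∧ hits (fun l => X l ω) B n < k} := fun C k hC =>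
      (hX n hC).inter (measurable_hits hX hB n measurableSet_Iio)
    have key : ∀ (C : Set α) (k : ℕ), MeasurableSet C →
        P.real {ω | X n ω ∈ C ∧ hits (fun l => X l ω) B n < k} =
          μ.real C * (1 - binTail (μ.real B) n k) := fun C k hC => by
      rw [← ih k]
      exact measureReal_inter_hits (ι := Unit) hX hindep hlaw (fun _ => hB) hC
        {N | N () < k} n
    have hsplit : {ω | hits (fun l => X l ω) B (n + 1) < k} =
        {ω | X n ω ∈ Bᶜ ∧ hits (fun l => X l ω) B n < k} ∪
        {ω | X n ω ∈ B ∧ hits (fun l => X l ω) B n < k - 1} := by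
      ext ω
      simp only [Set.mem_ofPred_eq, hits_succ, Set.mem_union, Set.mem_compl_iff]
      by_cases h : X n ω ∈ B
      · simp [h]; omega
      · simp [h]
    rw [hsplit, measureReal_union _ (hmeas _ _ hB), key _ _ hB.compl, key _ _ hB,
      probReal_compl_eq_one_sub hB, binTail_succ]
    · ring
    · exact Set.disjoint_left.2 fun ω h1 h2 => h1.1 h2.1

end

/-! ### The rate function and sharp exponents of the tails -/

/-- The exponent of the lower tail: a Poisson variable with mean `c l` is at most `b l` with
probability about `exp (-l * poissonRate b c)`. -/
noncomputable def poissonRate (b c : ℝ) : ℝ := c - b + b * Real.log b - b * Real.log c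

theorem mul_rateH_eq_poissonRate {b c : ℝ} (hb : 0 ≤ b) (hc : 0 < c) :
    c * rateH (b / c) = poissonRate b c := by
  rcases hb.eq_or_lt with rfl | hb
  · simp [rateH, poissonRate]
  · rw [mul_rateH_div hb hc, poissonRate]; ring

/-- Continuity includes `b = 0`, through `b log b`; this allows `β` to be perturbed even when it is
zero. -/
theorem continuous_poissonRate_left (c : ℝ) : Continuous fun b => poissonRate b c := by
  unfold poissonRate
  have := Real.continuous_mul_log
  fun_prop

theorem poissonRate_lt {b y z : ℝ} (hb : 0 ≤ b) (hby : b ≤ y) (hy : 0 < y) (hyz : y < z) :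
    poissonRate b y < poissonRate b z := by
  have hz : 0 < z := hy.trans hyz
  have h1 : Real.log (z / y) < z / y - 1 :=
    Real.log_lt_sub_one_of_pos (div_pos hz hy) (by
      rw [Ne, div_eq_one_iff_eq hy.ne']; exact hyz.ne')
  rw [Real.log_div hz.ne' hy.ne'] at h1
  have h3 : z / y - 1 = (z - y) / y := by field_simp
  have h2 : b * (z / y - 1) ≤ z - y := by
    rw [h3, mul_div_assoc', div_le_iff₀ hy]
    nlinarith
  unfold poissonRate
  rcases hb.eq_or_lt with rfl | hb
  · linarith
  · have h4 := mul_lt_mul_of_pos_left h1 hb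
    linarith

theorem poissonRate_self (b : ℝ) : poissonRate b b = 0 := by unfold poissonRate; ring

theorem poissonRate_pos {b c : ℝ} (hb : 0 < b) (hc : 0 < c) (hbc : b ≠ c) :
    0 < poissonRate b c := by
  have h1 : Real.log (c / b) < c / b - 1 :=
    Real.log_lt_sub_one_of_pos (div_pos hc hb) (by
      rw [Ne, div_eq_one_iff_eq hb.ne']; exact hbc.symm)
  rw [Real.log_div hc.ne' hb.ne'] at h1
  have h4 := mul_lt_mul_of_pos_left h1 hb
  have h5 : b * (c / b - 1) = c - b := by field_simp
  unfold poissonRate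
  linarith

/-- From `c = b` on, the rate increases from `0`, and `hatH b` is its inverse there. The next two
lemmas turn comparisons with `hatH` into comparisons of exponents. -/
theorem hatH_spec {b x : ℝ} (hb : 0 ≤ b) (hx : 0 < x) :
    b < hatH b x ∧ poissonRate b (hatH b x) = x := by
  obtain ⟨h1, h2⟩ := (eq_hatH_iff hb hx.le).1 rfl
  have h0 : 0 < hatH b x := by
    refine (hb.trans h2).lt_of_ne' fun h => ?_
    rw [h, zero_mul] at h1
    exact hx.ne h1
  rw [mul_rateH_eq_poissonRate hb h0] at h1
  refine ⟨h2.lt_of_ne fun h => ?_, h1⟩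
  rw [← h, poissonRate_self] at h1
  exact hx.ne h1

theorem lt_poissonRate_of_hatH_lt {b x c : ℝ} (hb : 0 ≤ b) (hx : 0 < x) (h : hatH b x < c) :
    x < poissonRate b c := by
  obtain ⟨h1, h2⟩ := hatH_spec hb hx
  rw [← h2]
  exact (h2.symm ▸ poissonRate_lt hb h1.le (hb.trans_lt h1) h)

theorem poissonRate_lt_of_lt_hatH {b x c : ℝ} (hb : 0 ≤ b) (hx : 0 < x) (hbc : b < c)
    (h : c < hatH b x) : poissonRate b c < x := by
  obtain ⟨h1, h2⟩ := hatH_spec hb hx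
  have := poissonRate_lt hb hbc.le (hb.trans_lt hbc) h
  rwa [h2] at this

/-- The level `b` is strictly above `β`, so that later `k n < b log n` eventually and a little of
`b` can be spent between the terms of a subsequence. The spare room `x < poissonRate β c` pays for
this. -/
theorem one_sub_binTail_le_rpow {β c x : ℝ} (hβ : 0 ≤ β) (hβc : β < c)
    (hx : x < poissonRate β c) :
    ∃ b > β, ∃ M : ℝ, 0 ≤ M ∧ ∀ n : ℕ, 1 ≤ n → ∀ p : ℝ, 0 ≤ p → p ≤ 1 → c * Real.log n ≤ n * p →
      1 - binTail p n ⌈b * Real.log n⌉₊ ≤ M * (n : ℝ) ^ (-x) := by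
  have hev : ∀ᶠ b in 𝓝[>] β, x < poissonRate b c ∧ b < c :=
    ((((continuous_poissonRate_left c).tendsto β).eventually_const_lt hx).and
      (eventually_lt_nhds hβc)).filter_mono nhdsWithin_le_nhds
  obtain ⟨b, ⟨hbx, hbc⟩, hb⟩ := (hev.and self_mem_nhdsWithin).exists
  have hb : β < b := hb
  have hb0 : 0 < b := hβ.trans_lt hb
  have hc0 : 0 < c := hb0.trans hbc
  -- `s = log (c / b)` is the optimal Chernoff parameter; the constant `e^s` pays for rounding `b
  -- log n` up.
  have hs : 0 < Real.log (c / b) := Real.log_pos ((one_lt_div hb0).2 hbc)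
  refine ⟨b, hb, Real.exp (Real.log (c / b)), (Real.exp_pos _).le, fun n hn p h0 h1 hp => ?_⟩
  have hn0 : (0 : ℝ) < n := by exact_mod_cast hn
  have hl : 0 ≤ Real.log n := Real.log_natCast_nonneg n
  have he : Real.exp (-Real.log (c / b)) = b / c := by
    rw [Real.exp_neg, Real.exp_log (by positivity), inv_div]
  have hbc1 : 0 ≤ 1 - b / c := by rw [sub_nonneg, div_le_one hc0]; exact hbc.le
  refine (one_sub_binTail_le h0 h1 hs.le n _).trans ?_
  have hbase : 0 ≤ 1 - p * (1 - b / c) := by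
    have : p * (1 - b / c) ≤ 1 * 1 := by
      refine mul_le_mul h1 ?_ hbc1 zero_le_one
      have : 0 ≤ b / c := by positivity
      linarith
    linarith
  have h2 : (1 - p * (1 - b / c)) ^ n ≤ Real.exp (-(n * p * (1 - b / c))) := by
    rw [show -(n * p * (1 - b / c)) = n * (-(p * (1 - b / c))) by ring, Real.exp_nat_mul]
    exact pow_le_pow_left₀ hbase (by linarith [Real.add_one_le_exp (-(p * (1 - b / c)))]) n
  have hk : (⌈b * Real.log n⌉₊ : ℝ) ≤ b * Real.log n + 1 :=
    (Nat.ceil_lt_add_one (by positivity)).le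
  rw [he]
  calc _ ≤ Real.exp (Real.log (c / b) * (b * Real.log n + 1)) *
        Real.exp (-(n * p * (1 - b / c))) :=
        mul_le_mul (Real.exp_le_exp.2 (mul_le_mul_of_nonneg_left hk hs.le)) h2
          (pow_nonneg hbase n) (Real.exp_pos _).le
    _ ≤ Real.exp (Real.log (c / b) * (b * Real.log n + 1)) *
        Real.exp (-(c * Real.log n * (1 - b / c))) := by gcongr
    _ ≤ Real.exp (Real.log (c / b)) * (n : ℝ) ^ (-x) := by
      rw [Real.rpow_def_of_pos hn0, ← Real.exp_add, ← Real.exp_add]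
      apply Real.exp_le_exp.2
      have h3 : c * Real.log n * (1 - b / c) = Real.log n * (c - b) := by field_simp
      have h4 := mul_le_mul_of_nonneg_left hbx.le hl
      rw [h3, Real.log_div hc0.ne' hb0.ne']
      unfold poissonRate at h4
      nlinarith

theorem binTail_le_rpow {b c : ℝ} (hb : 0 < b) (hcb : c < b) :
    ∃ δ > (0 : ℝ), ∀ n : ℕ, 1 ≤ n → ∀ p : ℝ, 0 ≤ p → p ≤ 1 → n * p ≤ c * Real.log n →
      ∀ k : ℕ, b * Real.log n ≤ k → binTail p n k ≤ (n : ℝ) ^ (-δ) := by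
  -- `c` need not be positive, so a positive `d` takes its place before tilting by `log (b / d)`.
  obtain ⟨d, hd, hdb⟩ := exists_between (max_lt hcb hb)
  obtain ⟨hcd, hd0⟩ := max_lt_iff.1 hd
  have hs : 0 < Real.log (b / d) := Real.log_pos ((one_lt_div hd0).2 hdb)
  refine ⟨poissonRate b d, poissonRate_pos hb hd0 hdb.ne', fun n hn p h0 h1 hp k hk => ?_⟩
  have hn0 : (0 : ℝ) < n := by exact_mod_cast hn
  have hl : 0 ≤ Real.log n := Real.log_natCast_nonneg n
  have he : Real.exp (Real.log (b / d)) = b / d := Real.exp_log (by positivity)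
  have hbd1 : 0 ≤ b / d - 1 := by rw [sub_nonneg, one_le_div hd0]; exact hdb.le
  refine (binTail_le h0 h1 hs.le n k).trans ?_
  have h2 : (1 + p * (b / d - 1)) ^ n ≤ Real.exp (n * p * (b / d - 1)) := by
    rw [show n * p * (b / d - 1) = n * (p * (b / d - 1)) by ring, Real.exp_nat_mul]
    exact pow_le_pow_left₀ (by positivity) (by linarith [Real.add_one_le_exp (p * (b / d - 1))]) n
  have hp' : n * p ≤ d * Real.log n := hp.trans (mul_le_mul_of_nonneg_right hcd.le hl)
  rw [he]
  calc _ ≤ Real.exp (-(Real.log (b / d) * (b * Real.log n))) *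
        Real.exp (n * p * (b / d - 1)) := by gcongr
    _ ≤ Real.exp (-(Real.log (b / d) * (b * Real.log n))) *
        Real.exp (d * Real.log n * (b / d - 1)) := by gcongr
    _ = (n : ℝ) ^ (-poissonRate b d) := by
      rw [Real.rpow_def_of_pos hn0, ← Real.exp_add]
      congr 1
      rw [Real.log_div hb.ne' hd0.ne']
      unfold poissonRate
      field_simp
      ring

theorem log_factorial_le (j : ℕ) :
    Real.log (j.factorial) ≤ j * Real.log j - j + Real.log j + 1 := by
  induction j with
  | zero => simp
  | succ j ih =>
    rcases j.eq_zero_or_pos with rfl | hj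
    · simp
    · have hj0 : (0 : ℝ) < j := by exact_mod_cast hj
      rw [Nat.factorial_succ]
      push_cast
      rw [Real.log_mul (by positivity) (by positivity)]
      have h1 := Real.one_sub_inv_le_log_of_pos (show 0 < ((j : ℝ) + 1) / j by positivity)
      rw [Real.log_div (by positivity) (by positivity)] at h1
      have h2 : (1 : ℝ) - (((j : ℝ) + 1) / j)⁻¹ = 1 / (j + 1) := by field_simp; ring
      rw [h2, div_le_iff₀ (by positivity)] at h1
      nlinarith

/-- `log j ≤ 2 √j`, which also covers the case where `j n` is of smaller order than `log n`. -/
theorem log_div_tendsto_zero {j : ℕ → ℕ} {b : ℝ}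
    (hj : Tendsto (fun n : ℕ => (j n : ℝ) / Real.log n) atTop (𝓝 b)) :
    Tendsto (fun n : ℕ => Real.log (j n) / Real.log n) atTop (𝓝 0) := by
  have hlog : Tendsto (fun n : ℕ => Real.log n) atTop atTop :=
    Real.tendsto_log_atTop.comp tendsto_natCast_atTop_atTop
  have h1 : Tendsto (fun n : ℕ => 2 * (√((j n : ℝ) / Real.log n) * √((Real.log n)⁻¹))) atTop
      (𝓝 0) := by
    simpa using (hj.sqrt.mul (tendsto_inv_atTop_zero.comp hlog).sqrt).const_mul 2
  refine squeeze_zero (fun n => div_nonneg (Real.log_natCast_nonneg _) (Real.log_natCast_nonneg _))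
    (fun n => ?_) h1
  have hl : 0 ≤ Real.log n := Real.log_natCast_nonneg n
  rcases hl.eq_or_lt with h | hl
  · simp [← h]
  · rw [← Real.sqrt_mul (by positivity), ← div_eq_mul_inv, div_div,
      Real.sqrt_div (by positivity), Real.sqrt_mul_self hl.le, mul_div_assoc']
    gcongr
    rcases (Nat.cast_nonneg (α := ℝ) (j n)).eq_or_lt with h | h
    · simp [← h]
    · have h2 := Real.log_le_sub_one_of_pos (Real.sqrt_pos.2 h)
      rw [Real.log_sqrt h.le] at h2
      linarith

/-- The converse to Chernoff's bound: keep only the probability of exactly `j = ⌊b log n⌋` points,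
with `b` slightly below `β`, and apply Stirling's estimate. -/
theorem rpow_le_one_sub_binTail {β c x : ℝ} (hβ : 0 ≤ β) (hc : 0 < c)
    (hx : poissonRate β c < x) {k : ℕ → ℕ} (hk1 : ∀ n, 1 ≤ n → 1 ≤ k n)
    (hk : Tendsto (fun n : ℕ => (k n : ℝ) / Real.log n) atTop (𝓝 β)) :
    ∀ᶠ n : ℕ in atTop, ∀ p : ℝ, 0 ≤ p → p ≤ 1 → n * p ≤ c * Real.log n →
      (n : ℝ) ^ (-x) ≤ 1 - binTail p n (k n) := by
  have hlog : Tendsto (fun n : ℕ => Real.log n) atTop atTop :=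
    Real.tendsto_log_atTop.comp tendsto_natCast_atTop_atTop
  have hlogn : Tendsto (fun n : ℕ => Real.log n / n) atTop (𝓝 0) :=
    (Real.isLittleO_log_id_atTop.tendsto_div_nhds_zero).comp tendsto_natCast_atTop_atTop
  obtain ⟨b, hb0, hbx, hb⟩ : ∃ b : ℝ, 0 ≤ b ∧ poissonRate b c < x ∧
      ∀ᶠ n : ℕ in atTop, ⌊b * Real.log n⌋₊ < k n := by
    rcases hβ.eq_or_lt with rfl | hβ
    · refine ⟨0, le_rfl, hx, ?_⟩
      filter_upwards [eventually_ge_atTop 1] with n hn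
      have := hk1 n hn
      simp
      omega
    · have hev : ∀ᶠ b in 𝓝[<] β, poissonRate b c < x ∧ 0 < b :=
        ((((continuous_poissonRate_left c).tendsto β).eventually_lt_const hx).and
          (eventually_gt_nhds hβ)).filter_mono nhdsWithin_le_nhds
      obtain ⟨b, ⟨hbx, hb0⟩, hb⟩ := (hev.and self_mem_nhdsWithin).exists
      have hb : b < β := hb
      refine ⟨b, hb0.le, hbx, ?_⟩
      filter_upwards [hk.eventually_const_lt hb, hlog.eventually_gt_atTop 0] with n h1 h2
      rw [lt_div_iff₀ h2] at h1
      exact (Nat.floor_lt (by positivity)).2 h1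
  set j : ℕ → ℕ := fun n => ⌊b * Real.log n⌋₊ with hjdef
  have hj : Tendsto (fun n : ℕ => (j n : ℝ) / Real.log n) atTop (𝓝 b) :=
    (tendsto_nat_floor_mul_div_atTop hb0).comp hlog
  have hjn : Tendsto (fun n : ℕ => (j n : ℝ) / n) atTop (𝓝 0) := by
    have := hj.mul hlogn
    rw [mul_zero] at this
    refine this.congr' ?_
    filter_upwards [hlog.eventually_gt_atTop 0] with n hn
    field_simp
  have hpn : Tendsto (fun n : ℕ => c * (Real.log n / n)) atTop (𝓝 0) := by
    simpa using hlogn.const_mul c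
  -- This is a lower bound for the logarithm of the kept term, divided by `log n`; its limit is
  -- `-poissonRate b c`. Writing the entropy as `negMulLog` keeps it continuous at `b = 0`.
  have hM : Tendsto (fun n : ℕ => (j n : ℝ) / Real.log n * (Real.log (1 - (j n : ℝ) / n) +
      Real.log c) + Real.negMulLog ((j n : ℝ) / Real.log n) + (j n : ℝ) / Real.log n -
      Real.log (j n) / Real.log n - (Real.log n)⁻¹ - c / (1 - c * (Real.log n / n))) atTop
      (𝓝 (b * (Real.log (1 - 0) + Real.log c) + Real.negMulLog b + b - 0 - 0 - c / (1 - 0))) := by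
    refine Tendsto.sub (Tendsto.sub (Tendsto.sub (Tendsto.add (Tendsto.add
      (hj.mul (Tendsto.add_const _ ?_)) ?_) hj) ?_) ?_) ?_
    · exact (tendsto_const_nhds.sub hjn).log (by norm_num)
    · exact (Real.continuous_negMulLog.tendsto b).comp hj
    · exact log_div_tendsto_zero hj
    · exact tendsto_inv_atTop_zero.comp hlog
    · exact tendsto_const_nhds.div (tendsto_const_nhds.sub hpn) (by norm_num)
  have hlim : -x < b * (Real.log (1 - 0) + Real.log c) + Real.negMulLog b + b - 0 - 0 -
      c / (1 - 0) := by
    unfold poissonRate at hbx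
    simp only [sub_zero, Real.log_one, Real.negMulLog, div_one]
    linarith
  filter_upwards [hb, hM.eventually_const_lt hlim, hlog.eventually_gt_atTop 0,
    hpn.eventually_lt_const (show (0 : ℝ) < 1 by norm_num),
    hjn.eventually_lt_const (show (0 : ℝ) < 1 by norm_num), eventually_gt_atTop 0]
    with n hjk hn hl hp1' hjn1 hn0 p h0 h1 hp
  have hn0' : (0 : ℝ) < n := by exact_mod_cast hn0
  set q : ℝ := c * (Real.log n / n) with hq
  have hq0 : 0 < q := by positivity
  have hpq : p ≤ q := by rw [hq, mul_div_assoc', le_div_iff₀ hn0']; linarith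
  refine le_trans ?_ (sub_le_sub_left (binTail_mono_prob h0 hpq hp1'.le n (k n)) 1)
  refine le_trans ?_ (choose_mul_le_one_sub_binTail hq0.le hp1'.le n hjk)
  have hjn2 : j n < n := by
    rw [div_lt_one hn0'] at hjn1; exact_mod_cast hjn1
  have hpow : (1 - q) ^ n ≤ (1 - q) ^ (n - j n) :=
    pow_le_pow_of_le_one (by linarith) (by linarith) (Nat.sub_le _ _)
  have hchoose : ((n : ℝ) - j n) ^ j n ≤ n.choose (j n) * (j n).factorial := by
    have h2 := Nat.pow_sub_le_descFactorial n (j n)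
    rw [Nat.descFactorial_eq_factorial_mul_choose] at h2
    have h3 : (n - j n) ^ j n ≤ (n + 1 - j n) ^ j n := Nat.pow_le_pow_left (by omega) _
    have h4 := h3.trans h2
    have h5 : ((n - j n : ℕ) : ℝ) = n - j n := Nat.cast_sub hjn2.le
    rw [← h5, mul_comm]
    exact_mod_cast h4
  have hfac : (0 : ℝ) < (j n).factorial := by exact_mod_cast Nat.factorial_pos _
  have hnj : (0 : ℝ) < (n : ℝ) - j n := by
    rw [sub_pos]; exact_mod_cast hjn2
  have hmain : (n : ℝ) ^ (-x) ≤ ((n : ℝ) - j n) ^ j n / (j n).factorial * q ^ j n * (1 - q) ^ n := by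
    have hq1 : 0 < 1 - q := by linarith
    rw [← Real.log_le_log_iff (by positivity) (by positivity), Real.log_rpow hn0',
      Real.log_mul (by positivity) (by positivity), Real.log_mul (by positivity) (by positivity),
      Real.log_div (by positivity) (by positivity), Real.log_pow, Real.log_pow, Real.log_pow]
    have e1 : Real.log (n - j n) = Real.log n + Real.log (1 - (j n : ℝ) / n) := by
      rw [← Real.log_mul hn0'.ne' (by linarith)]
      congr 1; field_simp
    have e2 : Real.log q = Real.log c + Real.log (Real.log n) - Real.log n := by
      rw [hq, Real.log_mul hc.ne' (by positivity), Real.log_div hl.ne' hn0'.ne']; ring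
    have e3 : -(c * Real.log n) / (1 - q) ≤ n * Real.log (1 - q) := by
      have h6 := Real.one_sub_inv_le_log_of_pos hq1
      have h7 : 1 - (1 - q)⁻¹ = -q / (1 - q) := by field_simp; ring
      rw [h7] at h6
      have h8 := mul_le_mul_of_nonneg_left h6 hn0'.le
      have h9 : n * (-q / (1 - q)) = -(c * Real.log n) / (1 - q) := by
        rw [hq]; field_simp
      linarith
    have e4 : Real.negMulLog ((j n : ℝ) / Real.log n) * Real.log n =
        j n * (Real.log (Real.log n) - Real.log (j n)) := by
      rcases (Nat.cast_nonneg (α := ℝ) (j n)).eq_or_lt with h | h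
      · simp [← h]
      · rw [Real.negMulLog, Real.log_div h.ne' hl.ne']; field_simp; ring
    have e5 := mul_lt_mul_of_pos_right hn hl
    have e6 : ((j n : ℝ) / Real.log n * (Real.log (1 - (j n : ℝ) / n) +
      Real.log c) + Real.negMulLog ((j n : ℝ) / Real.log n) + (j n : ℝ) / Real.log n -
      Real.log (j n) / Real.log n - (Real.log n)⁻¹ - c / (1 - q)) * Real.log n =
        j n * (Real.log (1 - (j n : ℝ) / n) + Real.log c) +
        Real.negMulLog ((j n : ℝ) / Real.log n) * Real.log n + j n - Real.log (j n) - 1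
        + (-(c * Real.log n) / (1 - q)) := by
      field_simp
      ring
    rw [e6, e4] at e5
    have e7 := log_factorial_le (j n)
    rw [e1, e2]
    nlinarith
  refine hmain.trans ?_
  have hc2 : ((n : ℝ) - j n) ^ j n / (j n).factorial ≤ n.choose (j n) := by
    rwa [div_le_iff₀ hfac]
  gcongr

/-! ### Borel-Cantelli along polynomial subsequences -/

/-- Powers `j ^ K` are sparse enough to make `n ^ (-δ)` summable when `K δ > 1`, and dense enough
that the ratio of consecutive ones tends to `1`. -/
theorem exists_pow_sandwich {K : ℕ} (hK : 1 ≤ K) {θ : ℝ} (hθ : 1 < θ) (J : ℕ) :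
    ∀ᶠ n : ℕ in atTop, ∃ j ≥ J, j ^ K ≤ n ∧ n ≤ (j + 1) ^ K ∧
      (((j + 1) ^ K : ℕ) : ℝ) ≤ θ * ((j ^ K : ℕ) : ℝ) := by
  have h1 : Tendsto (fun j : ℕ => (1 + ((j : ℝ))⁻¹) ^ K) atTop (𝓝 1) := by
    have : Tendsto (fun j : ℕ => ((j : ℝ))⁻¹) atTop (𝓝 0) :=
      tendsto_inv_atTop_zero.comp tendsto_natCast_atTop_atTop
    simpa using (this.const_add 1).pow K
  obtain ⟨J', hJ'⟩ := ((h1.eventually_lt_const hθ).and (eventually_ge_atTop (max J 1))).exists_forall_of_atTop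
  filter_upwards [eventually_ge_atTop (J' ^ K)] with n hn
  set j := Nat.findGreatest (fun j => j ^ K ≤ n) n with hj
  have hJn : J' ≤ n := (Nat.le_self_pow (by omega) J').trans hn
  have hj1 : J' ≤ j := Nat.le_findGreatest hJn hn
  have hj2 : j ^ K ≤ n := Nat.findGreatest_spec (P := fun j => j ^ K ≤ n) hJn hn
  have hj3 : n ≤ (j + 1) ^ K := by
    by_contra! h
    have h2 : j + 1 ≤ n := (Nat.le_self_pow (by omega) (j + 1)).trans h.le
    have h3 : j + 1 ≤ j := Nat.le_findGreatest h2 h.le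
    omega
  obtain ⟨h4, h5⟩ := hJ' j hj1
  refine ⟨j, (le_max_left _ _).trans h5, hj2, hj3, ?_⟩
  have hj0 : (0 : ℝ) < j := by
    have := (le_max_right _ _).trans h5
    exact_mod_cast this
  push_cast
  have h6 : ((j : ℝ) + 1) ^ K = (1 + (j : ℝ)⁻¹) ^ K * (j : ℝ) ^ K := by
    rw [← mul_pow]; congr 1; field_simp
  rw [h6]
  gcongr

section
variable {Ω : Type*} [MeasurableSpace Ω] {P : Measure Ω} [IsProbabilityMeasure P]

theorem ae_eventually_notMem_of_summable {E : ℕ → Set Ω} {u : ℕ → ℝ} (hu : Summable u)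
    (hE : ∀ᶠ n in atTop, P.real (E n) ≤ u n) : ∀ᵐ ω ∂P, ∀ᶠ n in atTop, ω ∉ E n := by
  have hs : Summable fun n => P.real (E n) :=
    summable_of_isBigO_nat hu (Asymptotics.IsBigO.of_bound 1 (by
      filter_upwards [hE] with n hn
      rw [Real.norm_of_nonneg measureReal_nonneg, one_mul]
      exact hn.trans (le_abs_self _)))
  refine ae_eventually_notMem ?_
  have : ∀ n, P (E n) = ENNReal.ofReal (P.real (E n)) := fun n => (ofReal_measureReal).symm
  simp_rw [this]
  exact hs.tsum_ofReal_ne_top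

theorem ae_eventually_notMem_pow {E : ℕ → Set Ω} {M δ : ℝ} (hδ : 0 < δ)
    (hE : ∀ᶠ n : ℕ in atTop, P.real (E n) ≤ M * (n : ℝ) ^ (-δ)) :
    ∃ K : ℕ, 1 ≤ K ∧ ∀ᵐ ω ∂P, ∀ᶠ j : ℕ in atTop, ω ∉ E (j ^ K) := by
  obtain ⟨K, hK⟩ := exists_nat_gt (max 1 (1 / δ))
  obtain ⟨hK1, hK2⟩ := max_lt_iff.1 hK
  have hK1' : 1 ≤ K := by exact_mod_cast hK1.le
  refine ⟨K, hK1', ?_⟩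
  rw [div_lt_iff₀ hδ] at hK2
  refine ae_eventually_notMem_of_summable (u := fun j : ℕ => M * (j : ℝ) ^ (-(K * δ))) ?_ ?_
  · exact (Real.summable_nat_rpow.2 (by linarith)).mul_left M
  · have ht : Tendsto (fun j : ℕ => j ^ K) atTop atTop := tendsto_pow_atTop (by omega)
    filter_upwards [ht.eventually hE] with j hj
    refine hj.trans_eq ?_
    push_cast
    rw [← Real.rpow_natCast, ← Real.rpow_mul (Nat.cast_nonneg j)]
    ring_nf

end

/-! ### Local shape of a polygon -/

theorem subset_or_subset_compl_of_disjoint_frontier {E : Type*} [TopologicalSpace E] {A S : Set E}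
    (hA : IsClosed A) (hS : IsPreconnected S) (h : Disjoint S (frontier A)) : S ⊆ A ∨ S ⊆ Aᶜ := by
  have hcov : S ⊆ interior A ∪ Aᶜ := by
    intro x hx
    by_cases hxA : x ∈ A
    · left
      by_contra hxi
      exact Set.disjoint_left.1 h hx (hA.frontier_eq ▸ ⟨hxA, hxi⟩)
    · exact Or.inr hxA
  have hd : Disjoint (interior A) Aᶜ :=
    Set.disjoint_left.2 fun x h1 h2 => h2 (interior_subset h1)
  exact (hS.subset_or_subset isOpen_interior hA.isOpen_compl hd hcov).imp_left
    fun h => h.trans interior_subset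

/-- Two connected pieces of a neighbourhood of a boundary point, separated by the boundary, lie on
different sides. -/
theorem separated_by_frontier {E : Type*} [TopologicalSpace E] {A S T U : Set E} {y : E}
    (hA : closure (interior A) = A) (hy : y ∈ frontier A) (hU : U ∈ 𝓝 y)
    (hS : IsPreconnected S) (hT : IsPreconnected T) (hSf : Disjoint S (frontier A))
    (hTf : Disjoint T (frontier A)) (hcov : U ⊆ S ∪ T ∪ frontier A) :
    (S ⊆ A ∧ T ⊆ Aᶜ) ∨ (S ⊆ Aᶜ ∧ T ⊆ A) := by
  have hAc : IsClosed A := hA ▸ isClosed_closure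
  -- If both pieces were in `A`, then `y` would be an interior point.
  have hnot : ¬ (S ⊆ A ∧ T ⊆ A) := by
    rintro ⟨h1, h2⟩
    have hUA : U ⊆ A := fun x hx => by
      rcases hcov hx with (h | h) | h
      · exact h1 h
      · exact h2 h
      · exact hAc.frontier_subset h
    exact hy.2 (mem_interior_iff_mem_nhds.2 (mem_of_superset hU hUA))
  -- If both were outside, `y` would not be a limit of interior points; this is where `A = closure
  -- (interior A)` enters.
  have hnot' : ¬ (S ⊆ Aᶜ ∧ T ⊆ Aᶜ) := by
    rintro ⟨h1, h2⟩
    have hyA : y ∈ closure (interior A) := by rw [hA]; exact hAc.frontier_subset hy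
    obtain ⟨x, hxU, hx⟩ := mem_closure_iff_nhds.1 hyA U hU
    rcases hcov hxU with (h | h) | h
    · exact h1 h (interior_subset hx)
    · exact h2 h (interior_subset hx)
    · exact h.2 hx
  rcases subset_or_subset_compl_of_disjoint_frontier hAc hS hSf with h1 | h1 <;>
    rcases subset_or_subset_compl_of_disjoint_frontier hAc hT hTf with h2 | h2
  · exact absurd ⟨h1, h2⟩ hnot
  · exact Or.inl ⟨h1, h2⟩
  · exact Or.inr ⟨h1, h2⟩
  · exact absurd ⟨h1, h2⟩ hnot'

/-- The determinant of two vectors of the plane. -/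
noncomputable def planeCross (u : Plane) : Plane →L[ℝ] ℝ :=
  u 0 • EuclideanSpace.proj (𝕜 := ℝ) (1 : Fin 2) - u 1 • EuclideanSpace.proj (𝕜 := ℝ) (0 : Fin 2)

theorem planeCross_apply (u x : Plane) : planeCross u x = u 0 * x 1 - u 1 * x 0 := rfl

theorem planeCross_self (u : Plane) : planeCross u u = 0 := by rw [planeCross_apply]; ring

/-- Cramer's rule; it yields the coordinates with respect to two independent edges. -/
theorem planeCross_smul_eq (u w x : Plane) :
    planeCross u w • x = -(planeCross w x) • u + planeCross u x • w := by
  ext i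
  fin_cases i <;> simp [planeCross_apply] <;> ring

theorem planeCross_ne_zero {u : Plane} (hu : u ≠ 0) : planeCross u ≠ 0 := by
  intro h
  apply hu
  have h0 : planeCross u (EuclideanSpace.single 1 1) = 0 := by rw [h]; rfl
  have h1 : planeCross u (EuclideanSpace.single 0 1) = 0 := by rw [h]; rfl
  simp [planeCross_apply] at h0 h1
  ext i
  fin_cases i <;> simp [h0, h1]

theorem planeCross_eq_zero {u x : Plane} (hu : u ≠ 0) (h : planeCross u x = 0) :
    x = (inner ℝ u x / ‖u‖ ^ 2) • u := by
  have hn : ‖u‖ ^ 2 = u 0 ^ 2 + u 1 ^ 2 := by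
    rw [EuclideanSpace.norm_sq_eq]; simp [Fin.sum_univ_two]
  have hn0 : u 0 ^ 2 + u 1 ^ 2 ≠ 0 := hn ▸ pow_ne_zero 2 (norm_ne_zero_iff.2 hu)
  have hi : inner ℝ u x = u 0 * x 0 + u 1 * x 1 := by
    simp [PiLp.inner_apply, Fin.sum_univ_two]; ring
  rw [planeCross_apply] at h
  rw [hn, hi]
  ext i
  fin_cases i
  · simp only [Fin.zero_eta, PiLp.smul_apply, smul_eq_mul]
    rw [div_mul_eq_mul_div, eq_div_iff hn0]
    linear_combination (-u 1) * h
  · simp only [Fin.mk_one, PiLp.smul_apply, smul_eq_mul]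
    rw [div_mul_eq_mul_div, eq_div_iff hn0]
    linear_combination (u 0) * h

namespace IsPolygon
variable {A : Set Plane} {V : Finset Plane} {σ : Equiv.Perm V}

theorem isClosed (hA : IsPolygon A V σ) : IsClosed A := hA.isCompact.isClosed

theorem mem_frontier_iff (hA : IsPolygon A V σ) {x : Plane} :
    x ∈ frontier A ↔ ∃ v : V, x ∈ segment ℝ (v : Plane) (σ v : Plane) := by
  rw [hA.frontier_eq, Set.mem_iUnion]

theorem vertex_mem_frontier (hA : IsPolygon A V σ) (v : V) : (v : Plane) ∈ frontier A :=
  hA.mem_frontier_iff.2 ⟨v, left_mem_segment _ _ _⟩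

theorem edge_ne_zero (hA : IsPolygon A V σ) (v : V) : (σ v : Plane) - v ≠ 0 :=
  sub_ne_zero.2 fun h => hA.edge_nondegenerate v (Subtype.ext h)

theorem eventually_notMem_edge (y : Plane) :
    ∀ᶠ x in 𝓝 y, ∀ v : V, y ∉ segment ℝ (v : Plane) (σ v : Plane) →
      x ∉ segment ℝ (v : Plane) (σ v : Plane) := by
  refine eventually_all.2 fun v => ?_
  by_cases h : y ∈ segment ℝ (v : Plane) (σ v : Plane)
  · exact Eventually.of_forall fun x hx => absurd h hx
  · have hc : IsClosed (segment ℝ (v : Plane) (σ v : Plane)) := by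
      rw [← closure_openSegment]; exact isClosed_closure
    exact (hc.isOpen_compl.eventually_mem h).mono fun x hx _ => hx

/-- Near an interior point of an edge, a polygon is a half-plane. -/
theorem exists_halfPlane (hA : IsPolygon A V σ) {v : V} {y : Plane}
    (hy : y ∈ openSegment ℝ (v : Plane) (σ v : Plane)) :
    ∃ φ : Plane →L[ℝ] ℝ, ∃ ρ > 0, φ ≠ 0 ∧ φ ((σ v : Plane) - v) = 0 ∧
      ∀ x ∈ Metric.ball y ρ, x ∈ A ↔ 0 ≤ φ (x - y) := by
  set d : Plane := (σ v : Plane) - v with hd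
  have hd0 : d ≠ 0 := hA.edge_ne_zero v
  have hyseg : y ∈ segment ℝ (v : Plane) (σ v : Plane) := openSegment_subset_segment _ _ _ hy
  have hyf : y ∈ frontier A := hA.mem_frontier_iff.2 ⟨v, hyseg⟩
  obtain ⟨τ, ⟨hτ0, hτ1⟩, hτ⟩ := openSegment_eq_image' ℝ (v : Plane) (σ v : Plane) ▸ hy
  have hτ : (v : Plane) + τ • d = y := hτ
  have honly : ∀ w : V, y ∈ segment ℝ (w : Plane) (σ w : Plane) → w = v := by
    intro w hw
    by_contra hne
    have h := (hA.edge_inter v w (Ne.symm hne) ⟨hyseg, hw⟩).1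
    rcases h with h | h
    · have : τ • d = 0 := by rw [← h] at hτ; simpa using hτ
      rcases smul_eq_zero.1 this with h | h
      · exact hτ0.ne' h
      · exact hd0 h
    · have h : y = σ v := h
      have : (1 - τ) • d = 0 := by
        rw [sub_smul, one_smul, sub_eq_zero]
        conv_lhs => rw [hd, ← h, ← hτ, add_sub_cancel_left]
      rcases smul_eq_zero.1 this with h | h
      · linarith
      · exact hd0 h
  have hcont : Continuous fun x : Plane => inner ℝ d (x - y) / ‖d‖ ^ 2 := by fun_prop
  have h1 : ∀ᶠ x in 𝓝 y, -τ < inner ℝ d (x - y) / ‖d‖ ^ 2 ∧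
      inner ℝ d (x - y) / ‖d‖ ^ 2 < 1 - τ := by
    have h2 : inner ℝ d (y - y) / ‖d‖ ^ 2 = 0 := by simp
    have := hcont.tendsto y
    rw [h2] at this
    exact (this.eventually_const_lt (by linarith)).and (this.eventually_lt_const (by linarith))
  obtain ⟨ρ, hρ, hball⟩ := Metric.eventually_nhds_iff_ball.1 (h1.and (eventually_notMem_edge (σ := σ) y))
  -- No other edge meets this ball, and the ends of the edge through `y` are out of reach. So the
  -- boundary is a full diameter, and the two open half-discs can be separated.
  have hfr : ∀ x ∈ Metric.ball y ρ, x ∈ frontier A ↔ planeCross d (x - y) = 0 := by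
    intro x hx
    obtain ⟨⟨hx1, hx2⟩, hx3⟩ := hball x hx
    rw [hA.mem_frontier_iff]
    constructor
    · rintro ⟨w, hw⟩
      have hwv : w = v := honly w (by by_contra h; exact hx3 w h hw)
      subst hwv
      obtain ⟨s, -, hs⟩ := segment_eq_image' ℝ (w : Plane) (σ w : Plane) ▸ hw
      have hs : (w : Plane) + s • d = x := hs
      rw [← hs, ← hτ, add_sub_add_left_eq_sub, ← sub_smul, map_smul, planeCross_self, smul_zero]
    · intro h
      refine ⟨v, ?_⟩
      have hx4 := planeCross_eq_zero hd0 h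
      set s := inner ℝ d (x - y) / ‖d‖ ^ 2
      rw [segment_eq_image']
      refine ⟨τ + s, ⟨by linarith, by linarith⟩, ?_⟩
      change (v : Plane) + (τ + s) • d = x
      rw [add_smul, ← add_assoc, hτ, ← hx4]; abel
  let S : Set Plane := Metric.ball y ρ ∩ {x | 0 < planeCross d (x - y)}
  let T : Set Plane := Metric.ball y ρ ∩ {x | planeCross d (x - y) < 0}
  have hS : Convex ℝ S := by
    refine (convex_ball _ _).inter ?_
    have : {x | 0 < planeCross d (x - y)} = {x | planeCross d y < planeCross d x} := by
      ext x; simp [map_sub]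
    rw [this]
    exact convex_halfSpace_gt (planeCross d).toLinearMap.isLinear _
  have hT : Convex ℝ T := by
    refine (convex_ball _ _).inter ?_
    have : {x | planeCross d (x - y) < 0} = {x | planeCross d x < planeCross d y} := by
      ext x; simp [map_sub]
    rw [this]
    exact convex_halfSpace_lt (planeCross d).toLinearMap.isLinear _
  have hSf : Disjoint S (frontier A) :=
    Set.disjoint_left.2 fun x hx hf => hx.2.ne' ((hfr x hx.1).1 hf)
  have hTf : Disjoint T (frontier A) :=
    Set.disjoint_left.2 fun x hx hf => hx.2.ne ((hfr x hx.1).1 hf)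
  have hcov : Metric.ball y ρ ⊆ S ∪ T ∪ frontier A := by
    intro x hx
    rcases lt_trichotomy 0 (planeCross d (x - y)) with h | h | h
    · exact Or.inl (Or.inl ⟨hx, h⟩)
    · exact Or.inr ((hfr x hx).2 h.symm)
    · exact Or.inl (Or.inr ⟨hx, h⟩)
  rcases separated_by_frontier hA.closure_interior hyf (Metric.ball_mem_nhds y hρ)
    hS.isPreconnected hT.isPreconnected hSf hTf hcov with ⟨h2, h3⟩ | ⟨h2, h3⟩
  · refine ⟨planeCross d, ρ, hρ, planeCross_ne_zero hd0, planeCross_self d, fun x hx => ?_⟩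
    constructor
    · intro hxA; by_contra! h; exact h3 ⟨hx, h⟩ hxA
    · intro h
      rcases h.eq_or_lt with h | h
      · exact hA.isClosed.frontier_subset ((hfr x hx).2 h.symm)
      · exact h2 ⟨hx, h⟩
  · refine ⟨-planeCross d, ρ, hρ, neg_ne_zero.2 (planeCross_ne_zero hd0),
      by simp [planeCross_self], fun x hx => ?_⟩
    rw [show (-planeCross d) (x - y) = -planeCross d (x - y) from rfl, neg_nonneg]
    constructor
    · intro hxA; by_contra! h; exact h2 ⟨hx, h⟩ hxA
    · intro h
      rcases h.eq_or_lt with h | h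
      · exact hA.isClosed.frontier_subset ((hfr x hx).2 h)
      · exact h3 ⟨hx, h⟩

theorem symm_ne (hA : IsPolygon A V σ) (v : V) : σ.symm v ≠ v := fun h =>
  hA.edge_nondegenerate v (by conv_lhs => rw [← h, Equiv.apply_symm_apply])

/-- Opposite directions are excluded by `angle_ne_pi`. With equal directions the two edges would
overlap: a point `v + ε u` with `ε < min 1 a` would be in both without being an endpoint. -/
theorem cross_edges_ne_zero (hA : IsPolygon A V σ) (v : V) :
    planeCross ((σ.symm v : Plane) - v) ((σ v : Plane) - v) ≠ 0 := by
  intro h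
  set u : Plane := (σ.symm v : Plane) - v with hu
  set w : Plane := (σ v : Plane) - v with hw
  have hu0 : u ≠ 0 := sub_ne_zero.2 fun h => hA.symm_ne v (Subtype.ext h)
  have hw0 : w ≠ 0 := hA.edge_ne_zero v
  have h1 := planeCross_eq_zero hu0 h
  set a := inner ℝ u w / ‖u‖ ^ 2
  rcases lt_trichotomy a 0 with ha | ha | ha
  · exact hA.angle_ne_pi v (InnerProductGeometry.angle_eq_pi_iff.2 ⟨hu0, a, ha, h1⟩)
  · rw [ha, zero_smul] at h1; exact hw0 h1
  · set ε := min 1 a / 2 with hε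
    have hε0 : 0 < ε := by positivity
    have hε1 : ε < 1 := by
      have := min_le_left 1 a; rw [hε]; linarith
    have hεa : ε < a := by
      have := min_le_right 1 a; rw [hε]; linarith
    have hz1 : (v : Plane) + ε • u ∈ segment ℝ (v : Plane) (σ v : Plane) := by
      rw [segment_eq_image']
      refine ⟨ε / a, ⟨by positivity, (div_le_one ha).2 hεa.le⟩, ?_⟩
      change (v : Plane) + (ε / a) • w = _
      rw [h1, smul_smul, div_mul_cancel₀ _ ha.ne']
    have hz2 : (v : Plane) + ε • u ∈ segment ℝ (σ.symm v : Plane) (σ (σ.symm v) : Plane) := by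
      rw [Equiv.apply_symm_apply, segment_symm, segment_eq_image']
      exact ⟨ε, ⟨hε0.le, hε1.le⟩, rfl⟩
    have hz := (hA.edge_inter v (σ.symm v) (hA.symm_ne v).symm ⟨hz1, hz2⟩).2
    rw [Equiv.apply_symm_apply] at hz
    rcases hz with hz | hz
    · have : (1 - ε) • u = 0 := by
        rw [sub_smul, one_smul, sub_eq_zero]
        conv_lhs => rw [hu, ← hz, add_sub_cancel_left]
      rcases smul_eq_zero.1 this with h | h
      · linarith
      · exact hu0 h
    · have : ε • u = 0 := by
        have hz : (v : Plane) + ε • u = v := hz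
        simpa using hz
      rcases smul_eq_zero.1 this with h | h
      · exact hε0.ne' h
      · exact hu0 h

set_option maxHeartbeats 1000000 in
/-- Near a vertex, a polygon is a convex sector or the complement of one. -/
theorem exists_sector (hA : IsPolygon A V σ) (v : V) :
    ∃ φ ψ : Plane →L[ℝ] ℝ, ∃ ρ > 0, φ ≠ 0 ∧ ψ ≠ 0 ∧
      (∀ x, x = φ x • ((σ.symm v : Plane) - v) + ψ x • ((σ v : Plane) - v)) ∧
      ((vertexAngle A σ v = InnerProductGeometry.angle ((σ.symm v : Plane) - v) ((σ v : Plane) - v) ∧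
          ∀ x ∈ Metric.ball (v : Plane) ρ, x ∈ A ↔ 0 ≤ φ (x - v) ∧ 0 ≤ ψ (x - v)) ∨
        (Real.pi ≤ vertexAngle A σ v ∧
          ∀ x ∈ Metric.ball (v : Plane) ρ, x ∈ A ↔ 0 ≤ (-φ) (x - v) ∨ 0 ≤ (-ψ) (x - v))) := by
  have hcr := hA.cross_edges_ne_zero v
  set u : Plane := (σ.symm v : Plane) - v with hu
  set w : Plane := (σ v : Plane) - v with hw
  set D := planeCross u w with hD
  -- `φ` and `ψ` are the coordinates in the basis `u`, `w`, so that near `v` the edges are the two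
  -- positive half-axes.
  let φ : Plane →L[ℝ] ℝ := (-D⁻¹) • planeCross w
  let ψ : Plane →L[ℝ] ℝ := D⁻¹ • planeCross u
  have hu0 : u ≠ 0 := sub_ne_zero.2 fun h => hA.symm_ne v (Subtype.ext h)
  have hw0 : w ≠ 0 := hA.edge_ne_zero v
  have hwu : planeCross w u = -D := by rw [hD, planeCross_apply, planeCross_apply]; ring
  have hφ : ∀ x, φ x = -D⁻¹ * planeCross w x := fun x => rfl
  have hψ : ∀ x, ψ x = D⁻¹ * planeCross u x := fun x => rfl
  have hφu : φ u = 1 := by rw [hφ, hwu]; field_simp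
  have hφw : φ w = 0 := by rw [hφ, planeCross_self, mul_zero]
  have hψu : ψ u = 0 := by rw [hψ, planeCross_self, mul_zero]
  have hψw : ψ w = 1 := by rw [hψ, ← hD]; field_simp
  have hrep : ∀ x, x = φ x • u + ψ x • w := by
    intro x
    have h := congrArg (fun z => D⁻¹ • z) (planeCross_smul_eq u w x)
    simp only [← hD, smul_add, smul_smul] at h
    rw [inv_mul_cancel₀ hcr, one_smul] at h
    rw [hφ, hψ, neg_mul_comm]
    exact h
  have hφ0 : φ ≠ 0 := fun h => by rw [h] at hφu; simp at hφu
  have hψ0 : ψ ≠ 0 := fun h => by rw [h] at hψw; simp at hψw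
  have honly : ∀ y : V, (v : Plane) ∈ segment ℝ (y : Plane) (σ y : Plane) →
      y = v ∨ y = σ.symm v := by
    intro y hy
    by_contra! hne
    have h := (hA.edge_inter v y hne.1.symm ⟨left_mem_segment _ _ _, hy⟩).2
    rcases h with h | h
    · exact hne.1 (Subtype.ext h).symm
    · have h : v = σ y := Subtype.ext h
      exact hne.2 (by rw [h, Equiv.symm_apply_apply])
  have h1 : ∀ᶠ x in 𝓝 (v : Plane), φ (x - v) < 1 ∧ ψ (x - v) < 1 := by
    have hc1 : Tendsto (fun x : Plane => φ (x - v)) (𝓝 (v : Plane)) (𝓝 (φ (v - v))) :=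
      (by fun_prop : Continuous fun x : Plane => φ (x - v)).tendsto _
    have hc2 : Tendsto (fun x : Plane => ψ (x - v)) (𝓝 (v : Plane)) (𝓝 (ψ (v - v))) :=
      (by fun_prop : Continuous fun x : Plane => ψ (x - v)).tendsto _
    rw [sub_self, map_zero] at hc1 hc2
    exact (hc1.eventually_lt_const one_pos).and (hc2.eventually_lt_const one_pos)
  obtain ⟨ρ, hρ, hball⟩ := Metric.eventually_nhds_iff_ball.1
    (h1.and (eventually_notMem_edge (σ := σ) (v : Plane)))
  have hfr : ∀ x ∈ Metric.ball (v : Plane) ρ, x ∈ frontier A ↔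
      (0 ≤ φ (x - v) ∧ ψ (x - v) = 0) ∨ (φ (x - v) = 0 ∧ 0 ≤ ψ (x - v)) := by
    intro x hx
    obtain ⟨⟨hx1, hx2⟩, hx3⟩ := hball x hx
    rw [hA.mem_frontier_iff]
    constructor
    · rintro ⟨y, hy⟩
      rcases honly y (by by_contra h; exact hx3 y h hy) with rfl | rfl
      · right
        obtain ⟨s, hs0, hs⟩ := segment_eq_image' ℝ (y : Plane) (σ y : Plane) ▸ hy
        have hs : (y : Plane) + s • w = x := hs
        rw [← hs, add_sub_cancel_left, map_smul, map_smul, hφw, hψw]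
        simpa using hs0.1
      · left
        rw [Equiv.apply_symm_apply, segment_symm, segment_eq_image'] at hy
        obtain ⟨s, hs0, hs⟩ := hy
        have hs : (v : Plane) + s • u = x := hs
        rw [← hs, add_sub_cancel_left, map_smul, map_smul, hφu, hψu]
        simpa using hs0.1
    · have hxr := hrep (x - v)
      rintro (⟨h2, h3⟩ | ⟨h2, h3⟩)
      · refine ⟨σ.symm v, ?_⟩
        rw [Equiv.apply_symm_apply, segment_symm, segment_eq_image']
        refine ⟨φ (x - v), ⟨h2, hx1.le⟩, ?_⟩
        rw [h3, zero_smul, add_zero] at hxr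
        change (v : Plane) + φ (x - v) • u = x
        rw [← hxr]; abel
      · refine ⟨v, ?_⟩
        rw [segment_eq_image']
        refine ⟨ψ (x - v), ⟨h3, hx2.le⟩, ?_⟩
        rw [h2, zero_smul, zero_add] at hxr
        change (v : Plane) + ψ (x - v) • w = x
        rw [← hxr]; abel
  have hgt : ∀ χ : Plane →L[ℝ] ℝ,
      Convex ℝ (Metric.ball (v : Plane) ρ ∩ {x | 0 < χ (x - v)}) := by
    intro χ
    refine (convex_ball _ _).inter ?_
    have : {x | 0 < χ (x - v)} = {x | χ v < χ x} := by ext x; simp [map_sub]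
    rw [this]
    exact convex_halfSpace_gt χ.toLinearMap.isLinear _
  let S : Set Plane := (Metric.ball (v : Plane) ρ ∩ {x | 0 < φ (x - v)}) ∩
    (Metric.ball (v : Plane) ρ ∩ {x | 0 < ψ (x - v)})
  let T : Set Plane := (Metric.ball (v : Plane) ρ ∩ {x | 0 < (-φ) (x - v)}) ∪
    (Metric.ball (v : Plane) ρ ∩ {x | 0 < (-ψ) (x - v)})
  have hS : IsPreconnected S := ((hgt φ).inter (hgt ψ)).isPreconnected
  have htend : ∀ z : Plane, ∀ᶠ ε : ℝ in 𝓝[>] 0, (v : Plane) + ε • z ∈ Metric.ball (v : Plane) ρ := by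
    intro z
    have hc : Tendsto (fun ε : ℝ => (v : Plane) + ε • z) (𝓝 0) (𝓝 ((v : Plane) + (0 : ℝ) • z)) :=
      (by fun_prop : Continuous fun ε : ℝ => (v : Plane) + ε • z).tendsto 0
    rw [zero_smul, add_zero] at hc
    exact (hc.mono_left nhdsWithin_le_nhds).eventually (Metric.ball_mem_nhds _ hρ)
  -- The two convex parts of `T` share a point in the direction `-u - w`.
  have hT : IsPreconnected T := by
    obtain ⟨ε, hε, hε0⟩ := ((htend (-u - w)).and self_mem_nhdsWithin).exists
    have hε0 : 0 < ε := hε0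
    refine IsPreconnected.union ((v : Plane) + ε • (-u - w)) ⟨hε, ?_⟩ ⟨hε, ?_⟩
      (hgt (-φ)).isPreconnected (hgt (-ψ)).isPreconnected
    · simp [hφu, hφw, hε0]
    · simp [hψu, hψw, hε0]
  have hSf : Disjoint S (frontier A) := by
    refine Set.disjoint_left.2 fun x hx hf => ?_
    have hx1 : 0 < φ (x - v) := hx.1.2
    have hx2 : 0 < ψ (x - v) := hx.2.2
    rcases (hfr x hx.1.1).1 hf with h | h
    · exact hx2.ne' h.2
    · exact hx1.ne' h.1
  have hTb : ∀ x ∈ T, x ∈ Metric.ball (v : Plane) ρ ∧ (φ (x - v) < 0 ∨ ψ (x - v) < 0) := by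
    rintro x (⟨h1, h2⟩ | ⟨h1, h2⟩)
    · exact ⟨h1, Or.inl (neg_pos.1 h2)⟩
    · exact ⟨h1, Or.inr (neg_pos.1 h2)⟩
  have hTb' : ∀ x ∈ Metric.ball (v : Plane) ρ, (φ (x - v) < 0 ∨ ψ (x - v) < 0) → x ∈ T := by
    rintro x hx (h | h)
    · exact Or.inl ⟨hx, neg_pos.2 h⟩
    · exact Or.inr ⟨hx, neg_pos.2 h⟩
  have hTf : Disjoint T (frontier A) := by
    refine Set.disjoint_left.2 fun x hx hf => ?_
    obtain ⟨hxb, h⟩ := hTb x hx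
    rcases (hfr x hxb).1 hf with h' | h' <;> rcases h with h | h <;> linarith [h'.1, h'.2]
  have hcov : Metric.ball (v : Plane) ρ ⊆ S ∪ T ∪ frontier A := by
    intro x hx
    by_cases hxT : x ∈ T
    · exact Or.inl (Or.inr hxT)
    by_cases hxf : x ∈ frontier A
    · exact Or.inr hxf
    have h2 : 0 ≤ φ (x - v) ∧ 0 ≤ ψ (x - v) := by
      by_contra h
      rw [not_and_or, not_le, not_le] at h
      exact hxT (hTb' x hx h)
    have h3 := mt (hfr x hx).2 hxf
    push Not at h3
    refine Or.inl (Or.inl ⟨⟨hx, h2.1.lt_of_ne' fun h => ?_⟩, ⟨hx, h2.2.lt_of_ne' fun h => ?_⟩⟩)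
    · exact absurd h2.2 (not_le.2 (h3.2 h))
    · exact h3.1 h2.1 h
  refine ⟨φ, ψ, ρ, hρ, hφ0, hψ0, hrep, ?_⟩
  rcases separated_by_frontier hA.closure_interior (hA.vertex_mem_frontier v)
    (Metric.ball_mem_nhds _ hρ) hS hT hSf hTf hcov with ⟨h2, h3⟩ | ⟨h2, h3⟩
  · left
    have hmem : ∀ x ∈ Metric.ball (v : Plane) ρ, x ∈ A ↔ 0 ≤ φ (x - v) ∧ 0 ≤ ψ (x - v) := by
      intro x hx
      constructor
      · intro hxA
        by_contra h
        rw [not_and_or, not_le, not_le] at h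
        exact h3 (hTb' x hx h) hxA
      · rintro ⟨h4, h5⟩
        rcases hcov hx with (h | h) | h
        · exact h2 h
        · rcases (hTb x h).2 with h | h <;> linarith
        · exact hA.isClosed.frontier_subset h
    refine ⟨?_, hmem⟩
    have hconv : Convex ℝ (A ∩ Metric.ball (v : Plane) ρ) := by
      have hge : ∀ χ : Plane →L[ℝ] ℝ, Convex ℝ {x : Plane | 0 ≤ χ (x - v)} := by
        intro χ
        have : {x | 0 ≤ χ (x - v)} = {x | χ v ≤ χ x} := by ext x; simp [map_sub]
        rw [this]
        exact convex_halfSpace_ge χ.toLinearMap.isLinear _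
      have : A ∩ Metric.ball (v : Plane) ρ =
          ({x | 0 ≤ φ (x - v)} ∩ {x | 0 ≤ ψ (x - v)}) ∩ Metric.ball (v : Plane) ρ := by
        ext x
        constructor
        · rintro ⟨h4, h5⟩; exact ⟨(hmem x h5).1 h4, h5⟩
        · rintro ⟨h4, h5⟩; exact ⟨(hmem x h5).2 h4, h5⟩
      rw [this]
      exact ((hge φ).inter (hge ψ)).inter (convex_ball _ _)
    rw [vertexAngle, if_pos ⟨_, Metric.ball_mem_nhds _ hρ, hconv⟩]
    rfl
  · right
    have hmem : ∀ x ∈ Metric.ball (v : Plane) ρ, x ∈ A ↔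
        0 ≤ (-φ) (x - v) ∨ 0 ≤ (-ψ) (x - v) := by
      intro x hx
      simp only [neg_apply, neg_nonneg]
      constructor
      · intro hxA
        by_contra! h
        exact h2 ⟨⟨hx, h.1⟩, ⟨hx, h.2⟩⟩ hxA
      · intro h4
        rcases hcov hx with (h | h) | h
        · have h5 : 0 < φ (x - v) := h.1.2
          have h6 : 0 < ψ (x - v) := h.2.2
          rcases h4 with h | h <;> linarith
        · exact h3 h
        · exact hA.isClosed.frontier_subset h
    refine ⟨?_, hmem⟩
    -- Short steps along the two edges stay in `A`, but their midpoint falls into the missing open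
    -- sector.
    have hnc : ¬ ∃ U ∈ 𝓝 (v : Plane), Convex ℝ (A ∩ U) := by
      rintro ⟨U, hU, hconv⟩
      have htU : ∀ z : Plane, ∀ᶠ ε : ℝ in 𝓝[>] 0, (v : Plane) + ε • z ∈ U := by
        intro z
        have hc : Tendsto (fun ε : ℝ => (v : Plane) + ε • z) (𝓝 0)
            (𝓝 ((v : Plane) + (0 : ℝ) • z)) :=
          (by fun_prop : Continuous fun ε : ℝ => (v : Plane) + ε • z).tendsto 0
        rw [zero_smul, add_zero] at hc
        exact (hc.mono_left nhdsWithin_le_nhds).eventually hU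
      obtain ⟨ε, ⟨⟨⟨⟨h4, h5⟩, h6⟩, h7⟩, h8⟩, hε⟩ := ((((((htend u).and (htend w)).and
        (htU u)).and (htU w)).and (htend ((1 / 2 : ℝ) • u + (1 / 2 : ℝ) • w))).and
        self_mem_nhdsWithin).exists
      have hε : 0 < ε := hε
      have hua : (v : Plane) + ε • u ∈ A := (hmem _ h4).2 (by simp [hψu])
      have hwa : (v : Plane) + ε • w ∈ A := (hmem _ h5).2 (by simp [hφw])
      have hmid := hconv ⟨hua, h6⟩ ⟨hwa, h7⟩ (show (0 : ℝ) ≤ 1 / 2 by norm_num)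
        (show (0 : ℝ) ≤ 1 / 2 by norm_num) (by norm_num)
      have heq : (1 / 2 : ℝ) • ((v : Plane) + ε • u) + (1 / 2 : ℝ) • ((v : Plane) + ε • w) =
          (v : Plane) + ε • ((1 / 2 : ℝ) • u + (1 / 2 : ℝ) • w) := by module
      rw [heq] at hmid
      have := (hmem _ h8).1 hmid.1
      simp [hφu, hφw, hψu, hψw] at this
      linarith
    rw [vertexAngle, if_neg hnc]
    have := EuclideanGeometry.angle_le_pi (σ.symm v : Plane) (v : Plane) (σ v : Plane)
    linarith

end IsPolygon

/-! ### Areas of discs, half-discs and sectors -/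

theorem volume_real_closedBall_plane (x : Plane) {r : ℝ} (hr : 0 ≤ r) :
    volume.real (Metric.closedBall x r) = Real.pi * r ^ 2 := by
  rw [Measure.real, EuclideanSpace.volume_closedBall_fin_two, ENNReal.toReal_mul,
    ENNReal.toReal_pow, ENNReal.toReal_ofReal hr, ENNReal.toReal_ofReal Real.pi_pos.le, mul_comm]

theorem volume_closedBall_plane_ne_top (x : Plane) (r : ℝ) :
    volume (Metric.closedBall x r) ≠ ∞ := (isCompact_closedBall x r).measure_lt_top.ne

theorem volume_inter_closedBall_ne_top (x : Plane) (r : ℝ) (s : Set Plane) :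
    volume (Metric.closedBall x r ∩ s) ≠ ∞ :=
  measure_ne_top_of_subset Set.inter_subset_left (volume_closedBall_plane_ne_top x r)

theorem volume_preimage_sub_const (x : Plane) (S : Set Plane) :
    volume ((fun z => z - x) ⁻¹' S) = volume S := by
  simp_rw [sub_eq_add_neg]
  exact measure_preimage_add_right volume (-x) S

/-- The point reflection `z ↦ 2 x - z` exchanges the two half-discs. -/
theorem volume_reflect_halfDisc (φ : Plane →L[ℝ] ℝ) (x : Plane) (r : ℝ) :
    volume (Metric.closedBall x r ∩ {z | φ (z - x) ≤ 0}) =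
      volume (Metric.closedBall x r ∩ {z | 0 ≤ φ (z - x)}) := by
  have hm : MeasurableSet (Metric.closedBall x r ∩ {z | 0 ≤ φ (z - x)}) :=
    Metric.isClosed_closedBall.measurableSet.inter
      (isClosed_le continuous_const (by fun_prop)).measurableSet
  rw [← (Measure.measurePreserving_sub_left volume (x + x)).measure_preimage hm.nullMeasurableSet]
  congr 1
  ext z
  have h1 : x + x - z - x = -(z - x) := by abel
  simp only [Set.mem_inter_iff, Metric.mem_closedBall, Set.mem_preimage, dist_eq_norm, h1, norm_neg,
    Set.mem_ofPred_eq, map_neg, neg_nonneg]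

theorem le_volume_halfDisc (φ : Plane →L[ℝ] ℝ) (x : Plane) {r : ℝ} (hr : 0 ≤ r) :
    Real.pi / 2 * r ^ 2 ≤ volume.real (Metric.closedBall x r ∩ {z | 0 ≤ φ (z - x)}) := by
  have h1 : Metric.closedBall x r ⊆ (Metric.closedBall x r ∩ {z | φ (z - x) ≤ 0}) ∪
      (Metric.closedBall x r ∩ {z | 0 ≤ φ (z - x)}) := by
    intro z hz
    rcases le_total (φ (z - x)) 0 with h | h
    · exact Or.inl ⟨hz, h⟩
    · exact Or.inr ⟨hz, h⟩
  have h2 := (measureReal_mono h1 (measure_union_ne_top (volume_inter_closedBall_ne_top x r _)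
    (volume_inter_closedBall_ne_top x r _))).trans (measureReal_union_le _ _)
  rw [volume_real_closedBall_plane x hr] at h2
  have h3 : volume.real (Metric.closedBall x r ∩ {z | φ (z - x) ≤ 0}) =
      volume.real (Metric.closedBall x r ∩ {z | 0 ≤ φ (z - x)}) :=
    congrArg ENNReal.toReal (volume_reflect_halfDisc φ x r)
  linarith

theorem volume_halfDisc_le {φ : Plane →L[ℝ] ℝ} (hφ : φ ≠ 0) (x : Plane) {r : ℝ} (hr : 0 ≤ r) :
    volume.real (Metric.closedBall x r ∩ {z | 0 ≤ φ (z - x)}) ≤ Real.pi / 2 * r ^ 2 := by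
  have hnull : volume {z : Plane | φ (z - x) = 0} = 0 := by
    have h := Measure.addHaar_submodule (volume : Measure Plane) φ.ker
      (fun h => hφ (by ext z; exact LinearMap.mem_ker.1 (h ▸ Submodule.mem_top : z ∈ φ.ker)))
    have h2 : {z : Plane | φ (z - x) = 0} = (fun z => z - x) ⁻¹' (φ.ker : Set Plane) := rfl
    rw [h2, volume_preimage_sub_const, h]
  have hm : MeasurableSet (Metric.closedBall x r ∩ {z | 0 ≤ φ (z - x)}) :=
    Metric.isClosed_closedBall.measurableSet.inter
      (isClosed_le continuous_const (by fun_prop)).measurableSet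
  have h3 : volume.real (Metric.closedBall x r ∩ {z | φ (z - x) ≤ 0}) =
      volume.real (Metric.closedBall x r ∩ {z | 0 ≤ φ (z - x)}) :=
    congrArg ENNReal.toReal (volume_reflect_halfDisc φ x r)
  have hdisj : AEDisjoint volume (Metric.closedBall x r ∩ {z | φ (z - x) ≤ 0})
      (Metric.closedBall x r ∩ {z | 0 ≤ φ (z - x)}) :=
    measure_mono_null (fun z hz => le_antisymm hz.1.2 hz.2.2) hnull
  have h4 := measureReal_union₀ hm.nullMeasurableSet hdisj
    (volume_inter_closedBall_ne_top x r _) (volume_inter_closedBall_ne_top x r _)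
  have h5 : volume.real ((Metric.closedBall x r ∩ {z | φ (z - x) ≤ 0}) ∪
      (Metric.closedBall x r ∩ {z | 0 ≤ φ (z - x)})) ≤ volume.real (Metric.closedBall x r) :=
    measureReal_mono (Set.union_subset Set.inter_subset_left Set.inter_subset_left)
      (volume_closedBall_plane_ne_top x r)
  rw [volume_real_closedBall_plane x hr] at h5
  linarith

/-- A rotation puts `u` on the positive real axis; a conjugation, if necessary, then puts `w` into
the upper half-plane, where it is determined by its norm and the unoriented angle. -/
theorem exists_isometry_complex {u w : Plane} (hu : u ≠ 0) :
    ∃ e : Plane ≃ₗᵢ[ℝ] ℂ, e u = (‖u‖ : ℂ) ∧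
      (e w).re = ‖w‖ * Real.cos (InnerProductGeometry.angle u w) ∧
      (e w).im = ‖w‖ * Real.sin (InnerProductGeometry.angle u w) := by
  set θ := InnerProductGeometry.angle u w with hθ
  let e0 : Plane ≃ₗᵢ[ℝ] ℂ := Complex.orthonormalBasisOneI.repr.symm
  have hz : ‖e0 u‖ = ‖u‖ := e0.norm_map u
  have hu0 : ‖u‖ ≠ 0 := norm_ne_zero_iff.2 hu
  have hz0 : e0 u ≠ 0 := norm_ne_zero_iff.1 (hz ▸ hu0)
  let c : Circle := ⟨(‖u‖ : ℂ) / e0 u, by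
    refine mem_sphere_zero_iff_norm.2 ?_
    rw [norm_div, hz, Complex.norm_real, norm_norm, div_self hu0]⟩
  let e1 : Plane ≃ₗᵢ[ℝ] ℂ := e0.trans (rotation c)
  have he1 : e1 u = (‖u‖ : ℂ) := by
    change (‖u‖ : ℂ) / e0 u * e0 u = _
    exact div_mul_cancel₀ _ hz0
  have hre : (e1 w).re = ‖w‖ * Real.cos θ := by
    have h1 : inner ℝ (e1 u) (e1 w) = inner ℝ u w := e1.inner_map_map u w
    rw [he1, Complex.inner, Complex.conj_ofReal, mul_comm (e1 w), Complex.re_ofReal_mul,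
      ← InnerProductGeometry.cos_angle_mul_norm_mul_norm, ← hθ] at h1
    have h2 : ‖u‖ * (e1 w).re = ‖u‖ * (‖w‖ * Real.cos θ) := by rw [h1]; ring
    exact mul_left_cancel₀ hu0 h2
  have hsq : (e1 w).im ^ 2 = (‖w‖ * Real.sin θ) ^ 2 := by
    have h1 : ‖e1 w‖ ^ 2 = ‖w‖ ^ 2 := by rw [e1.norm_map]
    rw [Complex.sq_norm, Complex.normSq_apply, hre] at h1
    nlinarith [Real.sin_sq_add_cos_sq θ]
  have hs : 0 ≤ ‖w‖ * Real.sin θ :=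
    mul_nonneg (norm_nonneg _) (InnerProductGeometry.sin_angle_nonneg u w)
  rcases sq_eq_sq_iff_eq_or_eq_neg.1 hsq with h | h
  · exact ⟨e1, he1, hre, h⟩
  · refine ⟨e1.trans Complex.conjLIE, ?_, ?_, ?_⟩
    · simp [he1]
    · simpa using hre
    · simp [h]

/-- In polar coordinates the conditions read `0 ≤ sin t` and `0 ≤ sin (θ - t)`, that is `0 ≤ t ≤ θ`
on `(-π, π)`, and the integral splits into a radial and an angular factor. -/
theorem volume_complex_sector {θ r : ℝ} (h0 : 0 < θ) (hπ : θ < Real.pi) (hr : 0 ≤ r) :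
    volume {z : ℂ | ‖z‖ ≤ r ∧ 0 ≤ z.im ∧ 0 ≤ z.re * Real.sin θ - z.im * Real.cos θ} =
      ENNReal.ofReal (θ / 2 * r ^ 2) := by
  set T : Set ℂ := {z : ℂ | ‖z‖ ≤ r ∧ 0 ≤ z.im ∧ 0 ≤ z.re * Real.sin θ - z.im * Real.cos θ}
  have hT : MeasurableSet T := by
    have h : Continuous fun z : ℂ => z.re * Real.sin θ - z.im * Real.cos θ :=
      (Complex.continuous_re.mul continuous_const).sub
        (Complex.continuous_im.mul continuous_const)
    exact (isClosed_le continuous_norm continuous_const).measurableSet.inter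
      ((isClosed_le continuous_const Complex.continuous_im).measurableSet.inter
      (isClosed_le continuous_const h).measurableSet)
  let F : ℝ → ℝ≥0∞ := (Set.Ioc 0 r).indicator fun ρ => ENNReal.ofReal ρ
  let G : ℝ → ℝ≥0∞ := (Set.Icc 0 θ).indicator 1
  have hF : Measurable F := ENNReal.measurable_ofReal.indicator measurableSet_Ioc
  have hG : Measurable G := measurable_one.indicator measurableSet_Icc
  have h1 : volume T = ∫⁻ p : ℝ × ℝ, F p.1 * G p.2 := by
    rw [← lintegral_indicator_one hT, ← Complex.lintegral_comp_polarCoord_symm,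
      ← lintegral_indicator polarCoord.open_target.measurableSet]
    refine lintegral_congr fun p => ?_
    obtain ⟨ρ, t⟩ := p
    have htgt : (ρ, t) ∈ polarCoord.target ↔ 0 < ρ ∧ -Real.pi < t ∧ t < Real.pi := by
      rw [polarCoord_target]; rfl
    by_cases hp : (ρ, t) ∈ polarCoord.target
    · rw [Set.indicator_of_mem hp]
      obtain ⟨hρ, ht1, ht2⟩ := htgt.1 hp
      have hmem : Complex.polarCoord.symm (ρ, t) ∈ T ↔ ρ ∈ Set.Ioc 0 r ∧ t ∈ Set.Icc 0 θ := by
        have hre : (Complex.polarCoord.symm (ρ, t)).re = ρ * Real.cos t := by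
          simp [Complex.polarCoord_symm_apply, -Complex.ofReal_cos, -Complex.ofReal_sin]
        have him : (Complex.polarCoord.symm (ρ, t)).im = ρ * Real.sin t := by
          simp [Complex.polarCoord_symm_apply, -Complex.ofReal_cos, -Complex.ofReal_sin]
        have hn : ‖Complex.polarCoord.symm (ρ, t)‖ = ρ := by
          rw [Complex.norm_polarCoord_symm, abs_of_pos hρ]
        have hsin : ρ * Real.cos t * Real.sin θ - ρ * Real.sin t * Real.cos θ =
            ρ * Real.sin (θ - t) := by rw [Real.sin_sub]; ring
        change (_ ≤ r ∧ 0 ≤ _ ∧ 0 ≤ _) ↔ _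
        rw [hn, hre, him, hsin, mul_nonneg_iff_of_pos_left hρ, mul_nonneg_iff_of_pos_left hρ]
        constructor
        · rintro ⟨h2, h3, h4⟩
          have ht0 : 0 ≤ t := by
            by_contra! h
            exact absurd (Real.sin_neg_of_neg_of_neg_pi_lt h ht1) (not_lt.2 h3)
          refine ⟨⟨hρ, h2⟩, ht0, ?_⟩
          by_contra! h
          exact absurd (Real.sin_neg_of_neg_of_neg_pi_lt (sub_neg.2 h) (by linarith)) (not_lt.2 h4)
        · rintro ⟨⟨-, h2⟩, h3, h4⟩
          exact ⟨h2, Real.sin_nonneg_of_nonneg_of_le_pi h3 ht2.le,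
            Real.sin_nonneg_of_nonneg_of_le_pi (by linarith) (by linarith)⟩
      by_cases hT' : Complex.polarCoord.symm (ρ, t) ∈ T
      · obtain ⟨h2, h3⟩ := hmem.1 hT'
        simp only [F, G, Set.indicator_of_mem hT', Set.indicator_of_mem h2,
          Set.indicator_of_mem h3, Pi.one_apply, smul_eq_mul]
      · rw [Set.indicator_of_notMem hT', smul_zero]
        rcases not_and_or.1 (mt hmem.2 hT') with h | h
        · simp only [F, Set.indicator_of_notMem h, zero_mul]
        · simp only [G, Set.indicator_of_notMem h, mul_zero]
    · rw [Set.indicator_of_notMem hp]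
      by_cases hρ : ρ ∈ Set.Ioc 0 r
      · have ht : t ∉ Set.Icc 0 θ := fun ht =>
          hp (htgt.2 ⟨hρ.1, by linarith [ht.1, Real.pi_pos], by linarith [ht.2]⟩)
        simp only [G, Set.indicator_of_notMem ht, mul_zero]
      · simp only [F, Set.indicator_of_notMem hρ, zero_mul]
  have h2 : ∫⁻ ρ, F ρ = ENNReal.ofReal (r ^ 2 / 2) := by
    rw [lintegral_indicator measurableSet_Ioc,
      ← ofReal_integral_eq_lintegral_ofReal, ← intervalIntegral.integral_of_le hr, integral_id]
    · simp
    · exact (continuous_id.integrableOn_Icc (a := 0) (b := r)).mono_set Set.Ioc_subset_Icc_self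
    · exact (ae_restrict_mem measurableSet_Ioc).mono fun x hx => hx.1.le
  have h3 : ∫⁻ t, G t = ENNReal.ofReal θ := by
    rw [lintegral_indicator_one measurableSet_Icc, Real.volume_Icc, sub_zero]
  rw [h1, Measure.volume_eq_prod, lintegral_prod_mul hF.aemeasurable hG.aemeasurable, h2, h3,
    ← ENNReal.ofReal_mul (by positivity)]
  congr 1; ring

theorem angle_pos_of_planeCross_ne_zero {u w : Plane} (hcr : planeCross u w ≠ 0) :
    0 < InnerProductGeometry.angle u w := by
  refine (InnerProductGeometry.angle_nonneg u w).lt_of_ne' fun h => ?_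
  obtain ⟨-, a, -, rfl⟩ := InnerProductGeometry.angle_eq_zero_iff.1 h
  simp [planeCross_self] at hcr

/-- After the isometry to `ℂ`, `0 ≤ ψ` means a nonnegative imaginary part and `0 ≤ φ` bounds the
argument by the angle. -/
theorem volume_sector {φ ψ : Plane →L[ℝ] ℝ} {u w : Plane} (hcr : planeCross u w ≠ 0)
    (hrep : ∀ x, x = φ x • u + ψ x • w) (x : Plane) {r : ℝ} (hr : 0 ≤ r) :
    volume.real (Metric.closedBall x r ∩ {z | 0 ≤ φ (z - x) ∧ 0 ≤ ψ (z - x)}) =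
      InnerProductGeometry.angle u w / 2 * r ^ 2 := by
  set θ := InnerProductGeometry.angle u w with hθ
  have hu : u ≠ 0 := by rintro rfl; simp [planeCross_apply] at hcr
  have hw : w ≠ 0 := by rintro rfl; simp at hcr
  have hθ0 : 0 < θ := angle_pos_of_planeCross_ne_zero hcr
  have hθπ : θ < Real.pi := by
    refine (InnerProductGeometry.angle_le_pi u w).lt_of_ne fun h => ?_
    obtain ⟨-, a, -, rfl⟩ := InnerProductGeometry.angle_eq_pi_iff.1 h
    simp [planeCross_self] at hcr
  have hs : 0 < Real.sin θ := Real.sin_pos_of_pos_of_lt_pi hθ0 hθπ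
  obtain ⟨e, he, hre, him⟩ := exists_isometry_complex (w := w) hu
  have hset : Metric.closedBall x r ∩ {z | 0 ≤ φ (z - x) ∧ 0 ≤ ψ (z - x)} =
      (fun z => z - x) ⁻¹' (e ⁻¹' {z : ℂ | ‖z‖ ≤ r ∧ 0 ≤ z.im ∧
        0 ≤ z.re * Real.sin θ - z.im * Real.cos θ}) := by
    ext z
    have hz : e (z - x) = φ (z - x) • (‖u‖ : ℂ) + ψ (z - x) • e w := by
      conv_lhs => rw [hrep (z - x)]
      rw [map_add, map_smul, map_smul, he]
    have hzim : (e (z - x)).im = ψ (z - x) * (‖w‖ * Real.sin θ) := by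
      rw [hz, Complex.add_im, Complex.smul_im, Complex.smul_im, Complex.ofReal_im, him, smul_zero, zero_add, smul_eq_mul]
    have hzre : (e (z - x)).re = φ (z - x) * ‖u‖ + ψ (z - x) * (‖w‖ * Real.cos θ) := by
      rw [hz, Complex.add_re, Complex.smul_re, Complex.smul_re, Complex.ofReal_re, hre, smul_eq_mul, smul_eq_mul]
    change (dist z x ≤ r ∧ 0 ≤ φ (z - x) ∧ 0 ≤ ψ (z - x)) ↔
      (‖e (z - x)‖ ≤ r ∧ 0 ≤ (e (z - x)).im ∧ _)
    have h1 : (e (z - x)).re * Real.sin θ - (e (z - x)).im * Real.cos θ =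
        φ (z - x) * (‖u‖ * Real.sin θ) := by rw [hzre, hzim]; ring
    rw [e.norm_map, dist_eq_norm, h1, hzim,
      mul_nonneg_iff_of_pos_right (mul_pos (norm_pos_iff.2 hw) hs),
      mul_nonneg_iff_of_pos_right (mul_pos (norm_pos_iff.2 hu) hs), and_comm (a := 0 ≤ φ (z - x))]
  have hemb : MeasurableEmbedding e := e.toHomeomorph.measurableEmbedding
  rw [Measure.real, hset, volume_preimage_sub_const,
    e.measurePreserving.measure_preimage_emb hemb, volume_complex_sector hθ0 hθπ hr,
    ENNReal.toReal_ofReal (by positivity)]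

/-! ### Masses of small discs under the law of the points -/

/-- The law with density `f` on `A`. -/
noncomputable abbrev densityLaw (A : Set Plane) (f : Plane → ℝ≥0) : Measure Plane :=
  (volume.restrict A).withDensity fun x => (f x : ℝ≥0∞)

theorem mul_volume_le_densityLaw {A B S : Set Plane} {f : Plane → ℝ≥0} {g : ℝ}
    [IsFiniteMeasure (densityLaw A f)] (hB : MeasurableSet B) (hS : MeasurableSet S) (hSB : S ⊆ B)
    (hSA : S ⊆ A) (hg : ∀ᵐ z ∂(volume.restrict A), z ∈ S → g ≤ f z) :
    g * volume.real S ≤ (densityLaw A f).real B := by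
  rcases le_total g 0 with h0 | h0
  · exact (mul_nonpos_of_nonpos_of_nonneg h0 measureReal_nonneg).trans measureReal_nonneg
  have h1 : ENNReal.ofReal g * volume S ≤ densityLaw A f B := by
    calc ENNReal.ofReal g * volume S = ∫⁻ _ in S, ENNReal.ofReal g ∂(volume.restrict A) := by
          rw [setLIntegral_const, Measure.restrict_apply hS, Set.inter_eq_left.2 hSA]
      _ ≤ ∫⁻ z in S, f z ∂(volume.restrict A) := by
          refine setLIntegral_mono_ae' hS (hg.mono fun z hz hzS => ?_)
          rw [ENNReal.ofReal, ENNReal.coe_le_coe]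
          exact Real.toNNReal_le_iff_le_coe.2 (hz hzS)
      _ ≤ densityLaw A f B := by
          rw [densityLaw, withDensity_apply _ hB]
          exact lintegral_mono_set hSB
  have h2 := ENNReal.toReal_mono (measure_ne_top _ _) h1
  rwa [ENNReal.toReal_mul, ENNReal.toReal_ofReal h0] at h2

theorem densityLaw_le_mul_volume {A B S : Set Plane} {f : Plane → ℝ≥0} {g : ℝ} (hg0 : 0 ≤ g)
    (hA : MeasurableSet A) (hB : MeasurableSet B) (hg : ∀ z ∈ A ∩ B, f z ≤ g) (hS : A ∩ B ⊆ S)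
    (hSt : volume S ≠ ∞) : (densityLaw A f).real B ≤ g * volume.real S := by
  have h1 : densityLaw A f B ≤ ENNReal.ofReal g * volume S := by
    rw [densityLaw, withDensity_apply _ hB, Measure.restrict_restrict hB, Set.inter_comm]
    calc ∫⁻ z in A ∩ B, f z ≤ ∫⁻ _ in A ∩ B, ENNReal.ofReal g := by
          refine setLIntegral_mono' (hA.inter hB) fun z hz => ?_
          rw [← ENNReal.ofReal_coe_nnreal]
          exact ENNReal.ofReal_le_ofReal (hg z hz)
      _ ≤ ENNReal.ofReal g * volume S := by
          rw [setLIntegral_const]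
          gcongr
  have h2 := ENNReal.toReal_mono (ENNReal.mul_ne_top ENNReal.ofReal_ne_top hSt) h1
  rwa [ENNReal.toReal_mul, ENNReal.toReal_ofReal hg0] at h2

theorem measurableSet_halfDisc (φ : Plane →L[ℝ] ℝ) (x : Plane) (r : ℝ) :
    MeasurableSet (Metric.closedBall x r ∩ {z | 0 ≤ φ (z - x)}) :=
  Metric.isClosed_closedBall.measurableSet.inter
    (isClosed_le continuous_const (by fun_prop)).measurableSet

theorem le_densityLaw_of_halfDisc_subset {A : Set Plane} {f : Plane → ℝ≥0}
    [IsFiniteMeasure (densityLaw A f)] {φ : Plane →L[ℝ] ℝ} {x : Plane} {r g : ℝ} (hr : 0 ≤ r)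
    (hg0 : 0 ≤ g) (hsub : Metric.closedBall x r ∩ {z | 0 ≤ φ (z - x)} ⊆ A)
    (hg : ∀ z ∈ A ∩ Metric.closedBall x r, g ≤ f z) :
    g * (Real.pi / 2) * r ^ 2 ≤ (densityLaw A f).real (Metric.closedBall x r) := by
  have h := mul_volume_le_densityLaw (A := A) (f := f) (g := g)
    Metric.isClosed_closedBall.measurableSet (measurableSet_halfDisc φ x r)
    Set.inter_subset_left hsub (Eventually.of_forall fun z hz => hg z ⟨hsub hz, hz.1⟩)
  refine le_trans ?_ h
  rw [mul_assoc]
  exact mul_le_mul_of_nonneg_left (le_volume_halfDisc φ x hr) hg0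

namespace IsPolygon
variable {A : Set Plane} {V : Finset Plane} {σ : Equiv.Perm V}

theorem mem_openSegment_or_vertex (hA : IsPolygon A V σ) {y : Plane} (hy : y ∈ frontier A) :
    (∃ v : V, y ∈ openSegment ℝ (v : Plane) (σ v : Plane)) ∨ ∃ v : V, y = v := by
  obtain ⟨v, hv⟩ := hA.mem_frontier_iff.1 hy
  rw [← insert_endpoints_openSegment] at hv
  rcases hv with h | h | h
  · exact Or.inr ⟨v, h⟩
  · exact Or.inr ⟨σ v, h⟩
  · exact Or.inl ⟨v, h⟩

/-- The lower bound for the mass of small discs centred in `A` near a point of the boundary. -/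
theorem exists_local_lower_bound (hA : IsPolygon A V σ) {f : Plane → ℝ≥0}
    [IsFiniteMeasure (densityLaw A f)]
    (hfc : ∀ x ∈ frontier A, ContinuousWithinAt f A x) {f₁ κ : ℝ} (hf₁ : 0 < f₁)
    (hle : ∀ x ∈ frontier A, f₁ ≤ f x) (hκ0 : 0 < κ) (hκ1 : κ < 1) {y : Plane}
    (hy : y ∈ frontier A) :
    ∃ δ > 0, ∃ K : ℝ, ∀ x ∈ A, dist x y < δ → ∀ r, 0 < r → r < δ →
      κ * f₁ * (Real.pi / 2) * r ^ 2 ≤ (densityLaw A f).real (Metric.closedBall x r) ∨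
      ∃ v : V, dist x v ≤ K * r ∧ κ * f v * (vertexAngle A σ v / 2) * r ^ 2 ≤
        (densityLaw A f).real (Metric.closedBall x r) := by
  have hfy : 0 < (f y : ℝ) := hf₁.trans_le (hle y hy)
  have hc : ContinuousWithinAt (fun z => (f z : ℝ)) A y :=
    NNReal.continuous_coe.continuousAt.comp_continuousWithinAt (hfc y hy)
  have hev := hc.eventually_const_lt (show κ * f y < f y by nlinarith)
  obtain ⟨δ₁, hδ₁, hball⟩ := Metric.eventually_nhds_iff_ball.1
    (eventually_nhdsWithin_iff.1 hev)
  have hg1 : κ * f₁ ≤ κ * f y := mul_le_mul_of_nonneg_left (hle y hy) hκ0.le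
  have hin : ∀ ρ > 0, ∀ x, dist x y < min ρ δ₁ / 2 → ∀ r, r < min ρ δ₁ / 2 →
      Metric.closedBall x r ⊆ Metric.ball y ρ ∩ Metric.ball y δ₁ := by
    intro ρ _ x hx r hr z hz
    have h1 : dist z y < min ρ δ₁ := by
      linarith [dist_triangle z x y, Metric.mem_closedBall.1 hz]
    exact ⟨h1.trans_le (min_le_left _ _), h1.trans_le (min_le_right _ _)⟩
  have hhalf : ∀ φ : Plane →L[ℝ] ℝ, ∀ ρ > 0, ∀ x, dist x y < min ρ δ₁ / 2 → ∀ r, 0 < r →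
      r < min ρ δ₁ / 2 → (∀ z ∈ Metric.closedBall x r, z ∈ Metric.ball y ρ → 0 ≤ φ (z - x) → z ∈ A) →
      κ * f₁ * (Real.pi / 2) * r ^ 2 ≤ (densityLaw A f).real (Metric.closedBall x r) := by
    intro φ ρ hρ x hx r hr0 hr h
    refine le_densityLaw_of_halfDisc_subset hr0.le (by positivity)
      (fun z hz => h z hz.1 (hin ρ hρ x hx r hr hz.1).1 hz.2) fun z hz => ?_
    exact hg1.trans (hball z (hin ρ hρ x hx r hr hz.2).2 hz.1).le
  rcases hA.mem_openSegment_or_vertex hy with ⟨v, hv⟩ | ⟨v, rfl⟩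
  · obtain ⟨φ, ρ, hρ, -, -, hmem⟩ := hA.exists_halfPlane hv
    refine ⟨min ρ δ₁ / 2, by positivity, 0, fun x hx hxy r hr0 hr => Or.inl ?_⟩
    have hxb : x ∈ Metric.ball y ρ := (hin ρ hρ x hxy r hr (Metric.mem_closedBall_self hr0.le)).1
    refine hhalf φ ρ hρ x hxy r hr0 hr fun z _ hzb hz => (hmem z hzb).2 ?_
    have := (hmem x hxb).1 hx
    rw [show z - y = (z - x) + (x - y) by abel, map_add]
    linarith
  · obtain ⟨φ, ψ, ρ, hρ, -, -, hrep, hcase⟩ := hA.exists_sector v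
    set u : Plane := (σ.symm v : Plane) - v
    set w : Plane := (σ v : Plane) - v
    -- This `K` bounds `‖x - v‖ / r` when both coordinates of `x - v` are at most `‖φ‖ r` and `‖ψ‖
    -- r`.
    refine ⟨min ρ δ₁ / 2, by positivity, ‖φ‖ * ‖u‖ + ‖ψ‖ * ‖w‖, fun x hx hxy r hr0 hr => ?_⟩
    have hxb : x ∈ Metric.ball (v : Plane) ρ :=
      (hin ρ hρ x hxy r hr (Metric.mem_closedBall_self hr0.le)).1
    have hsplit : ∀ (χ : Plane →L[ℝ] ℝ) (z : Plane), χ (z - v) = χ (z - x) + χ (x - v) :=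
      fun χ z => by rw [← map_add]; congr 1; abel
    have hbound : ∀ (χ : Plane →L[ℝ] ℝ), ∀ z ∈ Metric.closedBall x r, -(‖χ‖ * r) ≤ χ (z - x) := by
      intro χ z hz
      have h1 := χ.le_opNorm (z - x)
      have h2 : ‖z - x‖ ≤ r := by rw [← dist_eq_norm]; exact hz
      have h3 := mul_le_mul_of_nonneg_left h2 (norm_nonneg χ)
      have h4 := neg_abs_le (χ (z - x))
      rw [Real.norm_eq_abs] at h1
      linarith
    rcases hcase with ⟨hang, hmem⟩ | ⟨-, hmem⟩
    · obtain ⟨hx1, hx2⟩ := (hmem x hxb).1 hx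
      -- If one coordinate is this large, its constraint holds on the whole disc, and only the other
      -- edge can cut it: a half-disc fits into `A`. Otherwise both coordinates are of order `r` and
      -- `x` is close to `v`.
      by_cases h1 : ‖φ‖ * r ≤ φ (x - v)
      · left
        refine hhalf ψ ρ hρ x hxy r hr0 hr fun z hz hzb hz0 => (hmem z hzb).2 ⟨?_, ?_⟩
        · rw [hsplit]; linarith [hbound φ z hz]
        · rw [hsplit]; linarith
      by_cases h2 : ‖ψ‖ * r ≤ ψ (x - v)
      · left
        refine hhalf φ ρ hρ x hxy r hr0 hr fun z hz hzb hz0 => (hmem z hzb).2 ⟨?_, ?_⟩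
        · rw [hsplit]; linarith
        · rw [hsplit]; linarith [hbound ψ z hz]
      right
      push Not at h1 h2
      refine ⟨v, ?_, ?_⟩
      · rw [dist_eq_norm, hrep (x - v)]
        refine (norm_add_le _ _).trans ?_
        rw [norm_smul, norm_smul, Real.norm_of_nonneg hx1, Real.norm_of_nonneg hx2]
        nlinarith [norm_nonneg u, norm_nonneg w]
      · have hsub : Metric.closedBall x r ∩ {z | 0 ≤ φ (z - x) ∧ 0 ≤ ψ (z - x)} ⊆ A := by
          rintro z ⟨hz, hz1, hz2⟩
          refine (hmem z (hin ρ hρ x hxy r hr hz).1).2 ⟨?_, ?_⟩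
          · rw [hsplit]; linarith
          · rw [hsplit]; linarith
        have hmeas : MeasurableSet
            (Metric.closedBall x r ∩ {z | 0 ≤ φ (z - x) ∧ 0 ≤ ψ (z - x)}) := by
          have hχ : ∀ χ : Plane →L[ℝ] ℝ, MeasurableSet {z : Plane | 0 ≤ χ (z - x)} := fun χ =>
            (isClosed_le continuous_const (by fun_prop)).measurableSet
          exact Metric.isClosed_closedBall.measurableSet.inter ((hχ φ).inter (hχ ψ))
        have h := mul_volume_le_densityLaw (A := A) (f := f) (g := κ * f v)
          Metric.isClosed_closedBall.measurableSet hmeas Set.inter_subset_left hsub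
          (Eventually.of_forall fun z hz =>
            (hball z (hin ρ hρ x hxy r hr hz.1).2 (hsub hz)).le)
        rw [volume_sector (hA.cross_edges_ne_zero v) hrep x hr0.le, ← hang, ← mul_assoc] at h
        exact h
    -- At a reflex vertex `A` is locally a union of two half-planes; one of them contains `x` and
    -- hence a half-disc around it.
    · left
      rcases (hmem x hxb).1 hx with h1 | h1
      · refine hhalf (-φ) ρ hρ x hxy r hr0 hr fun z _ hzb hz0 => (hmem z hzb).2 (Or.inl ?_)
        rw [hsplit]; linarith
      · refine hhalf (-ψ) ρ hρ x hxy r hr0 hr fun z _ hzb hz0 => (hmem z hzb).2 (Or.inr ?_)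
        rw [hsplit]; linarith

/-- The frontier is compact, and the property `Q` passes to subsets and unions, so the local
constants can be made uniform. -/
theorem exists_lower_bound_near_frontier (hA : IsPolygon A V σ) {f : Plane → ℝ≥0}
    [IsFiniteMeasure (densityLaw A f)]
    (hfc : ∀ x ∈ frontier A, ContinuousWithinAt f A x) {f₁ κ : ℝ} (hf₁ : 0 < f₁)
    (hle : ∀ x ∈ frontier A, f₁ ≤ f x) (hκ0 : 0 < κ) (hκ1 : κ < 1) :
    ∃ δ > 0, ∃ K : ℝ, ∀ x ∈ A, ∀ y ∈ frontier A, dist x y < δ → ∀ r, 0 < r → r < δ →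
      κ * f₁ * (Real.pi / 2) * r ^ 2 ≤ (densityLaw A f).real (Metric.closedBall x r) ∨
      ∃ v : V, dist x v ≤ K * r ∧ κ * f v * (vertexAngle A σ v / 2) * r ^ 2 ≤
        (densityLaw A f).real (Metric.closedBall x r) := by
  have hcpt : IsCompact (frontier A) :=
    hA.isCompact.of_isClosed_subset isClosed_frontier hA.isClosed.frontier_subset
  let Q : Set Plane → Prop := fun S => ∃ δ > 0, ∃ K : ℝ, ∀ x ∈ A, ∀ y ∈ S, dist x y < δ →
    ∀ r, 0 < r → r < δ →
      κ * f₁ * (Real.pi / 2) * r ^ 2 ≤ (densityLaw A f).real (Metric.closedBall x r) ∨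
      ∃ v : V, dist x v ≤ K * r ∧ κ * f v * (vertexAngle A σ v / 2) * r ^ 2 ≤
        (densityLaw A f).real (Metric.closedBall x r)
  refine hcpt.induction_on (p := Q) ?_ ?_ ?_ ?_
  · exact ⟨1, one_pos, 0, fun x _ y hy => absurd hy (Set.notMem_empty y)⟩
  · rintro S T hST ⟨δ, hδ, K, h⟩
    exact ⟨δ, hδ, K, fun x hx y hy => h x hx y (hST hy)⟩
  · rintro S T ⟨δ, hδ, K, h⟩ ⟨δ', hδ', K', h'⟩
    refine ⟨min δ δ', lt_min hδ hδ', max K K', fun x hx y hy hxy r hr0 hr => ?_⟩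
    have hmono : ∀ L ≤ max K K', L * r ≤ max K K' * r := fun L hL =>
      mul_le_mul_of_nonneg_right hL hr0.le
    rcases hy with hy | hy
    · exact (h x hx y hy (hxy.trans_le (min_le_left _ _)) r hr0 (hr.trans_le (min_le_left _ _))).imp_right
        fun ⟨v, h1, h2⟩ => ⟨v, h1.trans (hmono K (le_max_left _ _)), h2⟩
    · exact (h' x hx y hy (hxy.trans_le (min_le_right _ _)) r hr0
        (hr.trans_le (min_le_right _ _))).imp_right
        fun ⟨v, h1, h2⟩ => ⟨v, h1.trans (hmono K' (le_max_right _ _)), h2⟩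
  · intro y hy
    obtain ⟨δ, hδ, K, h⟩ := hA.exists_local_lower_bound hfc hf₁ hle hκ0 hκ1 hy
    refine ⟨Metric.ball y (δ / 2), mem_nhdsWithin_of_mem_nhds (Metric.ball_mem_nhds y (by positivity)),
      δ / 2, by positivity, K, fun x hx y' hy' hxy r hr0 hr => h x hx ?_ r hr0 (by linarith)⟩
    have := Metric.mem_ball.1 hy'
    linarith [dist_triangle x y' y]

end IsPolygon

/-! ### Nets of discs, segments and bounded sets -/

theorem closedBall_subset_of_disjoint_frontier {A : Set Plane} (hA : IsClosed A) {x : Plane} {r : ℝ}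
    (hr : 0 ≤ r) (hx : x ∈ A) (h : Disjoint (Metric.closedBall x r) (frontier A)) :
    Metric.closedBall x r ⊆ A :=
  (subset_or_subset_compl_of_disjoint_frontier hA (convex_closedBall x r).isPreconnected h).resolve_right
    fun h' => h' (Metric.mem_closedBall_self hr) hx

/-- Rescaling by `r` reduces to one fixed compact disc, so `N` depends neither on `v` nor on `r`. -/
theorem exists_net_closedBall (K : ℝ) {η : ℝ} (hη : 0 < η) :
    ∃ N : ℕ, ∀ (v : Plane) (r : ℝ), 0 < r → ∃ F : Finset Plane, F.card ≤ N ∧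
      ∀ x, dist x v ≤ K * r → ∃ y ∈ F, dist x y ≤ η * r := by
  classical
  obtain ⟨T, -, hTfin, hcov⟩ := (isCompact_closedBall (0 : Plane) K).finite_cover_balls hη
  refine ⟨hTfin.toFinset.card, fun v r hr => ⟨hTfin.toFinset.image fun t => v + r • t,
    Finset.card_image_le, fun x hx => ?_⟩⟩
  have hz : r⁻¹ • (x - v) ∈ Metric.closedBall (0 : Plane) K := by
    rw [mem_closedBall_zero_iff, norm_smul, norm_inv, Real.norm_of_nonneg hr.le, ← dist_eq_norm,
      inv_mul_le_iff₀ hr]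
    linarith
  obtain ⟨t, ht, htz⟩ := Set.mem_iUnion₂.1 (hcov hz)
  refine ⟨v + r • t, Finset.mem_image_of_mem _ (hTfin.mem_toFinset.2 ht), ?_⟩
  have h1 : x - (v + r • t) = r • (r⁻¹ • (x - v) - t) := by
    rw [smul_sub, smul_inv_smul₀ hr.ne']; abel
  rw [dist_eq_norm, h1, norm_smul, Real.norm_of_nonneg hr.le, ← dist_eq_norm, mul_comm]
  exact mul_le_mul_of_nonneg_right (Metric.mem_ball.1 htz).le hr.le

/-- Base points with spacing at most `r` on the segment, each with a net of the disc of radius `2 r`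
around it: one `r` for the width of the tube and one for the spacing. -/
theorem exists_net_segment (a b : Plane) {η : ℝ} (hη : 0 < η) :
    ∃ C : ℝ, ∀ r : ℝ, 0 < r → r ≤ 1 → ∃ F : Finset Plane, (F.card : ℝ) ≤ C * r⁻¹ ∧
      ∀ x, (∃ y ∈ segment ℝ a b, dist x y ≤ r) → ∃ y ∈ F, dist x y ≤ η * r := by
  classical
  obtain ⟨N, hN⟩ := exists_net_closedBall 2 hη
  choose! G hGcard hG using hN
  refine ⟨(‖b - a‖ + 3) * N, fun r hr hr1 => ?_⟩
  set M := ⌈‖b - a‖ / r⌉₊ + 1 with hM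
  have hM0 : (0 : ℝ) < M := by rw [hM]; positivity
  refine ⟨(Finset.range (M + 1)).biUnion fun i => G (a + ((i : ℝ) / M) • (b - a)) r, ?_, ?_⟩
  · have h1 : ((Finset.range (M + 1)).biUnion fun i : ℕ =>
        G (a + ((i : ℝ) / M) • (b - a)) r).card ≤ (M + 1) * N :=
      (Finset.card_biUnion_le_card_mul _ _ N fun i _ => hGcard _ r hr).trans (by simp)
    have h2 : ((M : ℝ) + 1) * r ≤ ‖b - a‖ + 3 := by
      have h3 : (⌈‖b - a‖ / r⌉₊ : ℝ) < ‖b - a‖ / r + 1 := Nat.ceil_lt_add_one (by positivity)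
      have h4 : ((M : ℝ) + 1) ≤ ‖b - a‖ / r + 3 := by rw [hM]; push_cast; linarith
      calc ((M : ℝ) + 1) * r ≤ (‖b - a‖ / r + 3) * r := by gcongr
        _ = ‖b - a‖ + 3 * r := by field_simp
        _ ≤ ‖b - a‖ + 3 := by linarith
    calc _ ≤ (((M + 1) * N : ℕ) : ℝ) := by exact_mod_cast h1
      _ = ((M : ℝ) + 1) * r * N * r⁻¹ := by push_cast; field_simp
      _ ≤ (‖b - a‖ + 3) * N * r⁻¹ := by gcongr
  · rintro x ⟨y, hy, hxy⟩
    rw [segment_eq_image'] at hy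
    obtain ⟨s, ⟨hs0, hs1⟩, hs⟩ := hy
    have hs : a + s • (b - a) = y := hs
    set i := ⌊s * M⌋₊ with hi
    have hi1 : (i : ℝ) ≤ s * M := Nat.floor_le (by positivity)
    have hi2 : s * M < i + 1 := Nat.lt_floor_add_one _
    have hiM : i < M + 1 := by
      have : (i : ℝ) < M + 1 := by nlinarith
      exact_mod_cast this
    have hd : dist y (a + ((i : ℝ) / M) • (b - a)) ≤ r := by
      have h1 : y - (a + ((i : ℝ) / M) • (b - a)) = (s - i / M) • (b - a) := by
        rw [← hs, sub_smul]; abel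
      have h2 : 0 ≤ s - i / M := by rw [sub_nonneg, div_le_iff₀ hM0]; exact hi1
      have h3 : s - i / M ≤ 1 / M := by
        rw [sub_le_iff_le_add, ← add_div, le_div_iff₀ hM0]; linarith
      have h4 : ‖b - a‖ / r ≤ M := by
        have := Nat.le_ceil (‖b - a‖ / r)
        rw [hM]; push_cast; linarith
      rw [dist_eq_norm, h1, norm_smul, Real.norm_of_nonneg h2]
      calc (s - i / M) * ‖b - a‖ ≤ 1 / M * ‖b - a‖ := by gcongr
        _ ≤ r := by
          rw [div_le_iff₀ hr] at h4
          rw [one_div, inv_mul_le_iff₀ hM0]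
          linarith
    obtain ⟨z, hz, hxz⟩ := hG (a + ((i : ℝ) / M) • (b - a)) r hr x
      (by linarith [dist_triangle x y (a + ((i : ℝ) / M) • (b - a))])
    exact ⟨z, Finset.mem_biUnion.2 ⟨i, Finset.mem_range.2 hiM, hz⟩, hxz⟩

theorem exists_net_bounded {A : Set Plane} (hA : Bornology.IsBounded A) {η : ℝ} (hη : 0 < η) :
    ∃ C : ℝ, ∀ r : ℝ, 0 < r → r ≤ 1 → ∃ F : Finset Plane, (F.card : ℝ) ≤ C * (r ^ 2)⁻¹ ∧
      ∀ x ∈ A, ∃ y ∈ F, dist x y ≤ η * r := by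
  classical
  obtain ⟨D, hD0, hD⟩ := hA.exists_pos_norm_le
  refine ⟨(4 * D / η + 5) ^ 2, fun r hr hr1 => ?_⟩
  -- Rounding down in a grid of mesh `h` moves a point by at most `√2 h`, which is below `2 h = η
  -- r`.
  set h : ℝ := η * r / 2 with hh
  have hh0 : 0 < h := by positivity
  set m : ℕ := ⌈D / h⌉₊ + 1 with hm
  let I : Finset ℤ := Finset.Icc (-(m : ℤ)) m
  refine ⟨(I ×ˢ I).image fun p => !₂[h * p.1, h * p.2], ?_, ?_⟩
  · have h1 : ((I ×ˢ I).image fun p : ℤ × ℤ => (!₂[h * p.1, h * p.2] : Plane)).card ≤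
        (2 * m + 1) ^ 2 := by
      refine Finset.card_image_le.trans ?_
      rw [Finset.card_product, Int.card_Icc, ← sq]
      exact Nat.pow_le_pow_left (by omega) 2
    have h2 : (2 * (m : ℝ) + 1) * r ≤ 4 * D / η + 5 := by
      have h3 : (⌈D / h⌉₊ : ℝ) < D / h + 1 := Nat.ceil_lt_add_one (by positivity)
      have h4 : 2 * (m : ℝ) + 1 ≤ 2 * (D / h) + 5 := by rw [hm]; push_cast; linarith
      calc (2 * (m : ℝ) + 1) * r ≤ (2 * (D / h) + 5) * r := by gcongr
        _ = 4 * D / η + 5 * r := by rw [hh]; field_simp; ring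
        _ ≤ 4 * D / η + 5 := by linarith
    calc _ ≤ (((2 * m + 1) ^ 2 : ℕ) : ℝ) := by exact_mod_cast h1
      _ = ((2 * (m : ℝ) + 1) * r) ^ 2 * (r ^ 2)⁻¹ := by push_cast; field_simp
      _ ≤ _ := by gcongr
  · intro x hx
    have hcoord : ∀ i : Fin 2, |x i| ≤ D := fun i =>
      (PiLp.norm_apply_le x i).trans (hD x hx)
    have hI : ∀ i : Fin 2, ⌊x i / h⌋ ∈ I := by
      intro i
      obtain ⟨h1, h2⟩ := abs_le.1 (hcoord i)
      have h3 : D / h ≤ m := by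
        have := Nat.le_ceil (D / h)
        rw [hm]; push_cast; linarith
      have h4 : x i / h ≤ D / h := by gcongr
      have h5 : -(D / h) ≤ x i / h := by rw [← neg_div]; gcongr
      rw [Finset.mem_Icc]
      refine ⟨Int.le_floor.2 (by push_cast; linarith), ?_⟩
      have : (⌊x i / h⌋ : ℝ) ≤ m := (Int.floor_le _).trans (by linarith)
      exact_mod_cast this
    have hd : ∀ i : Fin 2, (x i - h * ⌊x i / h⌋) ^ 2 ≤ h ^ 2 := by
      intro i
      have h1 := Int.floor_le (x i / h)
      have h2 := Int.lt_floor_add_one (x i / h)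
      rw [le_div_iff₀ hh0] at h1
      rw [div_lt_iff₀ hh0] at h2
      exact pow_le_pow_left₀ (by linarith) (by linarith) 2
    refine ⟨!₂[h * ⌊x 0 / h⌋, h * ⌊x 1 / h⌋],
      Finset.mem_image.2 ⟨(⌊x 0 / h⌋, ⌊x 1 / h⌋), Finset.mem_product.2 ⟨hI 0, hI 1⟩, rfl⟩, ?_⟩
    rw [EuclideanSpace.dist_eq, Real.sqrt_le_iff]
    refine ⟨by positivity, ?_⟩
    have e0 := hd 0
    have e1 := hd 1
    simp only [Fin.sum_univ_two, Real.dist_eq, sq_abs]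
    have : η * r = 2 * h := by rw [hh]; ring
    rw [this]
    simp
    nlinarith

/-! ### The logarithmic scale of radii -/

/-- The radius `r` with `n r ^ 2 / log n = t`. -/
noncomputable def logRadius (t : ℝ) (n : ℕ) : ℝ := √(t * Real.log n / n)

theorem logRadius_nonneg (t : ℝ) (n : ℕ) : 0 ≤ logRadius t n := Real.sqrt_nonneg _

theorem logRadius_sq {t : ℝ} (ht : 0 ≤ t) (n : ℕ) : logRadius t n ^ 2 = t * Real.log n / n :=
  Real.sq_sqrt (div_nonneg (mul_nonneg ht (Real.log_natCast_nonneg n)) (Nat.cast_nonneg n))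

theorem tendsto_log_natCast : Tendsto (fun n : ℕ => Real.log n) atTop atTop :=
  Real.tendsto_log_atTop.comp tendsto_natCast_atTop_atTop

theorem tendsto_log_div_natCast : Tendsto (fun n : ℕ => Real.log n / n) atTop (𝓝 0) :=
  (Real.isLittleO_log_id_atTop.tendsto_div_nhds_zero).comp tendsto_natCast_atTop_atTop

theorem tendsto_logRadius (t : ℝ) : Tendsto (logRadius t) atTop (𝓝 0) := by
  have h := (tendsto_log_div_natCast.const_mul t).sqrt
  rw [mul_zero, Real.sqrt_zero] at h
  exact h.congr fun n => by rw [logRadius, mul_div_assoc]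

theorem eventually_logRadius_pos {t : ℝ} (ht : 0 < t) : ∀ᶠ n in atTop, 0 < logRadius t n := by
  filter_upwards [tendsto_log_natCast.eventually_gt_atTop 0, eventually_gt_atTop 0] with n hn hn0
  have : (0 : ℝ) < n := by exact_mod_cast hn0
  exact Real.sqrt_pos.2 (by positivity)

/-- With the next lemma this turns the net sizes `r ^ (-2)` and `r ^ (-1)` into the powers `n` and
`n ^ (1 / 2)`, dropping the logarithm. -/
theorem eventually_inv_sq_logRadius_le {t : ℝ} (ht : 0 < t) :
    ∀ᶠ n : ℕ in atTop, (logRadius t n ^ 2)⁻¹ ≤ t⁻¹ * n := by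
  filter_upwards [tendsto_log_natCast.eventually_ge_atTop 1, eventually_gt_atTop 0] with n hn hn0
  have : (0 : ℝ) < n := by exact_mod_cast hn0
  rw [logRadius_sq ht.le, inv_div, div_le_iff₀ (by positivity)]
  have : t⁻¹ * n * (t * Real.log n) = n * Real.log n := by field_simp
  rw [this]
  nlinarith

theorem eventually_inv_logRadius_le {t : ℝ} (ht : 0 < t) :
    ∀ᶠ n : ℕ in atTop, (logRadius t n)⁻¹ ≤ √t⁻¹ * (n : ℝ) ^ (1 / 2 : ℝ) := by
  filter_upwards [eventually_inv_sq_logRadius_le ht] with n hn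
  rw [← Real.sqrt_eq_rpow, ← Real.sqrt_mul (by positivity)]
  refine Real.le_sqrt_of_sq_le ?_
  rwa [inv_pow]

theorem poissonRate_pos_of_lt {b c : ℝ} (hb : 0 ≤ b) (hbc : b < c) : 0 < poissonRate b c := by
  rcases hb.eq_or_lt with rfl | hb
  · simpa [poissonRate] using hbc
  · exact poissonRate_pos hb (hb.trans hbc) hbc.ne

/-! ### Upper bound: no disc has too few points -/

section
variable {Ω : Type*} [MeasurableSpace Ω]

/-- With polynomially small failure probability, all discs of radius `r n` centred in `S n` are hit
more than `b log n` times, for some `b > β`. -/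
def RareShortage (P : Measure Ω) (X : ℕ → Ω → Plane) (β : ℝ) (S : ℕ → Set Plane) (r : ℕ → ℝ) :
    Prop :=
  ∃ b > β, ∃ δ > (0 : ℝ), ∃ M : ℝ, ∀ᶠ n : ℕ in atTop,
    P.real {ω | ∃ x ∈ S n, (hits (fun i => X i ω) (Metric.closedBall x (r n)) n : ℝ) <
      b * Real.log n} ≤ M * (n : ℝ) ^ (-δ)

variable {P : Measure Ω} [IsProbabilityMeasure P] {X : ℕ → Ω → Plane} {μ : Measure Plane} {β : ℝ}
  {S T : ℕ → Set Plane} {r : ℕ → ℝ}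

theorem RareShortage.mono (h : RareShortage P X β T r) (hST : ∀ᶠ n in atTop, S n ⊆ T n) :
    RareShortage P X β S r := by
  obtain ⟨b, hb, δ, hδ, M, hM⟩ := h
  refine ⟨b, hb, δ, hδ, M, ?_⟩
  filter_upwards [hM, hST] with n h1 h2
  refine (measureReal_mono ?_).trans h1
  rintro ω ⟨x, hx, h⟩
  exact ⟨x, h2 hx, h⟩

theorem RareShortage.union (h : RareShortage P X β S r) (h' : RareShortage P X β T r) :
    RareShortage P X β (fun n => S n ∪ T n) r := by
  obtain ⟨b, hb, δ, hδ, M, hM⟩ := h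
  obtain ⟨b', hb', δ', hδ', M', hM'⟩ := h'
  refine ⟨min b b', lt_min hb hb', min δ δ', lt_min hδ hδ', |M| + |M'|, ?_⟩
  filter_upwards [hM, hM', eventually_ge_atTop 1] with n h1 h2 hn
  have hn1 : (1 : ℝ) ≤ n := by exact_mod_cast hn
  have hl : 0 ≤ Real.log n := Real.log_natCast_nonneg n
  have hsub : {ω | ∃ x ∈ S n ∪ T n, (hits (fun i => X i ω) (Metric.closedBall x (r n)) n : ℝ) <
      min b b' * Real.log n} ⊆
      {ω | ∃ x ∈ S n, (hits (fun i => X i ω) (Metric.closedBall x (r n)) n : ℝ) < b * Real.log n} ∪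
      {ω | ∃ x ∈ T n, (hits (fun i => X i ω) (Metric.closedBall x (r n)) n : ℝ) <
        b' * Real.log n} := by
    rintro ω ⟨x, hx | hx, h⟩
    · exact Or.inl ⟨x, hx, h.trans_le (mul_le_mul_of_nonneg_right (min_le_left _ _) hl)⟩
    · exact Or.inr ⟨x, hx, h.trans_le (mul_le_mul_of_nonneg_right (min_le_right _ _) hl)⟩
  refine (measureReal_mono hsub).trans ((measureReal_union_le _ _).trans ?_)
  rw [add_mul]
  refine add_le_add (h1.trans ?_) (h2.trans ?_)
  · exact mul_le_mul (le_abs_self M) (Real.rpow_le_rpow_of_exponent_le hn1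
      (neg_le_neg (min_le_left _ _))) (by positivity) (abs_nonneg M)
  · exact mul_le_mul (le_abs_self M') (Real.rpow_le_rpow_of_exponent_le hn1
      (neg_le_neg (min_le_right _ _))) (by positivity) (abs_nonneg M')

theorem RareShortage.iUnion {ι : Type*} [Finite ι] {S : ι → ℕ → Set Plane}
    (h : ∀ i, RareShortage P X β (S i) r) : RareShortage P X β (fun n => ⋃ i, S i n) r := by
  classical
  cases nonempty_fintype ι
  have key : ∀ s : Finset ι, RareShortage P X β (fun n => ⋃ i ∈ s, S i n) r := by
    intro s
    induction s using Finset.induction_on with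
    | empty =>
      refine ⟨β + 1, by linarith, 1, one_pos, 0, Eventually.of_forall fun n => ?_⟩
      simp
    | insert a s _ ih =>
      refine ((h a).union ih).mono (Eventually.of_forall fun n => ?_)
      rw [Finset.set_biUnion_insert]
  refine (key Finset.univ).mono (Eventually.of_forall fun n => ?_)
  simp

/-- Union bound: `n ^ e` net points, each failing with probability about `n ^ (-x)`, where `e < x`.
For `y` within `η` of `x`, `B(x, r - 2 η) ⊆ B(y, r - η) ⊆ B(x, r)`: the first inclusion carries the
mass bound to the net, the second carries the points back. -/
theorem RareShortage.of_net (hX : ∀ i, Measurable (X i)) (hindep : iIndepFun X P)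
    (hlaw : ∀ i, P.map (X i) = μ) {c e C : ℝ} {η : ℕ → ℝ} (hβ : 0 ≤ β) (hβc : β < c)
    (he : e < poissonRate β c)
    (hnet : ∀ᶠ n : ℕ in atTop, ∃ F : Finset Plane, (F.card : ℝ) ≤ C * (n : ℝ) ^ e ∧
      ∀ x ∈ S n, ∃ y ∈ F, dist x y ≤ η n)
    (hμ : ∀ᶠ n : ℕ in atTop, ∀ x ∈ S n,
      c * Real.log n / n ≤ μ.real (Metric.closedBall x (r n - 2 * η n))) :
    RareShortage P X β S r := by
  classical
  have hprob : IsProbabilityMeasure μ :=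
    hlaw 0 ▸ Measure.isProbabilityMeasure_map (hX 0).aemeasurable
  obtain ⟨x, hex, hx⟩ := exists_between he
  obtain ⟨b, hb, M, hM0, hM⟩ := one_sub_binTail_le_rpow hβ hβc hx
  refine ⟨b, hb, x - e, sub_pos.2 hex, C * M, ?_⟩
  filter_upwards [hnet, hμ, eventually_ge_atTop 1] with n ⟨F, hFcard, hF⟩ hn hn1
  have hn0 : (0 : ℝ) < n := by exact_mod_cast hn1
  set F' := F.filter fun y => ∃ x ∈ S n, dist x y ≤ η n
  have hsub : {ω | ∃ x ∈ S n, (hits (fun i => X i ω) (Metric.closedBall x (r n)) n : ℝ) <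
      b * Real.log n} ⊆ ⋃ y ∈ F', {ω | hits (fun i => X i ω)
        (Metric.closedBall y (r n - η n)) n < ⌈b * Real.log n⌉₊} := by
    rintro ω ⟨x, hx, h⟩
    obtain ⟨y, hy, hxy⟩ := hF x hx
    refine Set.mem_biUnion (Finset.mem_filter.2 ⟨hy, x, hx, hxy⟩ : y ∈ F') ?_
    have h1 : hits (fun i => X i ω) (Metric.closedBall y (r n - η n)) n ≤
        hits (fun i => X i ω) (Metric.closedBall x (r n)) n :=
      hits_mono_set _ (Metric.closedBall_subset_closedBall' (by rw [dist_comm]; linarith)) n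
    exact h1.trans_lt (Nat.lt_ceil.2 h)
  refine (measureReal_mono hsub (measure_ne_top P _)).trans ((measureReal_biUnion_finset_le _ _).trans ?_)
  have hterm : ∀ y ∈ F', P.real {ω | hits (fun i => X i ω)
      (Metric.closedBall y (r n - η n)) n < ⌈b * Real.log n⌉₊} ≤ M * (n : ℝ) ^ (-x) := by
    intro y hy
    obtain ⟨-, z, hz, hzy⟩ := Finset.mem_filter.1 hy
    rw [measureReal_hits_lt hX hindep hlaw Metric.isClosed_closedBall.measurableSet]
    refine hM n hn1 _ measureReal_nonneg measureReal_le_one ?_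
    have h1 : c * Real.log n / n ≤ μ.real (Metric.closedBall y (r n - η n)) :=
      (hn z hz).trans (measureReal_mono
        (Metric.closedBall_subset_closedBall' (by linarith)))
    rw [div_le_iff₀ hn0] at h1
    linarith
  refine (Finset.sum_le_sum hterm).trans ?_
  rw [Finset.sum_const, nsmul_eq_mul]
  have hcard : (F'.card : ℝ) ≤ C * (n : ℝ) ^ e :=
    le_trans (by exact_mod_cast Finset.card_filter_le _ _) hFcard
  calc _ ≤ C * (n : ℝ) ^ e * (M * (n : ℝ) ^ (-x)) := by gcongr
    _ = C * M * ((n : ℝ) ^ e * (n : ℝ) ^ (-x)) := by ring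
    _ = C * M * (n : ℝ) ^ (-(x - e)) := by rw [← Real.rpow_add hn0]; ring_nf

/-- Passage from a sparse subsequence to the whole sequence. -/
theorem RareShortage.ae_eventually {A : Set Plane} {t t' : ℝ} (hβ : 0 ≤ β) (ht : 0 < t)
    (htt : t < t') (h : RareShortage P X β (fun _ => A) (logRadius t)) :
    ∃ b > β, ∀ᵐ ω ∂P, ∀ᶠ n : ℕ in atTop, ∀ x ∈ A,
      b * Real.log n ≤ hits (fun i => X i ω) (Metric.closedBall x (logRadius t' n)) n := by
  obtain ⟨b, hb, δ, hδ, M, hM⟩ := h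
  obtain ⟨b', hβb', hb'⟩ := exists_between hb
  refine ⟨b', hβb', ?_⟩
  obtain ⟨K, hK, hae⟩ := ae_eventually_notMem_pow hδ hM
  have ht' : 0 < t' := ht.trans htt
  have hθ : 1 < t' / t := (one_lt_div ht).2 htt
  have hKt : Tendsto (fun j : ℕ => Real.log ((j ^ K : ℕ) : ℝ)) atTop atTop :=
    tendsto_log_natCast.comp (tendsto_pow_atTop (by omega))
  -- This makes `b log m ≥ b' log n` whenever `m ≤ n ≤ (t' / t) m`.
  have hlarge := hKt.eventually_ge_atTop (b' * Real.log (t' / t) / (b - b'))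
  filter_upwards [hae] with ω hω
  obtain ⟨J, hJ⟩ := (hω.and (hlarge.and (eventually_ge_atTop 1))).exists_forall_of_atTop
  filter_upwards [exists_pow_sandwich hK hθ J] with n ⟨j, hjJ, hjn, hnj, hj⟩ x hx
  obtain ⟨h1, h2, h3⟩ := hJ j hjJ
  set m := j ^ K with hm
  have hm0 : (0 : ℝ) < m := by
    rw [hm]; exact_mod_cast Nat.pow_pos (n := K) h3
  have hmn : (m : ℝ) ≤ n := by exact_mod_cast hjn
  have hn0 : (0 : ℝ) < n := hm0.trans_le hmn
  have hnm : (n : ℝ) ≤ t' / t * m := le_trans (by exact_mod_cast hnj) hj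
  have hlog : Real.log m ≤ Real.log n := Real.log_le_log hm0 hmn
  have hlm : 0 ≤ Real.log m := Real.log_natCast_nonneg m
  have hlog2 : Real.log n ≤ Real.log (t' / t) + Real.log m := by
    rw [← Real.log_mul (by positivity) hm0.ne']
    exact Real.log_le_log hn0 hnm
  -- The larger constant `t'` compensates for `n` exceeding `m` by at most the factor `t' / t`.
  have hr : logRadius t m ≤ logRadius t' n := by
    refine Real.sqrt_le_sqrt ?_
    rw [div_le_div_iff₀ hm0 hn0]
    have h4 : n * t ≤ t' * m := by
      rw [div_mul_eq_mul_div, le_div_iff₀ ht] at hnm; exact hnm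
    calc t * Real.log m * n = (n * t) * Real.log m := by ring
      _ ≤ (t' * m) * Real.log n := by gcongr
      _ = t' * Real.log n * m := by ring
  have h5 : b * Real.log m ≤ hits (fun i => X i ω) (Metric.closedBall x (logRadius t m)) m := by
    by_contra! hlt
    exact h1 ⟨x, hx, hlt⟩
  have h6 : hits (fun i => X i ω) (Metric.closedBall x (logRadius t m)) m ≤
      hits (fun i => X i ω) (Metric.closedBall x (logRadius t' n)) n :=
    (hits_mono _ _ hjn).trans (hits_mono_set _ (Metric.closedBall_subset_closedBall hr) n)
  have h7 : b' * Real.log n ≤ b * Real.log m := by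
    rw [div_le_iff₀ (sub_pos.2 hb')] at h2
    have := mul_le_mul_of_nonneg_left hlog2 (hβ.trans hβb'.le)
    linarith
  exact h7.trans (h5.trans (by exact_mod_cast h6))

/-- The centres are sorted by what certifies their mass: a full disc (`S₁`), a half-disc near the
boundary (`S₂`) or a sector near a vertex (`S₃`). Their nets have exponents `1`, `1 / 2` and `0`,
matching the three hypotheses on `t`. -/
theorem IsPolygon.rareShortage {A : Set Plane} {V : Finset Plane} {σ : Equiv.Perm V}
    (hA : IsPolygon A V σ) {f : Plane → ℝ≥0}
    (hfc : ∀ x ∈ frontier A, ContinuousWithinAt f A x)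
    (hX : ∀ i, Measurable (X i)) (hindep : iIndepFun X P)
    (hlaw : ∀ i, P.map (X i) = densityLaw A f) {f₀ f₁ t : ℝ} (hβ : 0 ≤ β) (ht : 0 < t)
    (hf₀ : 0 ≤ f₀) (hf₁ : 0 < f₁) (hle₀ : ∀ᵐ z ∂(volume.restrict A), f₀ ≤ f z)
    (hle₁ : ∀ z ∈ frontier A, f₁ ≤ f z) (h₀ : hatH β 1 < Real.pi * f₀ * t)
    (h₁ : hatH β (1 / 2) < Real.pi * f₁ / 2 * t)
    (hv : ∀ v : V, β < vertexAngle A σ v / 2 * f v * t) :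
    RareShortage P X β (fun _ => A) (logRadius t) := by
  have hprob : IsProbabilityMeasure (densityLaw A f) :=
    hlaw 0 ▸ Measure.isProbabilityMeasure_map (hX 0).aemeasurable
  -- The power is `κ ^ 3`: one factor `κ` is lost to the variation of `f`, and `κ ^ 2` to shrinking
  -- the radius for the net.
  have hlim : ∀ a : ℝ, Tendsto (fun κ : ℝ => κ ^ 3 * a) (𝓝[<] 1) (𝓝 a) := fun a => by
    have : Tendsto (fun κ : ℝ => κ ^ 3 * a) (𝓝 1) (𝓝 (1 ^ 3 * a)) :=
      (by fun_prop : Continuous fun κ : ℝ => κ ^ 3 * a).tendsto 1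
    rw [one_pow, one_mul] at this
    exact this.mono_left nhdsWithin_le_nhds
  obtain ⟨κ, ⟨⟨⟨⟨hκ₀, hκ₁⟩, hκv⟩, hκ0⟩, hκ1⟩⟩ := ((((((hlim _).eventually_const_lt h₀).and
    ((hlim _).eventually_const_lt h₁)).and
    (eventually_all.2 fun v => (hlim _).eventually_const_lt (hv v))).and
    ((eventually_gt_nhds (zero_lt_one' ℝ)).filter_mono nhdsWithin_le_nhds)).and
    self_mem_nhdsWithin).exists
  have hκ1 : κ < 1 := hκ1
  obtain ⟨δ, hδ, K, hK⟩ := hA.exists_lower_bound_near_frontier hfc hf₁ hle₁ hκ0 hκ1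
  set μ := densityLaw A f with hμdef
  -- Chosen so that `r - 2 η r = κ r`.
  set η : ℝ := (1 - κ) / 2 with hη
  have hη0 : 0 < η := by rw [hη]; linarith
  set r : ℕ → ℝ := logRadius t with hr
  have hrκ : ∀ n, r n - 2 * (η * r n) = κ * r n := fun n => by rw [hη]; ring
  have hsq : ∀ n, (κ * r n) ^ 2 = κ ^ 2 * t * (Real.log n / n) := fun n => by
    rw [mul_pow, hr, logRadius_sq ht.le]; ring
  have hrpos := eventually_logRadius_pos ht
  have hr1 : ∀ᶠ n in atTop, r n ≤ 1 :=
    ((tendsto_logRadius t).eventually_lt_const one_pos).mono fun n hn => hn.le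
  let S₁ : ℕ → Set Plane := fun n => {x | x ∈ A ∧
    f₀ * Real.pi * (κ * r n) ^ 2 ≤ μ.real (Metric.closedBall x (κ * r n))}
  let S₂ : ℕ → Set Plane := fun n => {x | (∃ y ∈ frontier A, dist x y ≤ r n) ∧
    κ * f₁ * (Real.pi / 2) * (κ * r n) ^ 2 ≤ μ.real (Metric.closedBall x (κ * r n))}
  let S₃ : V → ℕ → Set Plane := fun v n => {x | dist x v ≤ K * κ * r n ∧
    κ * f v * (vertexAngle A σ v / 2) * (κ * r n) ^ 2 ≤ μ.real (Metric.closedBall x (κ * r n))}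
  have hS₁ : RareShortage P X β S₁ r := by
    have h2 := lt_poissonRate_of_hatH_lt hβ one_pos hκ₀
    have hβc := (hatH_spec hβ one_pos).1.trans hκ₀
    obtain ⟨C, hC⟩ := exists_net_bounded hA.isCompact.isBounded hη0
    refine RareShortage.of_net hX hindep hlaw (C := |C| * t⁻¹) (η := fun n => η * r n) hβ hβc h2
      ?_ ?_
    · filter_upwards [hrpos, hr1, eventually_inv_sq_logRadius_le ht] with n h3 h4 h5
      obtain ⟨F, hF, hcov⟩ := hC (r n) h3 h4
      refine ⟨F, ?_, fun x hx => hcov x hx.1⟩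
      rw [Real.rpow_one, mul_assoc]
      refine hF.trans (mul_le_mul (le_abs_self C) h5 (by positivity) (abs_nonneg C))
    · filter_upwards with n x hx
      rw [hrκ]
      refine le_trans ?_ hx.2
      rw [hsq, mul_div_assoc]
      have hl : 0 ≤ Real.log n / n := div_nonneg (Real.log_natCast_nonneg n) (Nat.cast_nonneg n)
      have h6 : κ ^ 3 ≤ κ ^ 2 := pow_le_pow_of_le_one hκ0.le hκ1.le (by norm_num)
      calc κ ^ 3 * (Real.pi * f₀ * t) * (Real.log n / n)
          ≤ κ ^ 2 * (Real.pi * f₀ * t) * (Real.log n / n) := by gcongr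
        _ = _ := by ring
  have hS₂ : RareShortage P X β S₂ r := by
    have h2 := lt_poissonRate_of_hatH_lt hβ (by norm_num) hκ₁
    have hβc := (hatH_spec (x := 1 / 2) hβ (by norm_num)).1.trans hκ₁
    have hμ : ∀ n : ℕ, ∀ x ∈ S₂ n, κ ^ 3 * (Real.pi * f₁ / 2 * t) * Real.log n / n ≤
        μ.real (Metric.closedBall x (r n - 2 * (η * r n))) := by
      intro n x hx
      rw [hrκ]
      refine le_trans (le_of_eq ?_) hx.2
      rw [hsq]; ring
    have hedge : ∀ v : V, RareShortage P X β (fun n => S₂ n ∩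
        {x | ∃ y ∈ segment ℝ (v : Plane) (σ v : Plane), dist x y ≤ r n}) r := by
      intro v
      obtain ⟨C, hC⟩ := exists_net_segment (v : Plane) (σ v : Plane) hη0
      refine RareShortage.of_net hX hindep hlaw (C := |C| * √t⁻¹) (η := fun n => η * r n) hβ hβc h2
        ?_ (Eventually.of_forall fun n x hx => hμ n x hx.1)
      filter_upwards [hrpos, hr1, eventually_inv_logRadius_le ht] with n h3 h4 h5
      obtain ⟨F, hF, hcov⟩ := hC (r n) h3 h4
      refine ⟨F, ?_, fun x hx => hcov x hx.2⟩
      rw [mul_assoc]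
      exact hF.trans (mul_le_mul (le_abs_self C) h5 (by positivity) (abs_nonneg C))
    refine (RareShortage.iUnion hedge).mono (Eventually.of_forall fun n x hx => ?_)
    obtain ⟨y, hy, hxy⟩ := hx.1
    obtain ⟨v, hv⟩ := hA.mem_frontier_iff.1 hy
    exact Set.mem_iUnion.2 ⟨v, hx, y, hv, hxy⟩
  have hS₃ : ∀ v, RareShortage P X β (S₃ v) r := by
    intro v
    obtain ⟨N, hN⟩ := exists_net_closedBall (K * κ) hη0
    refine RareShortage.of_net hX hindep hlaw (C := N) (e := 0) (η := fun n => η * r n) hβ (hκv v)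
      (poissonRate_pos_of_lt hβ (hκv v)) ?_ ?_
    · filter_upwards [hrpos] with n h3
      obtain ⟨F, hF, hcov⟩ := hN v (r n) h3
      refine ⟨F, ?_, fun x hx => hcov x hx.1⟩
      rw [Real.rpow_zero, mul_one]
      exact_mod_cast hF
    · filter_upwards with n x hx
      rw [hrκ]
      refine le_trans (le_of_eq ?_) hx.2
      rw [hsq]; ring
  refine ((hS₁.union hS₂).union (RareShortage.iUnion hS₃)).mono ?_
  filter_upwards [hrpos, (tendsto_logRadius t).eventually_lt_const hδ] with n h3 h4 x hx
  have hκr0 : 0 < κ * r n := mul_pos hκ0 h3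
  have hκr : κ * r n ≤ r n := by nlinarith
  by_cases hfr : ∃ y ∈ frontier A, dist x y ≤ r n
  · obtain ⟨y, hy, hxy⟩ := hfr
    rcases hK x hx y hy (hxy.trans_lt h4) (κ * r n) hκr0 (hκr.trans_lt h4) with h | ⟨v, h, h'⟩
    · exact Or.inl (Or.inr ⟨⟨y, hy, hxy⟩, h⟩)
    · exact Or.inr (Set.mem_iUnion.2 ⟨v, by rw [mul_assoc]; exact h, h'⟩)
  · refine Or.inl (Or.inl ⟨hx, ?_⟩)
    have hsub : Metric.closedBall x (κ * r n) ⊆ A :=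
      closedBall_subset_of_disjoint_frontier hA.isClosed hκr0.le hx
        (Set.disjoint_left.2 fun y hy hyf => hfr ⟨y, hyf, by
          rw [dist_comm]; exact (Metric.mem_closedBall.1 hy).trans hκr⟩)
    have h := mul_volume_le_densityLaw (f := f) Metric.isClosed_closedBall.measurableSet
      Metric.isClosed_closedBall.measurableSet subset_rfl hsub
      (hle₀.mono fun z hz _ => hz)
    rw [volume_real_closedBall_plane x hκr0.le] at h
    rwa [mul_assoc]

end

/-! ### Lower bound: some disc has too few points -/

/-- This leaves room for `n ^ e` disjoint discs along a segment and, after squaring, for `n ^ (2 e)`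
in a set of positive area. The `+ 1` absorbs rounding. -/
theorem tendsto_rpow_mul_logRadius (t : ℝ) {e : ℝ} (he : e < 1 / 2) :
    Tendsto (fun n : ℕ => ((n : ℝ) ^ e + 1) * logRadius t n) atTop (𝓝 0) := by
  have h1 : Tendsto (fun n : ℕ => Real.log n / (n : ℝ) ^ (1 - 2 * e)) atTop (𝓝 0) :=
    ((isLittleO_log_rpow_atTop (by linarith : 0 < 1 - 2 * e)).tendsto_div_nhds_zero).comp
      tendsto_natCast_atTop_atTop
  have h2 := (h1.const_mul t).sqrt
  rw [mul_zero, Real.sqrt_zero] at h2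
  have h3 := h2.add (tendsto_logRadius t)
  rw [add_zero] at h3
  refine h3.congr' ?_
  filter_upwards [eventually_gt_atTop 0] with n hn
  have hn0 : (0 : ℝ) < n := by exact_mod_cast hn
  have hl : 0 ≤ Real.log n := Real.log_natCast_nonneg n
  rw [add_mul, one_mul]
  congr 1
  have h4 : (n : ℝ) ^ e = √((n : ℝ) ^ (2 * e)) := by
    rw [Real.sqrt_eq_rpow, ← Real.rpow_mul hn0.le]; ring_nf
  rw [logRadius, h4, ← Real.sqrt_mul (by positivity)]
  congr 1
  rw [Real.rpow_sub hn0, Real.rpow_one]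
  have : (n : ℝ) ^ (2 * e) ≠ 0 := (Real.rpow_pos_of_pos hn0 _).ne'
  field_simp

/-- Greedy choice: the discs around `m` points are too small to cover `S`. Only outer measure is
involved, so `S` may be non-measurable. -/
theorem exists_separated_finset {S : Set Plane} {r : ℝ} (hr : 0 ≤ r) (m : ℕ)
    (h : ENNReal.ofReal (m * (Real.pi * r ^ 2)) < volume S) :
    ∃ F : Finset Plane, F.card = m ∧ (F : Set Plane) ⊆ S ∧
      (F : Set Plane).Pairwise fun x y => r < dist x y := by
  classical
  induction m with
  | zero => exact ⟨∅, by simp⟩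
  | succ m ih =>
    have hmono : ENNReal.ofReal (m * (Real.pi * r ^ 2)) ≤
        ENNReal.ofReal ((m + 1 : ℕ) * (Real.pi * r ^ 2)) := by
      apply ENNReal.ofReal_le_ofReal
      push_cast
      nlinarith [mul_nonneg Real.pi_pos.le (sq_nonneg r)]
    obtain ⟨F, hcard, hFS, hsep⟩ := ih (hmono.trans_lt h)
    have hvol : volume (⋃ x ∈ F, Metric.closedBall x r) ≤ ENNReal.ofReal (m * (Real.pi * r ^ 2)) := by
      refine (measure_biUnion_finset_le _ _).trans ?_
      have : ∀ x ∈ F, volume (Metric.closedBall x r) = ENNReal.ofReal (Real.pi * r ^ 2) := by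
        intro x _
        rw [← volume_real_closedBall_plane x hr, ofReal_measureReal
          (volume_closedBall_plane_ne_top x r)]
      rw [Finset.sum_congr rfl this, Finset.sum_const, hcard, nsmul_eq_mul,
        ENNReal.ofReal_mul (Nat.cast_nonneg m), ENNReal.ofReal_natCast]
    obtain ⟨x, hxS, hx⟩ : ∃ x ∈ S, x ∉ ⋃ x ∈ F, Metric.closedBall x r := by
      by_contra! hcon
      exact absurd ((measure_mono hcon).trans hvol) (not_le.2 (hmono.trans_lt h))
    have hfar : ∀ y ∈ F, r < dist x y := by
      intro y hy
      by_contra! hle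
      exact hx (Set.mem_biUnion (show y ∈ (F : Set Plane) from hy) hle)
    have hxF : x ∉ F := fun hxF => by
      have := hfar x hxF
      rw [dist_self] at this
      linarith
    refine ⟨insert x F, by rw [Finset.card_insert_of_notMem hxF, hcard], ?_, ?_⟩
    · rw [Finset.coe_insert]
      exact Set.insert_subset hxS hFS
    · rw [Finset.coe_insert]
      refine hsep.insert fun y hy _ => ⟨hfar y hy, ?_⟩
      rw [dist_comm]
      exact hfar y hy

section
variable {Ω : Type*} [MeasurableSpace Ω] {P : Measure Ω} [IsProbabilityMeasure P]
  {X : ℕ → Ω → Plane} {μ : Measure Plane} {β : ℝ} {k : ℕ → ℕ}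

/-- If there are many disjoint discs of small mass, then almost surely one of them is hit less than
`k n` times. -/
theorem ae_eventually_exists_hits_lt (hX : ∀ i, Measurable (X i)) (hindep : iIndepFun X P)
    (hlaw : ∀ i, P.map (X i) = μ) {A : Set Plane} {r : ℕ → ℝ} {c e : ℝ} (hβ : 0 ≤ β) (hc : 0 < c)
    (he : poissonRate β c < e) (hk1 : ∀ n, 1 ≤ n → 1 ≤ k n)
    (hk : Tendsto (fun n : ℕ => (k n : ℝ) / Real.log n) atTop (𝓝 β))
    (hF : ∀ᶠ n : ℕ in atTop, ∃ F : Finset Plane, (n : ℝ) ^ e ≤ F.card ∧ (F : Set Plane) ⊆ A ∧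
      (F : Set Plane).Pairwise (fun x y => r n + r n < dist x y) ∧
      ∀ x ∈ F, n * μ.real (Metric.closedBall x (r n)) ≤ c * Real.log n) :
    ∀ᵐ ω ∂P, ∀ᶠ n in atTop, ∃ x ∈ A,
      hits (fun i => X i ω) (Metric.closedBall x (r n)) n < k n := by
  have hprob : IsProbabilityMeasure μ :=
    hlaw 0 ▸ Measure.isProbabilityMeasure_map (hX 0).aemeasurable
  obtain ⟨x, hx, hxe⟩ := exists_between he
  -- All discs are well filled with probability at most `(1 - n ^ (-x)) ^ (n ^ e) ≤ exp (-n ^ (e -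
  -- x))`. This is summable over all `n`, so no subsequence is needed here.
  have hexp : ∀ᶠ n : ℕ in atTop, Real.exp (-(n : ℝ) ^ (e - x)) ≤ (n : ℝ) ^ (-2 : ℝ) := by
    have h1 := ((isLittleO_log_rpow_atTop (sub_pos.2 hxe)).def (show (0 : ℝ) < 1 / 2 by norm_num))
    filter_upwards [tendsto_natCast_atTop_atTop.eventually h1, eventually_gt_atTop 0] with n hn hn0
    have hn0' : (0 : ℝ) < n := by exact_mod_cast hn0
    rw [Real.norm_of_nonneg (Real.log_natCast_nonneg n), Real.norm_of_nonneg (by positivity)] at hn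
    rw [Real.rpow_def_of_pos hn0' (-2)]
    exact Real.exp_le_exp.2 (by linarith)
  have hae := ae_eventually_notMem_of_summable (P := P)
    (E := fun n => {ω | ∀ x ∈ A, k n ≤ hits (fun i => X i ω) (Metric.closedBall x (r n)) n})
    (Real.summable_nat_rpow.2 (by norm_num : (-2 : ℝ) < -1)) (by
      filter_upwards [hF, hexp, rpow_le_one_sub_binTail hβ hc hx hk1 hk, eventually_gt_atTop 0]
        with n ⟨F, hcard, hFA, hsep, hmass⟩ h2 h3 hn
      have hn0 : (0 : ℝ) < n := by exact_mod_cast hn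
      refine le_trans ?_ h2
      have hdisj : Pairwise (Function.onFun Disjoint fun y : F =>
          Metric.closedBall (y : Plane) (r n)) := fun y z hyz =>
        Metric.closedBall_disjoint_closedBall (hsep y.2 z.2 fun h => hyz (Subtype.ext h))
      have h4 := measureReal_forall_le_hits_le hX hindep hlaw
        (fun y : F => Metric.isClosed_closedBall.measurableSet) hdisj n (fun _ => k n)
      refine (measureReal_mono ?_).trans (h4.trans ?_)
      · intro ω hω y
        exact hω y (hFA y.2)
      have h5 : ∀ y : F, binTail (μ.real (Metric.closedBall (y : Plane) (r n))) n (k n) ≤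
          Real.exp (-(n : ℝ) ^ (-x)) := fun y => by
        have := h3 _ measureReal_nonneg measureReal_le_one (hmass y y.2)
        linarith [Real.add_one_le_exp (-(n : ℝ) ^ (-x))]
      refine (Finset.prod_le_prod (fun y _ => binTail_nonneg measureReal_nonneg measureReal_le_one
        _ _) fun y _ => h5 y).trans ?_
      rw [Finset.prod_const, ← Real.exp_nat_mul, Finset.card_univ, Fintype.card_coe]
      apply Real.exp_le_exp.2
      have h6 : (n : ℝ) ^ (e - x) = (n : ℝ) ^ e * (n : ℝ) ^ (-x) := by
        rw [← Real.rpow_add hn0]; ring_nf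
      rw [h6]
      have := mul_le_mul_of_nonneg_right hcard (Real.rpow_nonneg hn0.le (-x))
      linarith)
  filter_upwards [hae] with ω hω
  filter_upwards [hω] with n hn
  by_contra! h
  exact hn h

/-- The vertex term: one disc has mean `a t log n`, below `β log n`. The upper tail is only
polynomially small, so again a subsequence is used, with slack in `t` and in the level `b`. -/
theorem ae_eventually_hits_lt_of_lt (hX : ∀ i, Measurable (X i)) (hindep : iIndepFun X P)
    (hlaw : ∀ i, P.map (X i) = μ) {y : Plane} {a t : ℝ} (ht : 0 < t) (ha : 0 ≤ a)
    (hat : a * t < β)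
    (hk : Tendsto (fun n : ℕ => (k n : ℝ) / Real.log n) atTop (𝓝 β))
    (hμ : ∀ᶠ r in 𝓝[≥] (0 : ℝ), μ.real (Metric.closedBall y r) ≤ a * r ^ 2) :
    ∀ᵐ ω ∂P, ∀ᶠ n in atTop,
      hits (fun i => X i ω) (Metric.closedBall y (logRadius t n)) n < k n := by
  have hprob : IsProbabilityMeasure μ :=
    hlaw 0 ▸ Measure.isProbabilityMeasure_map (hX 0).aemeasurable
  obtain ⟨t', hat', htt⟩ : ∃ t', a * t' < β ∧ t < t' := by
    have hc : Tendsto (fun s : ℝ => a * s) (𝓝[>] t) (𝓝 (a * t)) :=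
      ((continuous_const.mul continuous_id).tendsto t).mono_left nhdsWithin_le_nhds
    exact ((hc.eventually_lt_const hat).and self_mem_nhdsWithin).exists
  have ht' : 0 < t' := ht.trans htt
  obtain ⟨b, hcb, hbβ⟩ := exists_between hat'
  obtain ⟨b', hbb', hbβ'⟩ := exists_between hbβ
  have hb0 : 0 < b := (mul_nonneg ha ht'.le).trans_lt hcb
  obtain ⟨δ, hδ, hD⟩ := binTail_le_rpow hb0 hcb
  have hr : Tendsto (logRadius t') atTop (𝓝[≥] 0) :=
    tendsto_nhdsWithin_iff.2 ⟨tendsto_logRadius t', Eventually.of_forall (logRadius_nonneg t')⟩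
  obtain ⟨K, hK, hae⟩ := ae_eventually_notMem_pow (P := P) (M := 1) hδ
    (E := fun n => {ω | ⌈b * Real.log n⌉₊ ≤
      hits (fun i => X i ω) (Metric.closedBall y (logRadius t' n)) n}) (by
    filter_upwards [hr.eventually hμ, eventually_ge_atTop 1] with n hn hn1
    have hn0 : (0 : ℝ) < n := by exact_mod_cast hn1
    have h1 := measureReal_forall_le_hits_le (ι := Unit) hX hindep hlaw
      (fun _ => Metric.isClosed_closedBall.measurableSet)
      (fun i j hij => absurd (Subsingleton.elim i j) hij)
      (B := fun _ => Metric.closedBall y (logRadius t' n)) n (fun _ => ⌈b * Real.log n⌉₊)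
    simp only [Finset.univ_unique, Finset.prod_singleton, forall_const] at h1
    refine h1.trans ?_
    rw [one_mul]
    refine hD n hn1 _ measureReal_nonneg measureReal_le_one ?_ _ (Nat.le_ceil _)
    rw [logRadius_sq ht'.le] at hn
    calc n * μ.real (Metric.closedBall y (logRadius t' n))
        ≤ n * (a * (t' * Real.log n / n)) := by gcongr
      _ = a * t' * Real.log n := by field_simp)
  have hθ : 1 < t' / t := (one_lt_div ht).2 htt
  filter_upwards [hae] with ω hω
  obtain ⟨J, hJ⟩ := hω.exists_forall_of_atTop
  filter_upwards [exists_pow_sandwich hK hθ J, eventually_gt_atTop 0,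
    tendsto_log_natCast.eventually_ge_atTop (b * Real.log (t' / t) / (b' - b)),
    hk.eventually_const_lt hbβ', tendsto_log_natCast.eventually_gt_atTop 0]
    with n ⟨j, hjJ, hjn, hnj, hj⟩ hn hlarge hkn hl
  have h1 := hJ (j + 1) (by omega)
  -- The count at `n` is now bounded from above, hence by the next subsequence term `m ≥ n`.
  set m := (j + 1) ^ K with hm
  have hn0 : (0 : ℝ) < n := by exact_mod_cast hn
  have hnm : (n : ℝ) ≤ m := by exact_mod_cast hnj
  have hm0 : (0 : ℝ) < m := hn0.trans_le hnm
  have hmn : (m : ℝ) ≤ t' / t * n := hj.trans (by gcongr)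
  have hlog : Real.log n ≤ Real.log m := Real.log_le_log hn0 hnm
  have hlog2 : Real.log m ≤ Real.log (t' / t) + Real.log n := by
    rw [← Real.log_mul (by positivity) hn0.ne']
    exact Real.log_le_log hm0 hmn
  have hr : logRadius t n ≤ logRadius t' m := by
    refine Real.sqrt_le_sqrt ?_
    rw [div_le_div_iff₀ hn0 hm0]
    have h4 : m * t ≤ t' * n := by
      rw [div_mul_eq_mul_div, le_div_iff₀ ht] at hmn; exact hmn
    calc t * Real.log n * m = (m * t) * Real.log n := by ring
      _ ≤ (t' * n) * Real.log m := by gcongr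
      _ = t' * Real.log m * n := by ring
  have h2 : hits (fun i => X i ω) (Metric.closedBall y (logRadius t n)) n ≤
      hits (fun i => X i ω) (Metric.closedBall y (logRadius t' m)) m :=
    (hits_mono _ _ hnj).trans (hits_mono_set _ (Metric.closedBall_subset_closedBall hr) m)
  have h3 : (hits (fun i => X i ω) (Metric.closedBall y (logRadius t' m)) m : ℝ) <
      b * Real.log m := Nat.lt_ceil.1 (not_le.1 h1)
  have h4 : b * Real.log m ≤ b' * Real.log n := by
    rw [div_le_iff₀ (sub_pos.2 hbb')] at hlarge
    have := mul_le_mul_of_nonneg_left hlog2 hb0.le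
    linarith
  rw [lt_div_iff₀ hl] at hkn
  have h5 : (hits (fun i => X i ω) (Metric.closedBall y (logRadius t n)) n : ℝ) ≤
      hits (fun i => X i ω) (Metric.closedBall y (logRadius t' m)) m := by exact_mod_cast h2
  exact_mod_cast h5.trans_lt (h3.trans_le (h4.trans hkn.le))

/-- By Lebesgue differentiation almost every point of `{f < g}` has small discs of mass below `g π
r²`. The admissible radius depends on the point; splitting into the countably many sets `G j` makes
it uniform on a set that is not null. -/
theorem exists_pos_volume_small_mass {A : Set Plane} (hA : MeasurableSet A) {f : Plane → ℝ≥0}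
    (hf : Measurable f) [IsFiniteMeasure (densityLaw A f)] {g : ℝ}
    (hg : volume {x | x ∈ A ∧ (f x : ℝ) < g} ≠ 0) :
    ∃ δ > 0, volume {x | x ∈ A ∧ ∀ r, 0 < r → r < δ →
      (densityLaw A f).real (Metric.closedBall x r) ≤ g * (Real.pi * r ^ 2)} ≠ 0 := by
  set μ := densityLaw A f with hμ
  have hμ2 : μ = volume.withDensity (A.indicator fun x => (f x : ℝ≥0∞)) := by
    rw [withDensity_indicator hA]
  have hmeas : Measurable (A.indicator fun x => (f x : ℝ≥0∞)) := hf.coe_nnreal_ennreal.indicator hA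
  have hrn : μ.rnDeriv volume =ᵐ[volume] A.indicator fun x => (f x : ℝ≥0∞) := by
    rw [hμ2]; exact Measure.rnDeriv_withDensity _ hmeas
  let G : ℕ → Set Plane := fun j => {x | x ∈ A ∧ ∀ r, 0 < r → r < 1 / ((j : ℝ) + 1) →
    μ.real (Metric.closedBall x r) ≤ g * (Real.pi * r ^ 2)}
  suffices h : ∃ j, volume (G j) ≠ 0 by
    obtain ⟨j, hj⟩ := h
    exact ⟨1 / ((j : ℝ) + 1), Nat.one_div_pos_of_nat, hj⟩
  by_contra! hG
  refine hg (measure_mono_null (t := {x | ¬ (x ∈ A → (f x : ℝ) < g → ∃ j, x ∈ G j)} ∪ ⋃ j, G j) ?_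
    (measure_union_null ?_ (measure_iUnion_null hG)))
  · rintro x ⟨hxA, hxg⟩
    by_cases h : ∃ j, x ∈ G j
    · exact Or.inr (Set.mem_iUnion.2 h)
    · exact Or.inl fun h' => h (h' hxA hxg)
  · change ∀ᵐ x ∂volume, _
    filter_upwards [Besicovitch.ae_tendsto_rnDeriv μ volume, hrn] with x hx hx2 hxA hxg
    rw [hx2, Set.indicator_of_mem hxA] at hx
    have hlt : (f x : ℝ≥0∞) < ENNReal.ofReal g := by
      rw [← ENNReal.ofReal_coe_nnreal]
      exact (ENNReal.ofReal_lt_ofReal_iff_of_nonneg (f x).2).2 hxg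
    have hg0 : 0 ≤ g := (f x).2.trans hxg.le
    obtain ⟨ε, hε, hball⟩ := mem_nhdsGT_iff_exists_Ioo_subset.1 (hx.eventually_lt_const hlt)
    obtain ⟨j, hj⟩ := exists_nat_one_div_lt (show (0 : ℝ) < ε from hε)
    refine ⟨j, hxA, fun r hr0 hr => ?_⟩
    have h1 : μ (Metric.closedBall x r) / volume (Metric.closedBall x r) < ENNReal.ofReal g :=
      hball ⟨hr0, hr.trans hj⟩
    have hv0 : volume (Metric.closedBall x r) ≠ 0 := (Metric.measure_closedBall_pos _ x hr0).ne'
    have h2 := (ENNReal.div_le_iff hv0 (volume_closedBall_plane_ne_top x r)).1 h1.le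
    have h3 := ENNReal.toReal_mono (ENNReal.mul_ne_top ENNReal.ofReal_ne_top
      (volume_closedBall_plane_ne_top x r)) h2
    rw [ENNReal.toReal_mul, ENNReal.toReal_ofReal hg0] at h3
    rw [← volume_real_closedBall_plane x hr0.le]
    exact h3

theorem ae_eventually_exists_hits_lt_interior (hX : ∀ i, Measurable (X i)) (hindep : iIndepFun X P)
    {A : Set Plane} (hA : MeasurableSet A) {f : Plane → ℝ≥0} (hf : Measurable f)
    (hlaw : ∀ i, P.map (X i) = densityLaw A f) {g t : ℝ} (hβ : 0 ≤ β) (ht : 0 < t)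
    (hk1 : ∀ n, 1 ≤ n → 1 ≤ k n)
    (hk : Tendsto (fun n : ℕ => (k n : ℝ) / Real.log n) atTop (𝓝 β))
    (hg : volume {x | x ∈ A ∧ (f x : ℝ) < g} ≠ 0) (hgt : Real.pi * g * t < hatH β 1) :
    ∀ᵐ ω ∂P, ∀ᶠ n in atTop, ∃ x ∈ A,
      hits (fun i => X i ω) (Metric.closedBall x (logRadius t n)) n < k n := by
  have hprob : IsProbabilityMeasure (densityLaw A f) :=
    hlaw 0 ▸ Measure.isProbabilityMeasure_map (hX 0).aemeasurable
  -- `c` is only an upper bound for the mean, so it may be taken above `β`, where the rate is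
  -- monotone in `c`.
  obtain ⟨c, hc, hcH⟩ := exists_between (max_lt hgt (hatH_spec hβ one_pos).1)
  obtain ⟨hgc, hβc⟩ := max_lt_iff.1 hc
  have hrate := poissonRate_lt_of_lt_hatH hβ one_pos hβc hcH
  have hrate0 := poissonRate_pos_of_lt hβ hβc
  obtain ⟨e, hre, he1⟩ := exists_between hrate
  obtain ⟨δ, hδ, hvol⟩ := exists_pos_volume_small_mass hA hf hg
  set S := {x | x ∈ A ∧ ∀ r, 0 < r → r < δ →
      (densityLaw A f).real (Metric.closedBall x r) ≤ g * (Real.pi * r ^ 2)}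
  obtain ⟨v, -, hv0, hv⟩ := ENNReal.lt_iff_exists_real_btwn.1 (pos_iff_ne_zero.2 hvol)
  have hv0 : 0 < v := ENNReal.ofReal_pos.1 hv0
  have hlim := (tendsto_rpow_mul_logRadius (e := e / 2) t (by linarith)).pow 2
  rw [zero_pow two_ne_zero] at hlim
  refine ae_eventually_exists_hits_lt hX hindep hlaw hβ (hβ.trans_lt hβc) hre hk1 hk ?_
  filter_upwards [hlim.eventually_lt_const (show 0 < v / (4 * Real.pi) by positivity),
    eventually_logRadius_pos ht, (tendsto_logRadius t).eventually_lt_const hδ,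
    eventually_gt_atTop 0] with n h1 h2 h3 h4
  have hn0 : (0 : ℝ) < n := by exact_mod_cast h4
  set r := logRadius t n with hr
  set m : ℕ := ⌊v / (Real.pi * (r + r) ^ 2)⌋₊ with hm
  have hrr : 0 < Real.pi * (r + r) ^ 2 := by positivity
  have hmle : (m : ℝ) * (Real.pi * (r + r) ^ 2) ≤ v := by
    rw [← le_div_iff₀ hrr]; exact Nat.floor_le (by positivity)
  obtain ⟨F, hcard, hFS, hsep⟩ := exists_separated_finset (S := S) (r := r + r) (by positivity) m
    ((ENNReal.ofReal_le_ofReal hmle).trans_lt hv)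
  refine ⟨F, ?_, fun x hx => (hFS hx).1, hsep, fun x hx => ?_⟩
  · rw [hcard]
    have h5 : v / (Real.pi * (r + r) ^ 2) < m + 1 := Nat.lt_floor_add_one _
    have h6 : (n : ℝ) ^ e = ((n : ℝ) ^ (e / 2)) ^ 2 := by
      rw [← Real.rpow_natCast, ← Real.rpow_mul hn0.le]; norm_num
    have h7 : 0 ≤ (n : ℝ) ^ (e / 2) := by positivity
    have h8 : ((n : ℝ) ^ (e / 2) + 1) ^ 2 ≤ v / (Real.pi * (r + r) ^ 2) := by
      rw [le_div_iff₀ hrr]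
      rw [lt_div_iff₀ (by positivity), mul_pow] at h1
      linarith
    rw [h6]
    nlinarith
  · have h5 := (hFS hx).2 r h2 h3
    rw [hr, logRadius_sq ht.le, ← hr] at h5
    have hl : 0 ≤ Real.log n := Real.log_natCast_nonneg n
    calc n * (densityLaw A f).real (Metric.closedBall x r)
        ≤ n * (g * (Real.pi * (t * Real.log n / n))) := by gcongr
      _ = Real.pi * g * t * Real.log n := by field_simp
      _ ≤ c * Real.log n := by gcongr

theorem IsPolygon.ae_eventually_exists_hits_lt_frontier {A : Set Plane} {V : Finset Plane}
    {σ : Equiv.Perm V} (hA : IsPolygon A V σ) (hX : ∀ i, Measurable (X i)) (hindep : iIndepFun X P)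
    {f : Plane → ℝ≥0} (hfc : ∀ x ∈ frontier A, ContinuousWithinAt f A x)
    (hlaw : ∀ i, P.map (X i) = densityLaw A f) {t : ℝ} (hβ : 0 ≤ β) (ht : 0 < t)
    (hk1 : ∀ n, 1 ≤ n → 1 ≤ k n)
    (hk : Tendsto (fun n : ℕ => (k n : ℝ) / Real.log n) atTop (𝓝 β)) {x : Plane}
    (hx : x ∈ frontier A) (hxt : Real.pi * f x / 2 * t < hatH β (1 / 2)) :
    ∀ᵐ ω ∂P, ∀ᶠ n in atTop, ∃ x ∈ A,
      hits (fun i => X i ω) (Metric.closedBall x (logRadius t n)) n < k n := by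
  have hfc' : ∀ y ∈ frontier A, ContinuousWithinAt (fun z => (f z : ℝ)) A y := fun y hy =>
    NNReal.continuous_coe.continuousAt.comp_continuousWithinAt (hfc y hy)
  obtain ⟨g, hgt, hxg⟩ : ∃ g, Real.pi * g / 2 * t < hatH β (1 / 2) ∧ (f x : ℝ) < g := by
    have hc : Tendsto (fun g : ℝ => Real.pi * g / 2 * t) (𝓝[>] (f x : ℝ))
        (𝓝 (Real.pi * f x / 2 * t)) :=
      ((by fun_prop : Continuous fun g : ℝ => Real.pi * g / 2 * t).tendsto _).mono_left
        nhdsWithin_le_nhds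
    exact ((hc.eventually_lt_const hxt).and self_mem_nhdsWithin).exists
  have hg0 : 0 ≤ g := (f x).2.trans hxg.le
  obtain ⟨v, hv⟩ := hA.mem_frontier_iff.1 hx
  have hsegA : segment ℝ (v : Plane) (σ v : Plane) ⊆ frontier A := fun z hz =>
    hA.mem_frontier_iff.2 ⟨v, hz⟩
  -- `x` may be a vertex; continuity of `f` along the edge moves it to an interior point of the
  -- edge, where `A` is a half-plane.
  obtain ⟨y, hy, hyg⟩ : ∃ y ∈ openSegment ℝ (v : Plane) (σ v : Plane), (f y : ℝ) < g := by
    have h1 : ∀ᶠ z in 𝓝 x, z ∈ A → (f z : ℝ) < g :=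
      eventually_nhdsWithin_iff.1 ((hfc' x hx).eventually_lt_const hxg)
    rw [← closure_openSegment] at hv
    obtain ⟨y, hy1, hy2⟩ := mem_closure_iff_nhds.1 hv _ h1
    exact ⟨y, hy2, hy1 (hA.isClosed.frontier_subset (hsegA (openSegment_subset_segment _ _ _ hy2)))⟩
  have hyf : y ∈ frontier A := hsegA (openSegment_subset_segment _ _ _ hy)
  obtain ⟨φ, ρ, hρ, hφ, hφd, hmem⟩ := hA.exists_halfPlane hy
  obtain ⟨ρ', hρ', hball⟩ := Metric.eventually_nhds_iff_ball.1
    (eventually_nhdsWithin_iff.1 ((hfc' y hyf).eventually_lt_const hyg))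
  set ρ₀ := min ρ ρ' with hρ₀
  have hρ₀0 : 0 < ρ₀ := lt_min hρ hρ'
  set d : Plane := ‖(σ v : Plane) - v‖⁻¹ • ((σ v : Plane) - v) with hd
  have hd1 : ‖d‖ = 1 := by
    rw [hd, norm_smul, norm_inv, norm_norm, inv_mul_cancel₀ (norm_ne_zero_iff.2 (hA.edge_ne_zero v))]
  have hφd : φ d = 0 := by rw [hd, map_smul, hφd, smul_zero]
  obtain ⟨c, hc, hcH⟩ := exists_between
    (max_lt hgt (hatH_spec hβ (show (0 : ℝ) < 1 / 2 by norm_num)).1)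
  obtain ⟨hgc, hβc⟩ := max_lt_iff.1 hc
  have hrate := poissonRate_lt_of_lt_hatH hβ (by norm_num) hβc hcH
  obtain ⟨e, hre, he1⟩ := exists_between hrate
  refine ae_eventually_exists_hits_lt hX hindep hlaw hβ (hβ.trans_lt hβc) hre hk1 hk ?_
  filter_upwards [(tendsto_rpow_mul_logRadius t he1).eventually_lt_const
    (show 0 < ρ₀ / 6 by positivity), eventually_logRadius_pos ht,
    (tendsto_logRadius t).eventually_lt_const (show 0 < ρ₀ / 2 by positivity),
    eventually_gt_atTop 0] with n h1 h2 h3 h4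
  classical
  have hn0 : (0 : ℝ) < n := by exact_mod_cast h4
  set r := logRadius t n with hr
  -- Centres are placed along the edge at spacing `3 r`, so `m` of them stay within `ρ₀ / 2` of `y`.
  set m : ℕ := ⌊ρ₀ / (6 * r)⌋₊ with hm
  have hm1 : (m : ℝ) * (6 * r) ≤ ρ₀ := by
    rw [← le_div_iff₀ (by positivity)]; exact Nat.floor_le (by positivity)
  have hm2 : ρ₀ / (6 * r) < m + 1 := Nat.lt_floor_add_one _
  let p : ℕ → Plane := fun i => y + (3 * r * i) • d
  have hdist : ∀ i j : ℕ, dist (p i) (p j) = 3 * r * |(i : ℝ) - j| := by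
    intro i j
    have : p i - p j = (3 * r * (i - j)) • d := by
      simp only [p, add_sub_add_left_eq_sub, ← sub_smul]; ring_nf
    rw [dist_eq_norm, this, norm_smul, hd1, mul_one, Real.norm_eq_abs, abs_mul,
      abs_of_pos (by positivity : 0 < 3 * r)]
  have hsep : ∀ i j : ℕ, i ≠ j → r + r < dist (p i) (p j) := by
    intro i j hij
    have h5 : (1 : ℝ) ≤ |(i : ℝ) - j| := by
      have h6 : (1 : ℤ) ≤ |(i : ℤ) - j| := Int.one_le_abs (sub_ne_zero.2 (by exact_mod_cast hij))
      exact_mod_cast h6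
    rw [hdist]
    nlinarith
  have hinj : Function.Injective p := by
    intro i j hij
    by_contra hne
    have := hsep i j hne
    rw [hij, dist_self] at this
    linarith
  have hp : ∀ i < m, p i ∈ Metric.closedBall y (ρ₀ / 2) := by
    intro i hi
    have hi' : (i : ℝ) ≤ m := by exact_mod_cast hi.le
    have h0 : p 0 = y := by simp [p]
    rw [Metric.mem_closedBall, ← h0, hdist, Nat.cast_zero, sub_zero, abs_of_nonneg (Nat.cast_nonneg i)]
    nlinarith
  have hin : ∀ i < m, Metric.closedBall (p i) r ⊆ Metric.ball y ρ₀ := by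
    intro i hi z hz
    have h5 := Metric.mem_closedBall.1 hz
    have h6 := Metric.mem_closedBall.1 (hp i hi)
    rw [Metric.mem_ball]
    linarith [dist_triangle z (p i) y]
  have hφp : ∀ i, φ (p i - y) = 0 := fun i => by
    simp only [p, add_sub_cancel_left, map_smul, hφd, smul_zero]
  refine ⟨(Finset.range m).image p, ?_, ?_, ?_, ?_⟩
  · rw [Finset.card_image_of_injective _ hinj, Finset.card_range]
    have h5 : (n : ℝ) ^ e + 1 < ρ₀ / (6 * r) := by
      rw [lt_div_iff₀ (by positivity)]; linarith
    linarith
  · intro z hz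
    obtain ⟨i, hi, rfl⟩ := Finset.mem_image.1 hz
    have hi := Finset.mem_range.1 hi
    refine (hmem (p i) ?_).2 (hφp i).ge
    exact Metric.ball_subset_ball (min_le_left _ _) (hin i hi (Metric.mem_closedBall_self h2.le))
  · intro z hz z' hz' hne
    obtain ⟨i, hi, rfl⟩ := Finset.mem_image.1 hz
    obtain ⟨j, hj, rfl⟩ := Finset.mem_image.1 hz'
    exact hsep i j fun h => hne (by rw [h])
  · intro z hz
    obtain ⟨i, hi, rfl⟩ := Finset.mem_image.1 hz
    have hi := Finset.mem_range.1 hi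
    have h5 := densityLaw_le_mul_volume (f := f) (B := Metric.closedBall (p i) r)
      (S := Metric.closedBall (p i) r ∩ {z | 0 ≤ φ (z - p i)}) hg0 hA.isClosed.measurableSet
      Metric.isClosed_closedBall.measurableSet
      (fun z hz => (hball z (Metric.ball_subset_ball (min_le_right _ _) (hin i hi hz.2)) hz.1).le)
      (fun z hz => ⟨hz.2, by
        have h6 := (hmem z (Metric.ball_subset_ball (min_le_left _ _) (hin i hi hz.2))).1 hz.1
        rw [show z - y = (z - p i) + (p i - y) by abel, map_add, hφp, add_zero] at h6
        exact h6⟩)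
      (volume_inter_closedBall_ne_top _ _ _)
    have h6 := h5.trans (mul_le_mul_of_nonneg_left (volume_halfDisc_le hφ (p i) h2.le) hg0)
    rw [hr, logRadius_sq ht.le, ← hr] at h6
    have hl : 0 ≤ Real.log n := Real.log_natCast_nonneg n
    calc n * (densityLaw A f).real (Metric.closedBall (p i) r)
        ≤ n * (g * (Real.pi / 2 * (t * Real.log n / n))) := by gcongr
      _ = Real.pi * g / 2 * t * Real.log n := by field_simp
      _ ≤ c * Real.log n := by gcongr

theorem IsPolygon.ae_eventually_exists_hits_lt_vertex {A : Set Plane} {V : Finset Plane}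
    {σ : Equiv.Perm V} (hA : IsPolygon A V σ) (hX : ∀ i, Measurable (X i)) (hindep : iIndepFun X P)
    {f : Plane → ℝ≥0} (hfc : ∀ x ∈ frontier A, ContinuousWithinAt f A x)
    (hlaw : ∀ i, P.map (X i) = densityLaw A f) {t : ℝ} (hβ : 0 ≤ β) (ht : 0 < t)
    (hk1 : ∀ n, 1 ≤ n → 1 ≤ k n)
    (hk : Tendsto (fun n : ℕ => (k n : ℝ) / Real.log n) atTop (𝓝 β)) (v : V)
    (hvt : vertexAngle A σ v / 2 * f v * t < β) :
    ∀ᵐ ω ∂P, ∀ᶠ n in atTop, ∃ x ∈ A,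
      hits (fun i => X i ω) (Metric.closedBall x (logRadius t n)) n < k n := by
  have hvf := hA.vertex_mem_frontier v
  have hvA : (v : Plane) ∈ A := hA.isClosed.frontier_subset hvf
  obtain ⟨φ, ψ, ρ, hρ, -, -, hrep, ⟨hang, hmem⟩ | ⟨hang, -⟩⟩ := hA.exists_sector v
  · have hω0 : 0 ≤ vertexAngle A σ v := hang ▸ InnerProductGeometry.angle_nonneg _ _
    obtain ⟨g, hgt, hvg⟩ : ∃ g, g * (vertexAngle A σ v / 2) * t < β ∧ (f v : ℝ) < g := by
      have hc : Tendsto (fun g : ℝ => g * (vertexAngle A σ v / 2) * t) (𝓝[>] (f v : ℝ))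
          (𝓝 (f v * (vertexAngle A σ v / 2) * t)) :=
        ((by fun_prop : Continuous fun g : ℝ => g * (vertexAngle A σ v / 2) * t).tendsto _).mono_left
          nhdsWithin_le_nhds
      exact ((hc.eventually_lt_const (by linarith)).and self_mem_nhdsWithin).exists
    have hg0 : 0 ≤ g := (f v).2.trans hvg.le
    have hc : ContinuousWithinAt (fun z => (f z : ℝ)) A v :=
      NNReal.continuous_coe.continuousAt.comp_continuousWithinAt (hfc v hvf)
    obtain ⟨ρ', hρ', hball⟩ := Metric.eventually_nhds_iff_ball.1
      (eventually_nhdsWithin_iff.1 (hc.eventually_lt_const hvg))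
    have h := ae_eventually_hits_lt_of_lt (y := (v : Plane)) hX hindep hlaw ht
      (mul_nonneg hg0 (by positivity)) hgt hk (by
        filter_upwards [(eventually_lt_nhds (lt_min hρ hρ')).filter_mono nhdsWithin_le_nhds,
          self_mem_nhdsWithin] with r hr hr0
        have hsub : Metric.closedBall (v : Plane) r ⊆ Metric.ball v (min ρ ρ') :=
          Metric.closedBall_subset_ball hr
        have h5 := densityLaw_le_mul_volume (f := f) (B := Metric.closedBall (v : Plane) r)
          (S := Metric.closedBall (v : Plane) r ∩ {z | 0 ≤ φ (z - v) ∧ 0 ≤ ψ (z - v)}) hg0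
          hA.isClosed.measurableSet Metric.isClosed_closedBall.measurableSet
          (fun z hz => (hball z (Metric.ball_subset_ball (min_le_right _ _) (hsub hz.2)) hz.1).le)
          (fun z hz => ⟨hz.2,
            (hmem z (Metric.ball_subset_ball (min_le_left _ _) (hsub hz.2))).1 hz.1⟩)
          (volume_inter_closedBall_ne_top _ _ _)
        rw [volume_sector (hA.cross_edges_ne_zero v) hrep v hr0, ← hang, ← mul_assoc] at h5
        exact h5)
    filter_upwards [h] with ω hω
    filter_upwards [hω] with n hn
    exact ⟨v, hvA, hn⟩
  -- A reflex vertex has `π ≤ ω_v`, and `β < hatH β (1 / 2)`, so the edge criterion already holds at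
  -- `v`.
  · refine hA.ae_eventually_exists_hits_lt_frontier hX hindep hfc hlaw hβ ht hk1 hk hvf ?_
    refine lt_of_le_of_lt ?_ (hvt.trans (hatH_spec hβ (show (0 : ℝ) < 1 / 2 by norm_num)).1)
    have h1 : Real.pi * f v ≤ vertexAngle A σ v * f v :=
      mul_le_mul_of_nonneg_right hang (f v).2
    nlinarith

end

/-! ### From counts to the coverage threshold -/

theorem encard_image_inter_le_hits {α : Type*} (x : ℕ → α) (B : Set α) (n : ℕ) :
    ((x '' Set.Iio n) ∩ B).encard ≤ hits x B n := by
  classical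
  have h : (x '' Set.Iio n) ∩ B ⊆ x '' ((Finset.range n).filter fun i => x i ∈ B) := by
    rintro _ ⟨⟨i, hi, rfl⟩, hB⟩
    exact ⟨i, by simpa using ⟨hi, hB⟩, rfl⟩
  refine (Set.encard_le_encard h).trans ((Set.encard_image_le _ _).trans ?_)
  rw [Set.encard_coe_eq_coe_finsetCard, ← Nat.count_eq_card_filter_range]
  exact le_of_eq (by rw [hits])

/-- The threshold counts distinct points whereas `hits` counts indices, so this direction needs that
no point is repeated. -/
theorem hits_le_encard_image_inter {α : Type*} {x : ℕ → α} (hx : Function.Injective x)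
    (B : Set α) (n : ℕ) : (hits x B n : ℕ∞) ≤ ((x '' Set.Iio n) ∩ B).encard := by
  classical
  have h : x '' ((Finset.range n).filter fun i => x i ∈ B) ⊆ (x '' Set.Iio n) ∩ B := by
    rintro _ ⟨i, hi, rfl⟩
    have hi : i < n ∧ x i ∈ B := by simpa using hi
    exact ⟨⟨i, hi.1, rfl⟩, hi.2⟩
  refine le_trans ?_ (Set.encard_le_encard h)
  rw [hx.encard_image, Set.encard_coe_eq_coe_finsetCard, ← Nat.count_eq_card_filter_range]
  exact le_of_eq (by rw [hits])

theorem ofReal_le_coverageThreshold {A : Set Plane} {x : ℕ → Plane} {n k : ℕ} {r : ℝ}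
    (h : ∃ a ∈ A, hits x (Metric.closedBall a r) n < k) :
    ENNReal.ofReal r ≤ coverageThreshold A x n k := by
  obtain ⟨a, ha, hlt⟩ := h
  refine le_iInf₂ fun s hs => ENNReal.ofReal_le_ofReal ?_
  by_contra! hsr
  have h1 := (hs.2 a ha).trans (encard_image_inter_le_hits x (Metric.closedBall a s) n)
  have h2 : k ≤ hits x (Metric.closedBall a s) n := by exact_mod_cast h1
  have h3 := hits_mono_set x (Metric.closedBall_subset_closedBall (x := a) hsr.le) n
  omega

theorem coverageThreshold_le_ofReal {A : Set Plane} {x : ℕ → Plane} (hx : Function.Injective x)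
    {n k : ℕ} {r : ℝ} (hr : 0 < r) (h : ∀ a ∈ A, k ≤ hits x (Metric.closedBall a r) n) :
    coverageThreshold A x n k ≤ ENNReal.ofReal r := by
  refine iInf₂_le r ⟨hr, fun a ha => le_trans ?_ (hits_le_encard_image_inter hx _ n)⟩
  exact_mod_cast h a ha

theorem eventually_mul_logRadius_sq_div {t : ℝ} (ht : 0 ≤ t) : ∀ᶠ n : ℕ in atTop,
    (n : ℝ≥0∞) * ENNReal.ofReal (logRadius t n) ^ 2 / ENNReal.ofReal (Real.log n) =
      ENNReal.ofReal t := by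
  filter_upwards [tendsto_log_natCast.eventually_gt_atTop 0, eventually_gt_atTop 0] with n hn hn0
  have hn0' : (0 : ℝ) < n := by exact_mod_cast hn0
  rw [← ENNReal.ofReal_pow (logRadius_nonneg t n), logRadius_sq ht, ← ENNReal.ofReal_natCast,
    ← ENNReal.ofReal_mul hn0'.le, ← ENNReal.ofReal_div_of_pos hn]
  congr 1
  field_simp

/-- By independence a pair has law `μ × μ`, and Fubini makes the diagonal null because `μ` has no
atoms. -/
theorem ae_injective_of_iIndepFun {Ω : Type*} [MeasurableSpace Ω] {P : Measure Ω}
    [IsProbabilityMeasure P] {X : ℕ → Ω → Plane} {μ : Measure Plane}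
    (hX : ∀ i, Measurable (X i)) (hindep : iIndepFun X P) (hlaw : ∀ i, P.map (X i) = μ)
    (hμ : ∀ x, μ {x} = 0) :
    ∀ᵐ ω ∂P, Function.Injective fun i => X i ω := by
  have hprob : IsProbabilityMeasure μ :=
    hlaw 0 ▸ Measure.isProbabilityMeasure_map (hX 0).aemeasurable
  have h : ∀ i j, i ≠ j → ∀ᵐ ω ∂P, X i ω ≠ X j ω := by
    intro i j hij
    have h1 := (indepFun_iff_map_prod_eq_prod_map_map (hX i).aemeasurable
      (hX j).aemeasurable).1 (hindep.indepFun hij)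
    rw [hlaw i, hlaw j] at h1
    have h2 : (μ.prod μ) (Set.diagonal Plane) = 0 := by
      rw [Measure.measure_prod_null measurableSet_diagonal]
      refine Eventually.of_forall fun x => ?_
      have : Prod.mk x ⁻¹' Set.diagonal Plane = {x} := by
        ext y; simp [eq_comm]
      change μ (Prod.mk x ⁻¹' Set.diagonal Plane) = 0
      rw [this, hμ]
    rw [← h1, Measure.map_apply ((hX i).prodMk (hX j)) measurableSet_diagonal] at h2
    exact measure_eq_zero_iff_ae_notMem.1 h2
  have h' : ∀ᵐ ω ∂P, ∀ i j, i ≠ j → X i ω ≠ X j ω :=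
    ae_all_iff.2 fun i => ae_all_iff.2 fun j => by
      by_cases hij : i = j
      · exact Eventually.of_forall fun ω hne => absurd hij hne
      · exact (h i j hij).mono fun ω hω _ => hω
  filter_upwards [h'] with ω hω i j hij
  by_contra hne
  exact hω i j hne hij

/-- The case `q = 0` matches the conventions `b / 0 = ∞` for `b > 0` and `0 / 0 = 0`: a quotient
above `t > 0` then forces `a > 0`. -/
theorem mul_lt_of_ofReal_lt_div {a q t : ℝ} (ht : 0 < t) (hq : 0 ≤ q)
    (h : ENNReal.ofReal t < ENNReal.ofReal a / ENNReal.ofReal q) : q * t < a := by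
  rcases hq.eq_or_lt with rfl | hq
  · rw [zero_mul]
    by_contra! ha
    rw [ENNReal.ofReal_of_nonpos ha, ENNReal.zero_div] at h
    exact not_lt_zero h
  · rw [← ENNReal.ofReal_div_of_pos hq, ENNReal.ofReal_lt_ofReal_iff_of_nonneg ht.le,
      lt_div_iff₀ hq] at h
    linarith

theorem lt_mul_of_div_lt_ofReal {a q t : ℝ} (hq : 0 < q) (ha : 0 ≤ a)
    (h : ENNReal.ofReal a / ENNReal.ofReal q < ENNReal.ofReal t) : a < q * t := by
  rw [← ENNReal.ofReal_div_of_pos hq,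
    ENNReal.ofReal_lt_ofReal_iff_of_nonneg (div_nonneg ha hq.le), div_lt_iff₀ hq] at h
  linarith

theorem pos_of_div_lt_ofReal {a q t : ℝ} (hq : 0 ≤ q) (ha : 0 < a)
    (h : ENNReal.ofReal a / ENNReal.ofReal q < ENNReal.ofReal t) : 0 < q := by
  refine hq.lt_of_ne' fun h0 => ?_
  rw [h0, ENNReal.ofReal_zero, ENNReal.div_zero (ENNReal.ofReal_pos.2 ha).ne'] at h
  exact not_top_lt h

theorem IsPolygon.vertexAngle_pos {A : Set Plane} {V : Finset Plane} {σ : Equiv.Perm V}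
    (hA : IsPolygon A V σ) (v : V) : 0 < vertexAngle A σ v := by
  obtain ⟨φ, ψ, ρ, -, -, -, -, ⟨hang, -⟩ | ⟨hang, -⟩⟩ := hA.exists_sector v
  · rw [hang]
    exact angle_pos_of_planeCross_ne_zero (hA.cross_edges_ne_zero v)
  · exact Real.pi_pos.trans_le hang

theorem IsPolygon.frontier_nonempty {A : Set Plane} {V : Finset Plane} {σ : Equiv.Perm V}
    (hA : IsPolygon A V σ) : (frontier A).Nonempty :=
  nonempty_frontier_iff.2 ⟨hA.isConnected.nonempty, hA.isCompact.ne_univ⟩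

/-- An infinite essential infimum of a finite function would make `A` null and the law zero. -/
theorem essInf_coe_ne_top {A : Set Plane} {f : Plane → ℝ≥0} [IsProbabilityMeasure (densityLaw A f)] :
    essInf (fun x => (f x : ℝ≥0∞)) (volume.restrict A) ≠ ∞ := by
  intro htop
  have h1 : ∀ᵐ x ∂(volume.restrict A), False := by
    filter_upwards [ae_essInf_le (f := fun x => (f x : ℝ≥0∞)) (μ := volume.restrict A)] with x hx
    rw [htop] at hx
    exact ENNReal.coe_ne_top (top_le_iff.1 hx)
  have h2 : volume.restrict A = 0 := by
    rwa [ae_iff, show {a : Plane | ¬ False} = Set.univ by ext; simp, Measure.measure_univ_eq_zero] at h1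
  have h3 : densityLaw A f = 0 := by rw [densityLaw, h2, withDensity_zero_left]
  exact IsProbabilityMeasure.ne_zero (densityLaw A f) h3

theorem volume_lt_ne_zero_of_essInf_lt {A : Set Plane} (hA : MeasurableSet A) {f : Plane → ℝ≥0}
    {g : ℝ}
    (h : essInf (fun x => (f x : ℝ≥0∞)) (volume.restrict A) < ENNReal.ofReal g) :
    volume {x | x ∈ A ∧ (f x : ℝ) < g} ≠ 0 := by
  intro h0
  refine absurd (le_essInf_of_ae_le (ENNReal.ofReal g) ?_) (not_le.2 h)
  rw [EventuallyLE, ae_restrict_iff' hA]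
  filter_upwards [measure_eq_zero_iff_ae_notMem.1 h0] with x hx hxA
  rw [← ENNReal.ofReal_coe_nnreal]
  exact ENNReal.ofReal_le_ofReal (not_lt.1 fun hlt => hx ⟨hxA, hlt⟩)

theorem hatH_zero {x : ℝ} (hx : 0 ≤ x) : hatH 0 x = x :=
  ((eq_hatH_iff le_rfl hx).2 ⟨by simp [rateH], hx⟩).symm

/-! ### The almost sure limit -/

section
variable {A : Set Plane} {V : Finset Plane} {σ : Equiv.Perm V} {f : Plane → ℝ≥0}
  {Ω : Type*} [MeasurableSpace Ω] {P : Measure Ω} [IsProbabilityMeasure P] {X : ℕ → Ω → Plane}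
  {β : ℝ} {k : ℕ → ℕ}

/-- The limit of the normalized coverage threshold. -/
noncomputable def coverageLimit (A : Set Plane) {V : Finset Plane} (σ : Equiv.Perm V)
    (f : Plane → ℝ≥0) (β : ℝ) : ℝ≥0∞ :=
  max (ENNReal.ofReal (hatH β 1) /
      (ENNReal.ofReal Real.pi * essInf (fun x => (f x : ℝ≥0∞)) (volume.restrict A)))
    (max (ENNReal.ofReal (2 * hatH β (1 / 2)) /
        (ENNReal.ofReal Real.pi * ⨅ x ∈ frontier A, (f x : ℝ≥0∞)))
      (⨆ v : V, ENNReal.ofReal (2 * β) /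
        (ENNReal.ofReal (vertexAngle A σ v) * (f v : ℝ≥0∞))))

theorem ofReal_mul_coe_eq {a : ℝ} (ha : 0 ≤ a) {F : ℝ≥0∞} (hF : F ≠ ∞) :
    ENNReal.ofReal a * F = ENNReal.ofReal (a * F.toReal) := by
  rw [ENNReal.ofReal_mul ha, ENNReal.ofReal_toReal hF]

theorem IsPolygon.iInf_frontier_ne_top (hA : IsPolygon A V σ) :
    ⨅ x ∈ frontier A, (f x : ℝ≥0∞) ≠ ∞ := by
  obtain ⟨x, hx⟩ := hA.frontier_nonempty
  exact ne_top_of_le_ne_top (ENNReal.coe_ne_top (r := f x)) (iInf₂_le x hx)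

/-- An intermediate `s` is inserted: the mass conditions hold at `s`, and the gap from `s` to `t`
pays for the passage from the subsequence to all `n`. Finiteness of the limit forces the infima of
`f` to be positive. -/
theorem IsPolygon.ae_eventually_le (hA : IsPolygon A V σ)
    (hfc : ∀ x ∈ frontier A, ContinuousWithinAt f A x)
    (hX : ∀ i, Measurable (X i)) (hindep : iIndepFun X P)
    (hlaw : ∀ i, P.map (X i) = densityLaw A f) (hβ : 0 ≤ β)
    (hk : Tendsto (fun n : ℕ => (k n : ℝ) / Real.log n) atTop (𝓝 β)) {t : ℝ}
    (ht : coverageLimit A σ f β < ENNReal.ofReal t) :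
    ∀ᵐ ω ∂P, ∀ᶠ n : ℕ in atTop, (n : ℝ≥0∞) * coverageThreshold A (fun i => X i ω) n (k n) ^ 2 /
      ENNReal.ofReal (Real.log n) ≤ ENNReal.ofReal t := by
  have hprob : IsProbabilityMeasure (densityLaw A f) :=
    hlaw 0 ▸ Measure.isProbabilityMeasure_map (hX 0).aemeasurable
  have hac : densityLaw A f ≪ volume :=
    (withDensity_absolutelyContinuous _ _).trans Measure.restrict_le_self.absolutelyContinuous
  obtain ⟨s, -, hs, hst⟩ := ENNReal.lt_iff_exists_real_btwn.1 ht
  have hs0 : 0 < s := ENNReal.ofReal_pos.1 (bot_le.trans_lt hs)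
  have hst : s < t := (ENNReal.ofReal_lt_ofReal_iff_of_nonneg hs0.le).1 hst
  set E := essInf (fun x => (f x : ℝ≥0∞)) (volume.restrict A)
  have hE : E ≠ ∞ := essInf_coe_ne_top
  have hI : ⨅ x ∈ frontier A, (f x : ℝ≥0∞) ≠ ∞ := hA.iInf_frontier_ne_top
  set F₁ := (⨅ x ∈ frontier A, (f x : ℝ≥0∞)).toReal
  obtain ⟨h₀, h₁₂⟩ := max_lt_iff.1 hs
  obtain ⟨h₁, h₂⟩ := max_lt_iff.1 h₁₂
  rw [ofReal_mul_coe_eq Real.pi_pos.le hE] at h₀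
  rw [ofReal_mul_coe_eq Real.pi_pos.le hI] at h₁
  have hh1 : 0 < hatH β 1 := hβ.trans_lt (hatH_spec hβ one_pos).1
  have hh2 : 0 < hatH β (1 / 2) := hβ.trans_lt (hatH_spec hβ (by norm_num)).1
  have hF₀pos : 0 < Real.pi * E.toReal := pos_of_div_lt_ofReal (by positivity) hh1 h₀
  have hF₁pos : 0 < Real.pi * F₁ := pos_of_div_lt_ofReal (by positivity) (by positivity) h₁
  have hF₁ : 0 < F₁ := pos_of_mul_pos_right hF₁pos Real.pi_pos.le
  have hle₁ : ∀ z ∈ frontier A, F₁ ≤ f z := fun z hz =>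
    ENNReal.toReal_mono ENNReal.coe_ne_top (iInf₂_le z hz)
  have hle₀ : ∀ᵐ z ∂(volume.restrict A), E.toReal ≤ f z := by
    filter_upwards [ae_essInf_le (f := fun x => (f x : ℝ≥0∞)) (μ := volume.restrict A)] with z hz
    exact ENNReal.toReal_mono ENNReal.coe_ne_top hz
  have hv : ∀ v : V, β < vertexAngle A σ v / 2 * f v * s := by
    intro v
    have h3 := (le_iSup (fun v : V => ENNReal.ofReal (2 * β) /
        (ENNReal.ofReal (vertexAngle A σ v) * (f v : ℝ≥0∞))) v).trans_lt h₂
    have hfv : 0 < (f v : ℝ) := hF₁.trans_le (hle₁ v (hA.vertex_mem_frontier v))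
    rw [ofReal_mul_coe_eq (hA.vertexAngle_pos v).le ENNReal.coe_ne_top] at h3
    have h4 := lt_mul_of_div_lt_ofReal (mul_pos (hA.vertexAngle_pos v) hfv) (by positivity) h3
    linarith
  have h₀' := lt_mul_of_div_lt_ofReal hF₀pos hh1.le h₀
  have h₁' := lt_mul_of_div_lt_ofReal hF₁pos (by positivity) h₁
  obtain ⟨b, hb, hae⟩ := (hA.rareShortage hfc hX hindep hlaw hβ hs0 ENNReal.toReal_nonneg hF₁
    hle₀ hle₁ h₀' (by linarith) hv).ae_eventually hβ hs0 hst
  have ht0 : 0 < t := hs0.trans hst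
  filter_upwards [hae, ae_injective_of_iIndepFun hX hindep hlaw
    fun x => hac (measure_singleton x)] with ω hω hinj
  filter_upwards [hω, eventually_mul_logRadius_sq_div ht0.le, eventually_logRadius_pos ht0,
    hk.eventually_lt_const hb, tendsto_log_natCast.eventually_gt_atTop 0] with n h3 h4 h5 h6 h7
  rw [← h4]
  rw [div_lt_iff₀ h7] at h6
  have h8 := coverageThreshold_le_ofReal (A := A) hinj (k := k n) (n := n) h5 fun a ha => by
    exact_mod_cast h6.le.trans (h3 a ha)
  gcongr

/-- Being below a maximum means being below one of its terms, and each term has its own source of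
poorly filled discs. -/
theorem IsPolygon.ae_eventually_ge (hA : IsPolygon A V σ) (hf : Measurable f)
    (hfc : ∀ x ∈ frontier A, ContinuousWithinAt f A x)
    (hX : ∀ i, Measurable (X i)) (hindep : iIndepFun X P)
    (hlaw : ∀ i, P.map (X i) = densityLaw A f) (hβ : 0 ≤ β) (hk1 : ∀ n, 1 ≤ n → 1 ≤ k n)
    (hk : Tendsto (fun n : ℕ => (k n : ℝ) / Real.log n) atTop (𝓝 β)) {t : ℝ} (ht0 : 0 < t)
    (ht : ENNReal.ofReal t < coverageLimit A σ f β) :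
    ∀ᵐ ω ∂P, ∀ᶠ n : ℕ in atTop, ENNReal.ofReal t ≤
      (n : ℝ≥0∞) * coverageThreshold A (fun i => X i ω) n (k n) ^ 2 /
        ENNReal.ofReal (Real.log n) := by
  have hprob : IsProbabilityMeasure (densityLaw A f) :=
    hlaw 0 ▸ Measure.isProbabilityMeasure_map (hX 0).aemeasurable
  have key : ∀ᵐ ω ∂P, ∀ᶠ n in atTop, ∃ x ∈ A,
      hits (fun i => X i ω) (Metric.closedBall x (logRadius t n)) n < k n := by
    have hlim : ∀ a c F : ℝ, Real.pi * F * a < c → ∃ g, Real.pi * g * a < c ∧ F < g := by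
      intro a c F h
      have hc : Tendsto (fun g : ℝ => Real.pi * g * a) (𝓝[>] F) (𝓝 (Real.pi * F * a)) :=
        ((by fun_prop : Continuous fun g : ℝ => Real.pi * g * a).tendsto _).mono_left
          nhdsWithin_le_nhds
      exact ((hc.eventually_lt_const h).and self_mem_nhdsWithin).exists
    rcases lt_max_iff.1 ht with h | h
    · have hE := essInf_coe_ne_top (A := A) (f := f)
      rw [ofReal_mul_coe_eq Real.pi_pos.le hE] at h
      obtain ⟨g, hg, hFg⟩ := hlim _ _ _ (mul_lt_of_ofReal_lt_div ht0 (by positivity) h)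
      exact ae_eventually_exists_hits_lt_interior hX hindep hA.isClosed.measurableSet hf hlaw hβ ht0
        hk1 hk (volume_lt_ne_zero_of_essInf_lt hA.isClosed.measurableSet
          ((ENNReal.lt_ofReal_iff_toReal_lt hE).2 hFg)) hg
    rcases lt_max_iff.1 h with h | h
    · have hI := hA.iInf_frontier_ne_top (f := f)
      rw [ofReal_mul_coe_eq Real.pi_pos.le hI] at h
      obtain ⟨g, hg, hFg⟩ := hlim _ _ _ (mul_lt_of_ofReal_lt_div ht0 (by positivity) h)
      have hlt := (ENNReal.lt_ofReal_iff_toReal_lt hI).2 hFg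
      obtain ⟨x, hx⟩ := iInf_lt_iff.1 hlt
      obtain ⟨hxf, hxg⟩ := iInf_lt_iff.1 hx
      rw [← ENNReal.ofReal_coe_nnreal] at hxg
      have hxg := (ENNReal.ofReal_lt_ofReal_iff_of_nonneg (f x).2).1 hxg
      refine hA.ae_eventually_exists_hits_lt_frontier hX hindep hfc hlaw hβ ht0 hk1 hk hxf ?_
      have h3 : Real.pi * f x * t ≤ Real.pi * g * t :=
        mul_le_mul_of_nonneg_right (mul_le_mul_of_nonneg_left hxg.le Real.pi_pos.le) ht0.le
      linarith
    · obtain ⟨v, hv⟩ := lt_iSup_iff.1 h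
      rw [ofReal_mul_coe_eq (hA.vertexAngle_pos v).le ENNReal.coe_ne_top] at hv
      have h3 : vertexAngle A σ v * (f v : ℝ) * t < 2 * β := mul_lt_of_ofReal_lt_div ht0
        (mul_nonneg (hA.vertexAngle_pos v).le (f v).2) hv
      exact hA.ae_eventually_exists_hits_lt_vertex hX hindep hfc hlaw hβ ht0 hk1 hk v (by linarith)
  filter_upwards [key] with ω hω
  filter_upwards [hω, eventually_mul_logRadius_sq_div ht0.le] with n h1 h2
  rw [← h2]
  have h3 := ofReal_le_coverageThreshold h1
  gcongr

theorem IsPolygon.ae_tendsto_coverageThreshold (hA : IsPolygon A V σ) (hf : Measurable f)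
    (hfc : ∀ x ∈ frontier A, ContinuousWithinAt f A x)
    (hX : ∀ i, Measurable (X i)) (hindep : iIndepFun X P)
    (hlaw : ∀ i, P.map (X i) = densityLaw A f) (hβ : 0 ≤ β) (hk1 : ∀ n, 1 ≤ n → 1 ≤ k n)
    (hk : Tendsto (fun n : ℕ => (k n : ℝ) / Real.log n) atTop (𝓝 β)) :
    ∀ᵐ ω ∂P, Tendsto (fun n : ℕ => (n : ℝ≥0∞) * coverageThreshold A (fun i => X i ω) n (k n) ^ 2 /
      ENNReal.ofReal (Real.log n)) atTop (𝓝 (coverageLimit A σ f β)) := by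
  -- Rational levels suffice to determine the limit and involve only countably many exceptional null
  -- sets.
  have hge : ∀ᵐ ω ∂P, ∀ q : ℚ, 0 < (q : ℝ) → ENNReal.ofReal q < coverageLimit A σ f β →
      ∀ᶠ n : ℕ in atTop, ENNReal.ofReal q ≤ (n : ℝ≥0∞) *
        coverageThreshold A (fun i => X i ω) n (k n) ^ 2 / ENNReal.ofReal (Real.log n) := by
    refine ae_all_iff.2 fun q => ?_
    by_cases h : 0 < (q : ℝ) ∧ ENNReal.ofReal q < coverageLimit A σ f β
    · exact (hA.ae_eventually_ge hf hfc hX hindep hlaw hβ hk1 hk h.1 h.2).mono fun ω hω _ _ => hω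
    · exact Eventually.of_forall fun ω h1 h2 => absurd ⟨h1, h2⟩ h
  have hle : ∀ᵐ ω ∂P, ∀ q : ℚ, coverageLimit A σ f β < ENNReal.ofReal q →
      ∀ᶠ n : ℕ in atTop, (n : ℝ≥0∞) * coverageThreshold A (fun i => X i ω) n (k n) ^ 2 /
        ENNReal.ofReal (Real.log n) ≤ ENNReal.ofReal q := by
    refine ae_all_iff.2 fun q => ?_
    by_cases h : coverageLimit A σ f β < ENNReal.ofReal q
    · exact (hA.ae_eventually_le hfc hX hindep hlaw hβ hk h).mono fun ω hω _ => hω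
    · exact Eventually.of_forall fun ω h1 => absurd h1 h
  filter_upwards [hge, hle] with ω h1 h2
  refine tendsto_order.2 ⟨fun a ha => ?_, fun a ha => ?_⟩
  · obtain ⟨q, -, haq, hq⟩ := ENNReal.lt_iff_exists_rat_btwn.1 ha
    have haq : a < ENNReal.ofReal q := haq
    exact (h1 q (ENNReal.ofReal_pos.1 (bot_le.trans_lt haq)) hq).mono fun n hn => haq.trans_le hn
  · obtain ⟨q, -, hq, hqa⟩ := ENNReal.lt_iff_exists_rat_btwn.1 ha
    exact (h2 q hq).mono fun n hn => hn.trans_lt hqa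

end

theorem mainTheorem11
    {A : Set Plane} {V : Finset Plane} {σ : Equiv.Perm V} (hA : IsPolygon A V σ)
    {f : Plane → ℝ≥0} (hf : Measurable f)
    (hfc : ∀ x ∈ frontier A, ContinuousWithinAt f A x)
    {Ω : Type*} [MeasurableSpace Ω] {P : Measure Ω} [IsProbabilityMeasure P]
    {X : ℕ → Ω → Plane} (hX : ∀ i, Measurable (X i)) (hindep : iIndepFun X P)
    (hlaw : ∀ i, P.map (X i) = (volume.restrict A).withDensity (fun x => (f x : ℝ≥0∞)))
    {f₀ f₁ : ℝ≥0∞}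
    (hf₀ : f₀ = essInf (fun x => (f x : ℝ≥0∞)) (volume.restrict A))
    (hf₁ : f₁ = ⨅ x ∈ frontier A, (f x : ℝ≥0∞)) :
    (∀ (β : ℝ) (k : ℕ → ℕ), 0 ≤ β → (∀ n, 1 ≤ n → 1 ≤ k n) →
      Tendsto (fun n : ℕ => (k n : ℝ) / Real.log n) atTop (𝓝 β) →
      Tendsto (fun n : ℕ => (k n : ℝ) / n) atTop (𝓝 0) →
      ∀ᵐ ω ∂P, Tendsto
        (fun n : ℕ => (n : ℝ≥0∞) * coverageThreshold A (fun i => X i ω) n (k n) ^ 2 /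
          ENNReal.ofReal (Real.log n))
        atTop
        (𝓝 (max (ENNReal.ofReal (hatH β 1) / (ENNReal.ofReal Real.pi * f₀))
          (max (ENNReal.ofReal (2 * hatH β (1 / 2)) / (ENNReal.ofReal Real.pi * f₁))
            (⨆ v : V, ENNReal.ofReal (2 * β) /
              (ENNReal.ofReal (vertexAngle A σ v) * (f v : ℝ≥0∞))))))) ∧
    (∀ k : ℕ, 1 ≤ k →
      ∀ᵐ ω ∂P, Tendsto
        (fun n : ℕ => (n : ℝ≥0∞) * ENNReal.ofReal Real.pi *
          coverageThreshold A (fun i => X i ω) n k ^ 2 / ENNReal.ofReal (Real.log n))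
        atTop
        (𝓝 (max (1 / f₀) (1 / f₁)))) := by
  subst hf₀ hf₁
  refine ⟨fun β k hβ hk1 hk _ =>
    hA.ae_tendsto_coverageThreshold hf hfc hX hindep hlaw hβ hk1 hk, fun k hk1 => ?_⟩
  have hk : Tendsto (fun n : ℕ => ((fun _ : ℕ => k) n : ℝ) / Real.log n) atTop (𝓝 0) :=
    tendsto_const_nhds.div_atTop tendsto_log_natCast
  have hπ : ENNReal.ofReal Real.pi ≠ 0 := (ENNReal.ofReal_pos.2 Real.pi_pos).ne'
  filter_upwards [hA.ae_tendsto_coverageThreshold (k := fun _ => k) hf hfc hX hindep hlaw le_rfl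
    (fun _ _ => hk1) hk] with ω hω
  have h := ENNReal.Tendsto.const_mul (a := ENNReal.ofReal Real.pi) hω
    (Or.inr ENNReal.ofReal_ne_top)
  -- For `β = 0` the function `hatH` is the identity: the factor `2` cancels `1 / 2`, and the vertex
  -- terms vanish, also where `f v = 0`, since `0 / 0 = 0`.
  have hlim : ENNReal.ofReal Real.pi * coverageLimit A σ f 0 =
      max (1 / essInf (fun x => (f x : ℝ≥0∞)) (volume.restrict A))
        (1 / ⨅ x ∈ frontier A, (f x : ℝ≥0∞)) := by
    have hmul : Monotone fun x : ℝ≥0∞ => ENNReal.ofReal Real.pi * x :=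
      fun x y hxy => mul_le_mul_right hxy _
    have hcancel : ∀ F : ℝ≥0∞, ENNReal.ofReal Real.pi * (1 / (ENNReal.ofReal Real.pi * F)) = 1 / F :=
      fun F => by rw [← mul_div_assoc, ENNReal.mul_div_mul_left _ _ hπ ENNReal.ofReal_ne_top]
    have h2 : (2 : ℝ) * (1 / 2) = 1 := by norm_num
    rw [coverageLimit, hatH_zero zero_le_one, hatH_zero (by norm_num), h2, mul_zero,
      ENNReal.ofReal_zero, ENNReal.ofReal_one]
    have h3 : (⨆ _ : V, (0 : ℝ≥0∞)) = 0 := by simp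
    simp only [ENNReal.zero_div]
    rw [h3, max_eq_left (zero_le (a := 1 / (ENNReal.ofReal Real.pi * ⨅ x ∈ frontier A, (f x : ℝ≥0∞)))),
      hmul.map_max, hcancel, hcancel]
  rw [hlim] at h
  refine h.congr fun n => ?_
  rw [← mul_div_assoc]
  congr 1
  ring
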